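/- **Setting.** Let $K$ be a local field of characteristic zero with absolute value $|\cdot|$, let $K_0=K\setminus\{0\}$, and let $f(x)=\sum_\alpha f_\alpha x^\alpha$ be a nontrivial power series convergent on an open set $U\ni 0$ in $K^n$, with $f(0)=0$. The Newton polyhedron $N(f)$ is the convex hull of the orthants $\{t\in\mathbf R^n: t_l\ge\alpha_l \text{ for all } l\}$ over all $\alpha$ with $f_\alpha\ne0$, and $v(f)$ is its set of vertices. For each $i$ let $F_{i1},F_{i2},\dots$ be a fixed enumeration of the compact faces of $N(f)$ of dimension $i$ (vertices being the faces of dimension $0$). Put $f_{F_{ij}}(x)=\sum_{\alpha\in F_{ij}}f_\alpha x^\alpha$, and let $o_{ij}$ be the maximum order of any zero of $f_{F_{ij}}$ on $K_0^n$ ($o_{ij}=0$ if there is no zero). *Regions.* Given constants $C_1,\dots,C_n>0$, let $E=\{x\in K_0^n:|x_l|<C_n^{-1}\text{ for all }l\}$. Going through the faces in the order of decreasing $i$ and, for equal $i$, of increasing $j$, let $A_{ij}$ be the set of $x\in E$ which lie in none of the previously defined regions and satisfy $$\sup_{v\in v(f)\cap F_{ij}}|x^v|=\sup_{v\in v(f)}|x^v|,\qquad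 \inf_{v\in v(f)\cap F_{ij}}|x^v|\ge C_i^{-1}\sup_{v\in v(f)}|x^v|,$$ the second condition being omitted when $i=0$. *Blowups.* Start with $\{x\in K_0^n:|x_l|\le1\text{ for all }l\}$. Repeatedly choose a current piece and two variables $x_a,x_b$ with $a\neq b$, divide the piece into its parts $|x_a|\le|x_b|$ and $|x_a|>|x_b|$, and replace each part by its inverse image in $K_0^n$ under the blowup that sends $x_a$ to $x_ax_b$ (on the first part), respectively $x_b$ to $x_ax_b$ (on the second part), and leaves the other variables fixed. Fix any finite sequence of such steps with final pieces $E_1,\dots,E_q$ such that, if $\gamma_k$ denotes the composition of the blowups leading to $E_k$ and $x^{L_k(\alpha)}$ denotes the monomial $x^\alpha\circ\gamma_k$, then for each $k$ the exponents $L_k(v)$, $v\in v(f)$, are linearly ordered under the componentwise order. Let $A_{ijk}'=\gamma_k^{-1}(A_{ij})\cap E_k$. *Variables.* For $i>0$, let $L_k(v')$ be the least of the exponents $L_k(v)$, $v\in v(f)$, and let $L_k(v'')$ be the greatest of the exponents $L_k(v)$, $v\in v(f)\cap F_{ij}$. The variables $x_r$ with $L_k(v')_r<L_k(v'')_r$ are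 called $z_1,\dots,z_d$, and the others are called the $y$ variables. Let $\alpha_{ijk}$ be the exponent for which $y^{\alpha_{ijk}}$ is the $y$-part of $x^{L_k(v)}$, $v\in v(f)\cap F_{ij}$ (it is the same for all these $v$ when $A_{ijk}'\ne\emptyset$; in general take the componentwise minimum). Write $f\circ\gamma_k=y^{\alpha_{ijk}}F_{ijk}(y,z)$ on $K_0^n$. For $i=0$, $F_{0j}$ is a single vertex $v$ and all variables are called $y$; then write $f\circ\gamma_k=y^{\alpha_{0jk}}F_{0jk}(y)$ on $K_0^n$, where $\alpha_{0jk}=L_k(v)$. **Lemma 3.4.** If the constants $C_i$ increase sufficiently quickly, the following holds. (That is, there is a function $T:\mathbf R\to\mathbf R$, depending on the data above, such that the following holds for all $C_1,\dots,C_n$ with $C_1>T(1)$ and $C_{i+1}>T(C_i)$ for $1\le i<n$.) a) Let $i>0$, let $\pi(y,z)=z$, and let $B_{ijk}=\pi(A_{ijk}')$. Then $B_{ijk}$ is a finite union $\bigcup_l B_{ijkl}$ such that for each $l$ there are rational numbers $\beta_1,\dots,\beta_d$ with $\sum_m|\beta_m|=1$ (ordinary absolute values of rational numbers), an integer $0\le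 p\le o_{ij}$ and a constant $\delta_{ijkl}>0$ such that for all $(y,z)\in A_{ijk}'$ with $z\in B_{ijkl}$ $$\Big|\Big(\sum_m\beta_m\partial_{z_m}\Big)^pF_{ijk}(y,z)\Big|\ge\delta_{ijkl};$$ equivalently, $\big|(\sum_m\beta_m\partial_{z_m})^p(f\circ\gamma_k)(y,z)\big|\ge\delta_{ijkl}\,|y^{\alpha_{ijk}}|$. b) Let $i=0$. Then there is a constant $\delta_{0jk}>0$ such that for all $y\in A_{0jk}'$ one has $|F_{0jk}(y)|\ge\delta_{0jk}$; equivalently, $|f\circ\gamma_k(y)|\ge\delta_{0jk}\,|y^{\alpha_{0jk}}|$. -/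

import Mathlib

noncomputable section

namespace NewtonBlowup

/-! Monomials and Newton polyhedra. A power series in `n` variables is given by its family of
coefficients `c : (Fin n → ℕ) → K`. -/

/-- The monomial `x ^ α`. -/
def mono {K : Type*} [CommMonoid K] {n : ℕ} (x : Fin n → K) (α : Fin n → ℕ) : K :=
  ∏ l, x l ^ α l

/-- A multi-index regarded as a point of `ℝⁿ`. -/
def toReal {n : ℕ} (α : Fin n → ℕ) : Fin n → ℝ := fun l => (α l : ℝ)

/-- The torus `K₀ⁿ`, where `K₀ = K \ {0}`. -/
def torus (K : Type*) [Zero K] (n : ℕ) : Set (Fin n → K) := {x | ∀ l, x l ≠ 0}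

/-- The Newton polyhedron: the convex hull of the orthants `α + [0, ∞)ⁿ` with `c α ≠ 0`. -/
def newtonPolyhedron {K : Type*} [Zero K] {n : ℕ} (c : (Fin n → ℕ) → K) : Set (Fin n → ℝ) :=
  convexHull ℝ (⋃ α ∈ {α | c α ≠ 0}, {t | ∀ l, (α l : ℝ) ≤ t l})

/-- The vertices of the Newton polyhedron (all of them are lattice points). -/
def vertices {K : Type*} [Zero K] {n : ℕ} (c : (Fin n → ℕ) → K) : Set (Fin n → ℕ) :=
  {v | toReal v ∈ (newtonPolyhedron c).extremePoints ℝ}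

/-- The vertices of the Newton polyhedron that lie on `F`. -/
def verticesOn {K : Type*} [Zero K] {n : ℕ} (c : (Fin n → ℕ) → K) (F : Set (Fin n → ℝ)) :
    Set (Fin n → ℕ) :=
  {v | v ∈ vertices c ∧ toReal v ∈ F}

/-- The compact faces of dimension `i` of the Newton polyhedron. -/
def compactFaces {K : Type*} [Zero K] {n : ℕ} (c : (Fin n → ℕ) → K) (i : ℕ) :
    Set (Set (Fin n → ℝ)) :=
  {F | F.Nonempty ∧ IsCompact F ∧ IsExposed ℝ (newtonPolyhedron c) F ∧
    Module.finrank ℝ (vectorSpan ℝ F) = i}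

/-- The polynomial `f_F`, the sum of the terms `c α x ^ α` with `α ∈ F`
(finitely many when `F` is bounded). -/
def facePoly {K : Type*} [Field K] {n : ℕ} (c : (Fin n → ℕ) → K) (F : Set (Fin n → ℝ)) :
    MvPolynomial (Fin n) K :=
  ∑ᶠ α ∈ {α : Fin n → ℕ | toReal α ∈ F},
    MvPolynomial.monomial (Finsupp.equivFunOnFinite.symm α) (c α)

/-- The order of vanishing of `P` at `a`: the least total degree of a nonzero term of the
expansion of `P` in powers of `x - a`. -/
def zeroOrder {K : Type*} [Field K] {n : ℕ} (P : MvPolynomial (Fin n) K) (a : Fin n → K) : ℕ∞ :=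
  MvPowerSeries.order
    ((MvPolynomial.bind₁ (fun l => MvPolynomial.X l + MvPolynomial.C (a l)) P :
      MvPolynomial (Fin n) K) : MvPowerSeries (Fin n) K)

/-- The maximum order of a zero of `P` on `K₀ⁿ` (it is `0` if there is no such zero). -/
def maxZeroOrder {K : Type*} [Field K] {n : ℕ} (P : MvPolynomial (Fin n) K) : ℕ∞ :=
  ⨆ a ∈ {a : Fin n → K | a ∈ torus K n ∧ MvPolynomial.eval a P = 0}, zeroOrder P a

/-! The regions `A i j`. -/

/-- The cube `{x ∈ K₀ⁿ : |x_l| < (C n)⁻¹ for all l}`. -/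
def cube (K : Type*) [NormedField K] (n : ℕ) (C : ℕ → ℝ) : Set (Fin n → K) :=
  {x | x ∈ torus K n ∧ ∀ l, ‖x l‖ < (C n)⁻¹}

/-- The face `F` of dimension `i` dominates at `x`: the largest `|x ^ v|` is attained on `F`, and
if `i > 0`, all `|x ^ v|` with `v` on `F` are within a factor `C i` of it. -/
def Dominates {K : Type*} [NormedField K] {n : ℕ} (c : (Fin n → ℕ) → K) (C : ℕ → ℝ)
    (i : ℕ) (F : Set (Fin n → ℝ)) (x : Fin n → K) : Prop :=
  (⨆ v : verticesOn c F, ‖mono x v.1‖) = (⨆ v : vertices c, ‖mono x v.1‖) ∧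
    (0 < i → (C i)⁻¹ * (⨆ v : vertices c, ‖mono x v.1‖) ≤ ⨅ v : verticesOn c F, ‖mono x v.1‖)

/-- The region `A i j`, for an enumeration `F i j` of the compact faces of dimension `i`: points of
the cube at which `F i j` dominates and no earlier face does. The faces are taken in the order of
decreasing `i`, and of increasing `j` for equal `i`. -/
def region {K : Type*} [NormedField K] {n : ℕ} (c : (Fin n → ℕ) → K) (C : ℕ → ℝ)
    {κ : ℕ → ℕ} (F : (i : ℕ) → Fin (κ i) → Set (Fin n → ℝ)) (i : ℕ) (j : Fin (κ i)) :
    Set (Fin n → K) :=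
  {x | x ∈ cube K n C ∧ Dominates c C i (F i j) x ∧
    ∀ (i' : ℕ) (j' : Fin (κ i')), (i < i' ∨ (i' = i ∧ (j' : ℕ) < j)) →
      ¬ Dominates c C i' (F i' j') x}

/-- The regions satisfy the recursion: a point of the cube is put into `A i j` if and only if
`F i j` dominates there and the point was not put into an earlier region. -/
theorem mem_region_iff {K : Type*} [NormedField K] {n : ℕ} (c : (Fin n → ℕ) → K) (C : ℕ → ℝ)
    {κ : ℕ → ℕ} (F : (i : ℕ) → Fin (κ i) → Set (Fin n → ℝ))
    (hF : ∀ i j, F i j ∈ compactFaces c i) (i : ℕ) (j : Fin (κ i)) (x : Fin n → K) :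
    x ∈ region c C F i j ↔ x ∈ cube K n C ∧ Dominates c C i (F i j) x ∧
      ∀ (i' : ℕ) (j' : Fin (κ i')), (i < i' ∨ (i' = i ∧ (j' : ℕ) < j)) →
        x ∉ region c C F i' j' := by
  have hdim : ∀ i, Fin (κ i) → i ≤ n := by
    intro i j
    have h := (hF i j).2.2.2
    have h' := Submodule.finrank_le (vectorSpan ℝ (F i j))
    simp only [Module.finrank_fintype_fun_eq_card, Fintype.card_fin] at h'
    omega
  have key : ∀ (N : ℕ) (i : ℕ) (j : Fin (κ i)), n - i ≤ N → x ∈ cube K n C →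
      Dominates c C i (F i j) x → ∃ (i' : ℕ) (j' : Fin (κ i')),
        (i < i' ∨ (i' = i ∧ (j' : ℕ) ≤ j)) ∧ x ∈ region c C F i' j' := by
    intro N
    induction N with
    | zero =>
      intro i j hN hx
      obtain ⟨m, hm⟩ := j
      induction m using Nat.strong_induction_on with
      | _ m ih =>
        intro hd
        by_cases hr : x ∈ region c C F i ⟨m, hm⟩
        · exact ⟨i, ⟨m, hm⟩, Or.inr ⟨rfl, le_rfl⟩, hr⟩
        · simp only [region, Set.mem_ofPred_eq, not_and, not_forall, not_not] at hr
          obtain ⟨i', j', hp, hd'⟩ := hr hx hd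
          rcases hp with hp | ⟨rfl, hp⟩
          · have := hdim i' j'
            omega
          · obtain ⟨i'', j'', h1, h2⟩ := ih j'.1 hp j'.2 hd'
            refine ⟨i'', j'', ?_, h2⟩
            rcases h1 with h1 | ⟨h1, h3⟩
            · exact Or.inl h1
            · exact Or.inr ⟨h1, h3.trans hp.le⟩
    | succ N IH =>
      intro i j hN hx
      obtain ⟨m, hm⟩ := j
      induction m using Nat.strong_induction_on with
      | _ m ih =>
        intro hd
        by_cases hr : x ∈ region c C F i ⟨m, hm⟩
        · exact ⟨i, ⟨m, hm⟩, Or.inr ⟨rfl, le_rfl⟩, hr⟩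
        · simp only [region, Set.mem_ofPred_eq, not_and, not_forall, not_not] at hr
          obtain ⟨i', j', hp, hd'⟩ := hr hx hd
          rcases hp with hp | ⟨rfl, hp⟩
          · have := hdim i' j'
            obtain ⟨i'', j'', h1, h2⟩ := IH i' j' (by omega) hx hd'
            exact ⟨i'', j'', Or.inl (by omega), h2⟩
          · obtain ⟨i'', j'', h1, h2⟩ := ih j'.1 hp j'.2 hd'
            refine ⟨i'', j'', ?_, h2⟩
            rcases h1 with h1 | ⟨h1, h3⟩
            · exact Or.inl h1
            · exact Or.inr ⟨h1, h3.trans hp.le⟩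
  constructor
  · rintro ⟨h1, h2, h3⟩
    exact ⟨h1, h2, fun i' j' hp hr => h3 i' j' hp hr.2.1⟩
  · rintro ⟨h1, h2, h3⟩
    refine ⟨h1, h2, fun i' j' hp hd => ?_⟩
    obtain ⟨i'', j'', hq, hr⟩ := key (n - i') i' j' le_rfl h1 hd
    refine h3 i'' j'' ?_ hr
    omega

/-! Subdivision of the unit cube by blowups. -/

/-- The blowup that replaces `x j` by `x j * x k`. -/
def blowup {K : Type*} [Mul K] {n : ℕ} (j k : Fin n) (x : Fin n → K) : Fin n → K :=
  Function.update x j (x j * x k)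

/-- The exponent of the monomial `x ^ α` after the blowup `blowup j k`. -/
def blowupExp {n : ℕ} (j k : Fin n) (α : Fin n → ℕ) : Fin n → ℕ :=
  Function.update α k (α k + α j)

/-- A piece of the subdivided cube in its blown-up coordinates: the composition `γ` of the blowups
that lead to it, the map `L` on exponents with `(γ x) ^ α = x ^ (L α)`, and the domain of the
blown-up coordinates. -/
structure Chart (K : Type*) (n : ℕ) where
  γ : (Fin n → K) → (Fin n → K)
  L : (Fin n → ℕ) → (Fin n → ℕ)
  dom : Set (Fin n → K)

/-- The chart to start with: the cube `{x ∈ K₀ⁿ : |x_l| ≤ 1 for all l}`, no blowup. -/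
def Chart.start (K : Type*) [NormedField K] (n : ℕ) : Chart K n where
  γ := id
  L := id
  dom := {x | x ∈ torus K n ∧ ∀ l, ‖x l‖ ≤ 1}

/-- The part of a chart where `|x j| ≤ |x k|`, blown up by `x j = x j * x k`. -/
def Chart.fst {K : Type*} [NormedField K] {n : ℕ} (ch : Chart K n) (j k : Fin n) : Chart K n where
  γ := ch.γ ∘ blowup j k
  L := blowupExp j k ∘ ch.L
  dom := torus K n ∩ blowup j k ⁻¹' {w | w ∈ ch.dom ∧ ‖w j‖ ≤ ‖w k‖}

/-- The part of a chart where `|x j| > |x k|`, blown up by `x k = x k * x j`. -/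
def Chart.snd {K : Type*} [NormedField K] {n : ℕ} (ch : Chart K n) (j k : Fin n) : Chart K n where
  γ := ch.γ ∘ blowup k j
  L := blowupExp k j ∘ ch.L
  dom := torus K n ∩ blowup k j ⁻¹' {w | w ∈ ch.dom ∧ ‖w k‖ < ‖w j‖}

/-- A finite pattern of successive blowups: each current piece is either kept, or divided according
to two distinct variables `x j`, `x k`, with both parts blown up and treated further. -/
inductive BlowupTree (n : ℕ) : Type
  | leaf : BlowupTree n
  | node (j k : Fin n) (hjk : j ≠ k) (t₁ t₂ : BlowupTree n) : BlowupTree n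

/-- The final pieces obtained from a chart by a pattern of blowups. -/
def BlowupTree.chartsFrom {K : Type*} [NormedField K] {n : ℕ} :
    BlowupTree n → Chart K n → List (Chart K n)
  | .leaf, ch => [ch]
  | .node j k _ t₁ t₂, ch => t₁.chartsFrom (ch.fst j k) ++ t₂.chartsFrom (ch.snd j k)

/-- The final pieces `E_1, …, E_q` of the unit cube, with their maps `γ_1, …, γ_q`. -/
def BlowupTree.charts {n : ℕ} (t : BlowupTree n) (K : Type*) [NormedField K] :
    List (Chart K n) :=
  t.chartsFrom (Chart.start K n)

/-- In each final piece, the blown-up monomials `x ^ v`, for `v` a vertex of the Newton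
polyhedron, have exponents that are linearly ordered componentwise. -/
def BlowupTree.Resolves {K : Type*} [NormedField K] {n : ℕ} (t : BlowupTree n)
    (c : (Fin n → ℕ) → K) : Prop :=
  ∀ ch ∈ t.charts K, ∀ v ∈ vertices c, ∀ w ∈ vertices c, ch.L v ≤ ch.L w ∨ ch.L w ≤ ch.L v

/-- The effect of one blowup on monomials. -/
theorem mono_blowup {K : Type*} [NormedField K] {n : ℕ} {j k : Fin n} (hjk : j ≠ k)
    (x : Fin n → K) (α : Fin n → ℕ) : mono (blowup j k x) α = mono x (blowupExp j k α) := by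
  have hA : ∀ l, blowup j k x l ^ α l = x l ^ α l * (if l = j then x k ^ α j else 1) := by
    intro l
    by_cases h : l = j
    · subst h; simp [blowup, mul_pow]
    · simp [blowup, h]
  have hB : ∀ l, x l ^ blowupExp j k α l = x l ^ α l * (if l = k then x k ^ α j else 1) := by
    intro l
    by_cases h : l = k
    · subst h; simp [blowupExp, pow_add]
    · simp [blowupExp, h]
  simp only [mono, hA, hB, Finset.prod_mul_distrib, Finset.prod_ite_eq', Finset.mem_univ, if_true]

/-- The map `L` of a final piece describes the effect of `γ` on monomials. -/
theorem mono_chart {K : Type*} [NormedField K] {n : ℕ} (t : BlowupTree n) (ch : Chart K n)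
    (hch : ch ∈ t.charts K) (x : Fin n → K) (α : Fin n → ℕ) :
    mono (ch.γ x) α = mono x (ch.L α) := by
  have key : ∀ (t : BlowupTree n) (ch₀ : Chart K n),
      (∀ x α, mono (ch₀.γ x) α = mono x (ch₀.L α)) →
      ∀ ch ∈ t.chartsFrom ch₀, ∀ x α, mono (ch.γ x) α = mono x (ch.L α) := by
    intro t
    induction t with
    | leaf =>
      intro ch₀ h ch hch
      simp only [BlowupTree.chartsFrom, List.mem_singleton] at hch
      exact hch ▸ h
    | node j k hjk t₁ t₂ ih₁ ih₂ =>
      intro ch₀ h ch hch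
      simp only [BlowupTree.chartsFrom, List.mem_append] at hch
      rcases hch with hch | hch
      · exact ih₁ _ (fun x α => by simp [Chart.fst, h, mono_blowup hjk]) ch hch
      · exact ih₂ _ (fun x α => by simp [Chart.snd, h, mono_blowup hjk.symm]) ch hch
  exact key t _ (fun x α => rfl) ch hch x α

/-! The blown-up regions and the splitting of the variables. -/

/-- The blown-up region `A'_{ijk} = γ_k⁻¹(A_{ij}) ∩ E_k`. -/
def blownRegion {K : Type*} [NormedField K] {n : ℕ} (c : (Fin n → ℕ) → K) (C : ℕ → ℝ)
    {κ : ℕ → ℕ} (F : (i : ℕ) → Fin (κ i) → Set (Fin n → ℝ)) (i : ℕ) (j : Fin (κ i))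
    (ch : Chart K n) : Set (Fin n → K) :=
  ch.γ ⁻¹' region c C F i j ∩ ch.dom

open scoped Classical in
/-- The indices of the `z` variables: those that appear in the monomial `x ^ (L v'' - L v')`, where
`L v'` is the least exponent `L v` over all vertices `v`, and `L v''` is the greatest one over the
vertices `v` on `F`. All other variables are `y` variables. -/
def zVars {K : Type*} [NormedField K] {n : ℕ} (c : (Fin n → ℕ) → K) (F : Set (Fin n → ℝ))
    (ch : Chart K n) : Finset (Fin n) :=
  {r | ∃ v' v'', (v' ∈ vertices c ∧ ∀ w ∈ vertices c, ch.L v' ≤ ch.L w) ∧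
    (v'' ∈ verticesOn c F ∧ ∀ w ∈ verticesOn c F, ch.L w ≤ ch.L v'') ∧ ch.L v' r < ch.L v'' r}

/-- The common exponent, in the `y` variables, of the blown-up monomials `x ^ (L v)` for the
vertices `v` on `F`; it is extended by `0` in the `z` variables. -/
def yExp {K : Type*} [NormedField K] {n : ℕ} (c : (Fin n → ℕ) → K) (F : Set (Fin n → ℝ))
    (ch : Chart K n) : Fin n → ℕ :=
  fun r => if r ∈ zVars c F ch then 0 else sInf ((fun v => ch.L v r) '' verticesOn c F)

/-- The factor `F_{ijk}` in `f ∘ γ = y ^ α F_{ijk}`, on `K₀ⁿ`. -/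
def quotientBy {K : Type*} [NormedField K] {n : ℕ} (f : (Fin n → K) → K) (ch : Chart K n)
    (α : Fin n → ℕ) : (Fin n → K) → K :=
  fun x => f (ch.γ x) / mono x α

/-- The differential operator `∑ m, β m ∂/∂z m`, the sum over the indices in `Z`. -/
def dirDeriv {K : Type*} [NontriviallyNormedField K] {n : ℕ} (Z : Finset (Fin n)) (β : Z → ℚ)
    (g : (Fin n → K) → K) : (Fin n → K) → K :=
  fun x => ∑ m : Z, (β m : K) * lineDeriv K g x (Pi.single m.1 1)

end NewtonBlowup

end

open NewtonBlowup

/-!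
On the region of a face `F` of dimension `i`, the function `f` is governed by the face polynomial
`f_F`. In the logarithmic coordinates `u = (-log |x_l|)` the monomials are linear functionals, and
`F` dominates at `x` when the vertices of `F` are within `log C_i` of the minimum of `u` over the
Newton polyhedron. If a vertex off `F` were nearly minimal as well, then `u`, all of whose
coefficients are large, could be rounded to a positive functional whose face is exactly the hull of
the nearly minimal vertices (`exists_rounding`); this compact face would be strictly larger than
`F`, hence of larger dimension, and it would dominate at `x`, contrary to the choice of the region
(`exists_vertex_gap`). So the vertices off `F` are negligible, and with them all terms off `F`
(`exists_sum_off_face_le`), since every exponent lies above a convex combination of the vertices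
(`exists_vertices_finset`).

In a chart of the blowups, `f_F ∘ γ` is `y ^ α` times a polynomial in the `z` variables
(`eval_chartPoly_factor`), and these satisfy `C_i⁻¹ ≤ |z_m| ≤ 1` on the blown-up region
(`inv_le_norm_of_mem_zVars`), so they range over a compact subset of the torus. Since `γ` is a
bijection of the torus with differentiable inverse, it does not change orders of vanishing. Hence at
each point some derivative in the `z` variables, of order at most the maximum order of a zero of
`f_F`, is nonzero, and the direction can be taken rational because a nonzero polynomial over a field
of characteristic zero does not vanish at all rational points (`exists_dirDeriv_ne_zero`).
By compactness finitely many directions and orders give a lower bound that depends only on `C_i`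
(`exists_finite_dirDeriv_cover`).

The derivatives of the remaining terms are bounded by Cauchy estimates for absolutely convergent
power series (`iterate_dirDeriv_hasSum`); these hold over every complete field because they concern
the weighted `ℓ¹` norm of the coefficients and not the maximum of the function. The room that they
need in the `z` variables is again of size `C_i⁻¹`, so the constants `C_k` with `k > i` can be taken
so large that the error is at most half of the lower bound (`exists_dirDeriv_sub_le`).
-/

namespace NewtonBlowup

/-! ### The Newton polyhedron and its vertices -/

/-- The set of points that dominate, coordinate by coordinate, a convex combination of the
points of `S`, i.e. the convex hull of the orthants `v + [0, ∞)ⁿ` with `v ∈ S`. -/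
def upperHull {n : ℕ} (S : Finset (Fin n → ℕ)) : Set (Fin n → ℝ) :=
  {t | ∃ w : (Fin n → ℕ) → ℝ, (∀ v, 0 ≤ w v) ∧ ∑ v ∈ S, w v = 1 ∧
    ∀ l, ∑ v ∈ S, w v * (v l : ℝ) ≤ t l}

section Polyhedron

variable {K : Type*} [Zero K] {n : ℕ} {c : (Fin n → ℕ) → K}

theorem upperHull_add {S : Finset (Fin n → ℕ)} {t s : Fin n → ℝ} (ht : t ∈ upperHull S)
    (hs : ∀ l, 0 ≤ s l) : t + s ∈ upperHull S := by
  obtain ⟨w, h0, h1, h2⟩ := ht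
  exact ⟨w, h0, h1, fun l => (h2 l).trans (by simpa using hs l)⟩

theorem toReal_mem_upperHull {S : Finset (Fin n → ℕ)} {v : Fin n → ℕ} (hv : v ∈ S) :
    toReal v ∈ upperHull S := by
  classical
  refine ⟨fun u => if u = v then 1 else 0, fun u => by dsimp only; split_ifs <;> simp,
    by simp [hv], fun l => ?_⟩
  simp [hv, toReal]

theorem convex_upperHull (S : Finset (Fin n → ℕ)) : Convex ℝ (upperHull S) := by
  rintro x ⟨w, h0, h1, h2⟩ y ⟨w', h0', h1', h2'⟩ a b ha hb hab
  refine ⟨fun v => a * w v + b * w' v, fun v => by have := h0 v; have := h0' v; positivity, ?_,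
    fun l => ?_⟩
  · rw [Finset.sum_add_distrib, ← Finset.mul_sum, ← Finset.mul_sum, h1, h1']; linarith
  · have : ∑ v ∈ S, (a * w v + b * w' v) * (v l : ℝ) =
        a * ∑ v ∈ S, w v * (v l : ℝ) + b * ∑ v ∈ S, w' v * (v l : ℝ) := by
      rw [Finset.mul_sum, Finset.mul_sum, ← Finset.sum_add_distrib]
      exact Finset.sum_congr rfl fun v _ => by ring
    rw [this]
    simp only [Pi.add_apply, Pi.smul_apply, smul_eq_mul]
    exact add_le_add (mul_le_mul_of_nonneg_left (h2 l) ha) (mul_le_mul_of_nonneg_left (h2' l) hb)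

theorem toReal_mem_newtonPolyhedron {α : Fin n → ℕ} (h : c α ≠ 0) :
    toReal α ∈ newtonPolyhedron c :=
  subset_convexHull ℝ _ (Set.mem_biUnion (x := α) h (fun _ => le_rfl))

theorem newtonPolyhedron_subset_upperHull {S : Finset (Fin n → ℕ)}
    (hS : ∀ α, c α ≠ 0 → toReal α ∈ upperHull S) : newtonPolyhedron c ⊆ upperHull S := by
  refine convexHull_min ?_ (convex_upperHull S)
  refine Set.iUnion₂_subset fun α hα t ht => ?_
  have : t = toReal α + (t - toReal α) := by simp
  rw [this]
  exact upperHull_add (hS α hα) fun l => sub_nonneg.2 (ht l)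

theorem newtonPolyhedron_add {t s : Fin n → ℝ} (ht : t ∈ newtonPolyhedron c) (hs : ∀ l, 0 ≤ s l) :
    t + s ∈ newtonPolyhedron c := by
  have : newtonPolyhedron c ⊆ (fun t => t + s) ⁻¹' newtonPolyhedron c := by
    refine convexHull_min ?_ ?_
    · refine Set.iUnion₂_subset fun α hα t ht => ?_
      exact subset_convexHull ℝ _ (Set.mem_biUnion (x := α) hα
        (fun l => (ht l).trans (by simpa using hs l)))
    · exact (convex_convexHull ℝ _).translate_preimage_left s
  exact this ht

/-- The exponents of the power series lie above finitely many of them (Dickson's lemma). -/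
theorem exists_finset_generating (c : (Fin n → ℕ) → K) : ∃ S : Finset (Fin n → ℕ),
    (∀ v ∈ S, c v ≠ 0) ∧ newtonPolyhedron c ⊆ upperHull S := by
  have hfin : {α | Minimal (fun α => c α ≠ 0) α}.Finite :=
    (setOfPred_minimal_antichain _).finite_of_partiallyWellOrderedOn
      (Set.isPWO_of_wellQuasiOrderedLE _)
  refine ⟨hfin.toFinset, fun v hv => ((Set.Finite.mem_toFinset _).1 hv).1,
    newtonPolyhedron_subset_upperHull fun α hα => ?_⟩
  obtain ⟨v, hv, hm⟩ := exists_minimal_le_of_wellFoundedLT (fun α => c α ≠ 0) α hα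
  have h1 : toReal v ∈ upperHull hfin.toFinset :=
    toReal_mem_upperHull ((Set.Finite.mem_toFinset _).2 hm)
  have : toReal α = toReal v + (toReal α - toReal v) := by simp
  rw [this]
  exact upperHull_add h1 fun l => sub_nonneg.2 (Nat.cast_le.2 (hv l))

/-- A generator that dominates a convex combination giving it weight less than `1` is
superfluous. -/
theorem upperHull_erase [DecidableEq (Fin n → ℕ)] {S : Finset (Fin n → ℕ)} {v : Fin n → ℕ}
    (hv : v ∈ S) {w : (Fin n → ℕ) → ℝ}
    (h0 : ∀ u, 0 ≤ w u) (h1 : ∑ u ∈ S, w u = 1) (h2 : ∀ l, ∑ u ∈ S, w u * (u l : ℝ) ≤ v l)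
    (hlt : w v < 1) : upperHull S ⊆ upperHull (S.erase v) := by
  rintro t ⟨a, ha0, ha1, ha2⟩
  have hpos : 0 < 1 - w v := by linarith
  have e1 : ∑ u ∈ S.erase v, w u = 1 - w v := by
    rw [← h1, ← Finset.add_sum_erase S _ hv]; ring
  have e2 : ∀ l, ∑ u ∈ S.erase v, w u * (u l : ℝ) ≤ (1 - w v) * v l := fun l => by
    have := h2 l
    rw [← Finset.add_sum_erase S _ hv] at this
    linarith
  refine ⟨fun u => a u + a v * (w u / (1 - w v)), fun u => ?_, ?_, fun l => ?_⟩
  · have := ha0 u; have := ha0 v; have := h0 u; positivity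
  · rw [Finset.sum_add_distrib, ← Finset.mul_sum, ← Finset.sum_div, e1, div_self hpos.ne', mul_one,
      ← ha1, ← Finset.add_sum_erase S _ hv]; ring
  · have : ∑ u ∈ S.erase v, (a u + a v * (w u / (1 - w v))) * (u l : ℝ) =
        ∑ u ∈ S.erase v, a u * (u l : ℝ) +
          a v * ((∑ u ∈ S.erase v, w u * (u l : ℝ)) / (1 - w v)) := by
      rw [Finset.sum_div, Finset.mul_sum, ← Finset.sum_add_distrib]
      exact Finset.sum_congr rfl fun u _ => by ring
    rw [this]
    have h3 : (∑ u ∈ S.erase v, w u * (u l : ℝ)) / (1 - w v) ≤ v l := by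
      rw [div_le_iff₀ hpos]; linarith [e2 l]
    have h4 := mul_le_mul_of_nonneg_left h3 (ha0 v)
    have h5 := ha2 l
    rw [← Finset.add_sum_erase S _ hv] at h5
    linarith

/-- A finite set of generators from which nothing can be left out consists of vertices. -/
theorem mem_vertices_of_irredundant [DecidableEq (Fin n → ℕ)] {S : Finset (Fin n → ℕ)}
    (hN : newtonPolyhedron c ⊆ upperHull S)
    {v : Fin n → ℕ} (hv : v ∈ S) (hcv : c v ≠ 0)
    (hmin : ¬ newtonPolyhedron c ⊆ upperHull (S.erase v)) : v ∈ vertices c := by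
  refine mem_extremePoints_iff_left.2 ⟨toReal_mem_newtonPolyhedron hcv, ?_⟩
  rintro x hx y hy ⟨a, b, ha, hb, hab, hxy⟩
  obtain ⟨w, h0, h1, h2⟩ := hN hx
  obtain ⟨w', h0', h1', h2'⟩ := hN hy
  have hsum : ∀ (w : (Fin n → ℕ) → ℝ), (∀ v, 0 ≤ w v) → ∑ v ∈ S, w v = 1 → w v ≤ 1 :=
    fun w h0 h1 => h1 ▸ Finset.single_le_sum (fun i _ => h0 i) hv
  have hxl : ∀ l, a * x l + b * y l = v l := fun l => by
    have := congrFun hxy l; simpa [toReal] using this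
  have hge : 1 ≤ a * w v + b * w' v := by
    by_contra hlt
    refine hmin (hN.trans (upperHull_erase hv (w := fun u => a * w u + b * w' u) ?_ ?_ ?_
      (not_le.1 hlt)))
    · intro u; have := h0 u; have := h0' u; positivity
    · rw [Finset.sum_add_distrib, ← Finset.mul_sum, ← Finset.mul_sum, h1, h1']; linarith
    · intro l
      have : ∑ v ∈ S, (a * w v + b * w' v) * (v l : ℝ) =
          a * ∑ v ∈ S, w v * (v l : ℝ) + b * ∑ v ∈ S, w' v * (v l : ℝ) := by
        rw [Finset.mul_sum, Finset.mul_sum, ← Finset.sum_add_distrib]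
        exact Finset.sum_congr rfl fun v _ => by ring
      rw [this, ← hxl l]
      exact add_le_add (mul_le_mul_of_nonneg_left (h2 l) ha.le)
        (mul_le_mul_of_nonneg_left (h2' l) hb.le)
  have hw := hsum w h0 h1
  have hw' := hsum w' h0' h1'
  have hle : ∀ (w : (Fin n → ℕ) → ℝ), (∀ v, 0 ≤ w v) → w v = 1 → ∀ l,
      (v l : ℝ) ≤ ∑ u ∈ S, w u * (u l : ℝ) := fun w h0 h1 l => by
    have := Finset.single_le_sum (f := fun u => w u * (u l : ℝ))
      (fun u _ => mul_nonneg (h0 u) (Nat.cast_nonneg (u l))) hv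
    simpa [h1] using this
  have ew : w v = 1 := by nlinarith
  have ew' : w' v = 1 := by nlinarith
  funext l
  have q1 := (hle w h0 ew l).trans (h2 l)
  have q2 := (hle w' h0' ew' l).trans (h2' l)
  have q3 := hxl l
  have : (toReal v) l = v l := rfl
  rw [this]
  nlinarith

theorem upperHull_subset_newtonPolyhedron {S : Finset (Fin n → ℕ)} (hS : ∀ v ∈ S, c v ≠ 0) :
    upperHull S ⊆ newtonPolyhedron c := by
  rintro t ⟨w, h0, h1, h2⟩
  have hp : ∑ v ∈ S, w v • toReal v ∈ newtonPolyhedron c :=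
    (convex_convexHull ℝ _).sum_mem (fun v _ => h0 v) h1
      (fun v hv => toReal_mem_newtonPolyhedron (hS v hv))
  have : t = ∑ v ∈ S, w v • toReal v + (t - ∑ v ∈ S, w v • toReal v) := by simp
  rw [this]
  refine newtonPolyhedron_add hp fun l => ?_
  simpa [toReal] using h2 l

/-- A vertex belongs to every finite set of generators. -/
theorem vertices_subset_of_generating {S : Finset (Fin n → ℕ)} (hS : ∀ v ∈ S, c v ≠ 0)
    (hN : newtonPolyhedron c ⊆ upperHull S) : vertices c ⊆ S := by
  intro v hv
  obtain ⟨hvN, hext⟩ := mem_extremePoints_iff_left.1 hv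
  obtain ⟨w, h0, h1, h2⟩ := hN hvN
  set p : Fin n → ℝ := ∑ u ∈ S, w u • toReal u with hp
  have hpl : ∀ l, p l = ∑ u ∈ S, w u * (u l : ℝ) := fun l => by simp [hp, toReal]
  have hpN : p ∈ newtonPolyhedron c :=
    (convex_convexHull ℝ _).sum_mem (fun v _ => h0 v) h1
      (fun v hv => toReal_mem_newtonPolyhedron (hS v hv))
  have hs : ∀ l, 0 ≤ (toReal v - p) l := fun l => by
    rw [Pi.sub_apply, hpl]; exact sub_nonneg.2 (h2 l)
  -- `v` is the midpoint of `p` and its reflection `p + 2 (v - p)`, so it equals `p`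
  have hq : toReal v + (toReal v - p) ∈ newtonPolyhedron c := newtonPolyhedron_add hvN hs
  have hpv : p = toReal v := by
    refine hext p hpN _ hq ⟨1/2, 1/2, by norm_num, by norm_num, by norm_num, ?_⟩
    funext l; simp; ring
  have hconv : convexHull ℝ (toReal '' (S : Set (Fin n → ℕ))) ⊆ newtonPolyhedron c :=
    convexHull_min (Set.image_subset_iff.2 fun u hu => toReal_mem_newtonPolyhedron (hS u hu))
      (convex_convexHull ℝ _)
  have hpc : p ∈ convexHull ℝ (toReal '' (S : Set (Fin n → ℕ))) :=
    (convex_convexHull ℝ _).sum_mem (fun v _ => h0 v) h1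
      (fun v hv => subset_convexHull ℝ _ ⟨v, hv, rfl⟩)
  have : toReal v ∈ (convexHull ℝ (toReal '' (S : Set (Fin n → ℕ)))).extremePoints ℝ :=
    mem_extremePoints_iff_left.2 ⟨hpv ▸ hpc, fun x hx y hy => hext x (hconv hx) y (hconv hy)⟩
  obtain ⟨u, hu, huv⟩ := extremePoints_convexHull_subset this
  have : u = v := funext fun l => by
    have := congrFun huv l; simpa [toReal] using this
  exact this ▸ hu

/-- The Newton polyhedron has finitely many vertices, all of them exponents of the power series,
and consists of the points above their convex hull. -/
theorem exists_vertices_finset (c : (Fin n → ℕ) → K) : ∃ V : Finset (Fin n → ℕ),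
    (V : Set (Fin n → ℕ)) = vertices c ∧ (∀ v ∈ V, c v ≠ 0) ∧ newtonPolyhedron c = upperHull V := by
  classical
  obtain ⟨S₀, hS₀⟩ := exists_finset_generating c
  obtain ⟨V, hV, hmin⟩ := exists_minimal_le_of_wellFoundedLT
    (fun S : Finset (Fin n → ℕ) => (∀ v ∈ S, c v ≠ 0) ∧ newtonPolyhedron c ⊆ upperHull S) S₀ hS₀
  refine ⟨V, Set.Subset.antisymm (fun v hv => ?_)
    (vertices_subset_of_generating hmin.1.1 hmin.1.2), hmin.1.1,
    hmin.1.2.antisymm (upperHull_subset_newtonPolyhedron hmin.1.1)⟩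
  refine mem_vertices_of_irredundant hmin.1.2 hv (hmin.1.1 v hv) fun h => ?_
  have := hmin.2 ⟨fun u hu => hmin.1.1 u (Finset.mem_of_mem_erase hu), h⟩ (Finset.erase_subset v V)
  exact Finset.notMem_erase v V (this hv)

end Polyhedron

/-! ### Compact faces as faces of positive functionals -/

section Faces

variable {K : Type*} [Zero K] {n : ℕ} {c : (Fin n → ℕ) → K}

theorem toReal_injective : Function.Injective (toReal : (Fin n → ℕ) → Fin n → ℝ) := fun v w h =>
  funext fun l => by have := congrFun h l; simpa [toReal] using this

theorem sum_mul_dotProduct_toReal (u : Fin n → ℝ) (V : Finset (Fin n → ℕ))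
    (w : (Fin n → ℕ) → ℝ) :
    ∑ v ∈ V, w v * (u ⬝ᵥ toReal v) = ∑ l, u l * ∑ v ∈ V, w v * (v l : ℝ) := by
  simp only [dotProduct, Finset.mul_sum, toReal]
  rw [Finset.sum_comm]
  exact Finset.sum_congr rfl fun l _ => Finset.sum_congr rfl fun v _ => by ring

/-- The value of a nonnegative functional at a point above a convex combination. -/
theorem sum_le_dotProduct {u t : Fin n → ℝ} (hu : ∀ l, 0 ≤ u l) {V : Finset (Fin n → ℕ)}
    {w : (Fin n → ℕ) → ℝ} (h2 : ∀ l, ∑ v ∈ V, w v * (v l : ℝ) ≤ t l) :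
    ∑ v ∈ V, w v * (u ⬝ᵥ toReal v) ≤ u ⬝ᵥ t := by
  rw [sum_mul_dotProduct_toReal]
  exact Finset.sum_le_sum fun l _ => mul_le_mul_of_nonneg_left (h2 l) (hu l)

theorem le_dotProduct_of_mem_upperHull {V : Finset (Fin n → ℕ)} {u : Fin n → ℝ}
    (hu : ∀ l, 0 ≤ u l) {m : ℝ}
    (hm : ∀ v ∈ V, m ≤ u ⬝ᵥ toReal v) {t : Fin n → ℝ} (ht : t ∈ upperHull V) : m ≤ u ⬝ᵥ t := by
  obtain ⟨w, h0, h1, h2⟩ := ht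
  refine le_trans ?_ (sum_le_dotProduct hu h2)
  calc m = ∑ v ∈ V, w v * m := by rw [← Finset.sum_mul, h1, one_mul]
    _ ≤ _ := Finset.sum_le_sum fun v hv => mul_le_mul_of_nonneg_left (hm v hv) (h0 v)

/-- A positive functional attains its minimum exactly on the convex hull of the generators at
which it does. -/
theorem face_eq_convexHull {V : Finset (Fin n → ℕ)} {u : Fin n → ℝ} (hu : ∀ l, 0 < u l) {m : ℝ}
    (hm : ∀ v ∈ V, m ≤ u ⬝ᵥ toReal v) :
    {t | t ∈ upperHull V ∧ u ⬝ᵥ t = m} =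
      convexHull ℝ (toReal '' {v | v ∈ V ∧ u ⬝ᵥ toReal v = m}) := by
  apply Set.Subset.antisymm
  · rintro t ⟨⟨w, h0, h1, h2⟩, htm⟩
    have hs := sum_le_dotProduct (fun l => (hu l).le) h2
    have hm' : m = ∑ v ∈ V, w v * m := by rw [← Finset.sum_mul, h1, one_mul]
    have hge : ∀ v ∈ V, w v * m ≤ w v * (u ⬝ᵥ toReal v) := fun v hv =>
      mul_le_mul_of_nonneg_left (hm v hv) (h0 v)
    have hsum : ∑ v ∈ V, w v * m = ∑ v ∈ V, w v * (u ⬝ᵥ toReal v) :=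
      le_antisymm (Finset.sum_le_sum hge) (by linarith)
    have heq := (Finset.sum_eq_sum_iff_of_le hge).1 hsum
    have hw : ∀ v ∈ V, w v ≠ 0 → u ⬝ᵥ toReal v = m := fun v hv hne =>
      (mul_left_cancel₀ hne (heq v hv)).symm
    have ht : t = ∑ v ∈ V, w v • toReal v := by
      have h3 : ∑ l, u l * ∑ v ∈ V, w v * (v l : ℝ) = ∑ l, u l * t l := by
        rw [← sum_mul_dotProduct_toReal, ← hsum, ← hm', ← htm]; rfl
      have h4 := (Finset.sum_eq_sum_iff_of_le
        (fun l _ => mul_le_mul_of_nonneg_left (h2 l) (hu l).le)).1 h3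
      funext l
      have := mul_left_cancel₀ (hu l).ne' (h4 l (Finset.mem_univ l))
      simp [← this, toReal]
    classical
    rw [ht, ← Finset.sum_filter_of_ne (p := fun v => u ⬝ᵥ toReal v = m)
      (fun v hv hne => hw v hv fun h => hne (by simp [h]))]
    refine (convex_convexHull ℝ _).sum_mem (fun v _ => h0 v) ?_ (fun v hv => ?_)
    · rw [← h1]
      exact Finset.sum_filter_of_ne hw
    · rw [Finset.mem_filter] at hv
      exact subset_convexHull ℝ _ ⟨v, hv, rfl⟩
  · refine convexHull_min ?_ ?_
    · rintro _ ⟨v, ⟨hv, hvm⟩, rfl⟩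
      exact ⟨toReal_mem_upperHull hv, hvm⟩
    · rintro x ⟨hx, hxm⟩ y ⟨hy, hym⟩ a b ha hb hab
      refine ⟨convex_upperHull V hx hy ha hb hab, ?_⟩
      rw [dotProduct_add, dotProduct_smul, dotProduct_smul, hxm, hym, smul_eq_mul, smul_eq_mul,
        ← add_mul, hab, one_mul]

/-- The linear functional `t ↦ u ⬝ᵥ t`. -/
def dotLin (u : Fin n → ℝ) : (Fin n → ℝ) →ₗ[ℝ] ℝ where
  toFun t := u ⬝ᵥ t
  map_add' := dotProduct_add u
  map_smul' a t := by simp [dotProduct_smul]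

/-- The face on which a positive functional is minimal is a compact face. -/
theorem mem_compactFaces_of_pos {V : Finset (Fin n → ℕ)} (hN : newtonPolyhedron c = upperHull V)
    {u : Fin n → ℝ} (hu : ∀ l, 0 < u l) {m : ℝ} (hm : ∀ v ∈ V, m ≤ u ⬝ᵥ toReal v)
    (hatt : ∃ v ∈ V, u ⬝ᵥ toReal v = m) :
    {t | t ∈ newtonPolyhedron c ∧ u ⬝ᵥ t = m} ∈
      compactFaces c (Module.finrank ℝ
        (vectorSpan ℝ {t | t ∈ newtonPolyhedron c ∧ u ⬝ᵥ t = m})) := by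
  obtain ⟨v, hv, hvm⟩ := hatt
  refine ⟨⟨toReal v, hN ▸ toReal_mem_upperHull hv, hvm⟩, ?_, ?_, rfl⟩
  · rw [hN, face_eq_convexHull hu hm]
    refine Set.Finite.isCompact_convexHull ℝ (Set.Finite.image _ ?_)
    exact V.finite_toSet.subset fun v hv => hv.1
  · intro _
    refine ⟨-LinearMap.toContinuousLinearMap (dotLin u), ?_⟩
    ext t
    refine and_congr_right fun ht => ?_
    have key : ∀ y ∈ newtonPolyhedron c, m ≤ u ⬝ᵥ y := fun y hy =>
      le_dotProduct_of_mem_upperHull (fun l => (hu l).le) hm (hN ▸ hy)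
    constructor
    · intro h y hy
      have := key y hy
      simpa [dotLin, h] using this
    · intro h
      refine le_antisymm ?_ (key t ht)
      have := h (toReal v) (hN ▸ toReal_mem_upperHull hv)
      simp only [dotLin, neg_apply, LinearMap.coe_toContinuousLinearMap',
        LinearMap.coe_mk, AddHom.coe_mk, neg_le_neg_iff] at this
      linarith

/-- A compact face is the face on which some positive functional is minimal: a functional that is
not strictly decreasing in every direction of the orthant would have an unbounded face. -/
theorem exists_pos_of_mem_compactFaces {i : ℕ} {F : Set (Fin n → ℝ)} (hF : F ∈ compactFaces c i) :
    ∃ (u : Fin n → ℝ) (m : ℝ), (∀ l, 0 < u l) ∧ (∀ t ∈ newtonPolyhedron c, m ≤ u ⬝ᵥ t) ∧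
      F = {t | t ∈ newtonPolyhedron c ∧ u ⬝ᵥ t = m} := by
  obtain ⟨hne, hcomp, hexp, -⟩ := hF
  obtain ⟨φ, hφ⟩ := hexp hne
  obtain ⟨t₀, ht₀⟩ := hne
  have hrep : ∀ t, φ t = -((fun l => -φ (Pi.single l 1)) ⬝ᵥ t) := fun t => by
    have := LinearMap.pi_apply_eq_sum_univ (φ : (Fin n → ℝ) →ₗ[ℝ] ℝ) t
    simp only [ContinuousLinearMap.coe_coe] at this
    rw [this]
    simp only [dotProduct, neg_mul, Finset.sum_neg_distrib, neg_neg]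
    refine Finset.sum_congr rfl fun l _ => ?_
    rw [smul_eq_mul, mul_comm]
    congr 2
    ext k
    simp [Pi.single_apply, eq_comm]
  have ht₀' := ht₀
  rw [hφ] at ht₀'
  obtain ⟨ht₀N, hmax⟩ := ht₀'
  refine ⟨fun l => -φ (Pi.single l 1), -φ t₀, fun l => ?_, fun t ht => ?_, ?_⟩
  · have hray : ∀ k : ℕ, t₀ + (k : ℝ) • Pi.single l 1 ∈ newtonPolyhedron c := fun k =>
      newtonPolyhedron_add ht₀N fun l' => by
        by_cases h : l' = l
        · subst h; simp
        · simp [h]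
    have hval : ∀ k : ℕ, φ (t₀ + (k : ℝ) • Pi.single l 1) = φ t₀ + k * φ (Pi.single l 1) :=
      fun k => by rw [map_add, map_smul, smul_eq_mul]
    have h1 := hmax _ (hray 1)
    rw [hval, Nat.cast_one, one_mul] at h1
    have h1' : φ (Pi.single l 1) ≤ 0 := by linarith
    rcases h1'.lt_or_eq with h | h
    · simpa using h
    · exfalso
      obtain ⟨R, hR⟩ := hcomp.isBounded.exists_norm_le
      obtain ⟨k, hk⟩ := exists_nat_gt (R - t₀ l)
      have hmem : t₀ + (k : ℝ) • Pi.single l 1 ∈ F := by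
        rw [hφ]
        refine ⟨hray k, fun y hy => ?_⟩
        rw [hval, h, mul_zero, add_zero]
        exact hmax y hy
      have h2 := (norm_le_pi_norm _ l).trans (hR _ hmem)
      have h3 := (le_abs_self _).trans h2
      simp at h3
      linarith
  · have := hmax t ht
    rw [hrep t] at this
    linarith
  · rw [hφ]
    ext t
    refine and_congr_right fun ht => ?_
    have := hrep t
    constructor
    · intro h
      have h1 := h t₀ ht₀N
      have h2 := hmax t ht
      linarith
    · intro h y hy
      have h2 := hmax y hy
      linarith

theorem mem_verticesOn_iff {V : Finset (Fin n → ℕ)} (hV : (V : Set (Fin n → ℕ)) = vertices c)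
    {u : Fin n → ℝ} {m : ℝ} {v : Fin n → ℕ} (hN : newtonPolyhedron c = upperHull V) :
    v ∈ verticesOn c {t | t ∈ newtonPolyhedron c ∧ u ⬝ᵥ t = m} ↔ v ∈ V ∧ u ⬝ᵥ toReal v = m := by
  have : v ∈ vertices c ↔ v ∈ V := by rw [← hV]; rfl
  simp only [verticesOn, Set.mem_ofPred_eq, this]
  exact ⟨fun h => ⟨h.1, h.2.2⟩, fun h => ⟨h.1, hN ▸ toReal_mem_upperHull h.1, h.2⟩⟩

theorem compactFace_eq_convexHull {i : ℕ} {F : Set (Fin n → ℝ)} (hF : F ∈ compactFaces c i) :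
    F = convexHull ℝ (toReal '' verticesOn c F) := by
  obtain ⟨V, hV, -, hN⟩ := exists_vertices_finset c
  obtain ⟨u, m, hu, hm, rfl⟩ := exists_pos_of_mem_compactFaces hF
  have := face_eq_convexHull hu (V := V) (m := m)
    (fun v hv => hm _ (hN ▸ toReal_mem_upperHull hv))
  rw [← hN] at this
  conv_lhs => rw [this]
  congr 2
  ext v
  exact (mem_verticesOn_iff hV hN).symm

theorem verticesOn_nonempty {i : ℕ} {F : Set (Fin n → ℝ)} (hF : F ∈ compactFaces c i) :
    (verticesOn c F).Nonempty := by
  have h := hF.1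
  rw [compactFace_eq_convexHull hF, convexHull_nonempty_iff] at h
  exact h.of_image

theorem vertices_finite (c : (Fin n → ℕ) → K) : (vertices c).Finite := by
  obtain ⟨V, hV, -, -⟩ := exists_vertices_finset c
  exact hV ▸ V.finite_toSet

theorem verticesOn_finite (c : (Fin n → ℕ) → K) (F : Set (Fin n → ℝ)) :
    (verticesOn c F).Finite := (vertices_finite c).subset fun _ h => h.1

theorem vectorSpan_le_ker_dotLin {u : Fin n → ℝ} {m : ℝ} {F : Set (Fin n → ℝ)}
    (h : ∀ t ∈ F, u ⬝ᵥ t = m) : vectorSpan ℝ F ≤ LinearMap.ker (dotLin u) := by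
  rw [vectorSpan_def, Submodule.span_le]
  rintro _ ⟨x, hx, y, hy, rfl⟩
  have h1 := h x hx
  have h2 := h y hy
  simp [dotLin, dotProduct_sub, h1, h2]

theorem dim_lt_of_mem_compactFaces {i : ℕ} {F : Set (Fin n → ℝ)} (hF : F ∈ compactFaces c i)
    (hn : 0 < n) : i < n := by
  obtain ⟨u, m, hu, hm, hFe⟩ := exists_pos_of_mem_compactFaces hF
  have hle := vectorSpan_le_ker_dotLin (u := u) (m := m) (F := F) (fun t ht => by
    rw [hFe] at ht; exact ht.2)
  have hne : vectorSpan ℝ F ≠ ⊤ := fun h => by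
    have : Pi.single ⟨0, hn⟩ 1 ∈ LinearMap.ker (dotLin u) := hle (h ▸ Submodule.mem_top)
    have h2 := hu ⟨0, hn⟩
    simp [dotLin] at this
    linarith
  have := Submodule.finrank_lt (lt_top_iff_ne_top.2 hne).ne
  rw [hF.2.2.2] at this
  simpa using this

/-- A compact face is contained in strictly larger faces only of strictly larger dimension. -/
theorem dim_lt_dim_of_ssubset {i i' : ℕ} {F F' : Set (Fin n → ℝ)} (hF : F ∈ compactFaces c i)
    (hF' : F' ∈ compactFaces c i') (hsub : F ⊆ F') {t : Fin n → ℝ} (ht : t ∈ F')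
    (htF : t ∉ F) (htN : t ∈ newtonPolyhedron c) : i < i' := by
  obtain ⟨u, m, hu, hm, hFe⟩ := exists_pos_of_mem_compactFaces hF
  have hle := vectorSpan_le_ker_dotLin (u := u) (m := m) (F := F) (fun t ht => by
    rw [hFe] at ht; exact ht.2)
  obtain ⟨s, hs⟩ := hF.1
  have hs' := hs
  rw [hFe] at hs'
  rw [← hF.2.2.2, ← hF'.2.2.2]
  refine Submodule.finrank_lt_finrank_of_lt (lt_of_le_of_ne (vectorSpan_mono ℝ hsub) fun h => ?_)
  have h1 : t -ᵥ s ∈ vectorSpan ℝ F' := vsub_mem_vectorSpan ℝ ht (hsub hs)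
  rw [← h] at h1
  have h2 : u ⬝ᵥ t - u ⬝ᵥ s = 0 := by
    have := hle h1
    simpa [dotLin, dotProduct_sub] using this
  exact htF (hFe ▸ ⟨htN, by rw [← hs'.2]; linarith⟩)

/-- A compact face of positive dimension has two different vertices. -/
theorem exists_ne_mem_verticesOn {i : ℕ} {F : Set (Fin n → ℝ)} (hF : F ∈ compactFaces c i)
    (hi : 0 < i) : ∃ v ∈ verticesOn c F, ∃ w ∈ verticesOn c F, v ≠ w := by
  by_contra! h
  have hs : (verticesOn c F).Subsingleton := fun v hv w hw => h v hv w hw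
  have hFs : F.Subsingleton := by
    rw [compactFace_eq_convexHull hF]
    rw [hs.eq_singleton_of_mem (verticesOn_nonempty hF).some_mem, Set.image_singleton,
      convexHull_singleton]
    exact Set.subsingleton_singleton
  have h0 := hF.2.2.2
  rw [vectorSpan_of_subsingleton ℝ hFs, finrank_bot] at h0
  omega

theorem eq_singleton_of_mem_compactFaces_zero {F : Set (Fin n → ℝ)} (hF : F ∈ compactFaces c 0) :
    ∃ v ∈ vertices c, F = {toReal v} := by
  obtain ⟨v, hv⟩ := verticesOn_nonempty hF
  refine ⟨v, hv.1, Set.Subsingleton.eq_singleton_of_mem (fun x hx y hy => ?_) hv.2⟩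
  have h0 := Submodule.finrank_eq_zero.1 hF.2.2.2
  have := vsub_mem_vectorSpan ℝ hx hy
  rw [h0, Submodule.mem_bot, vsub_eq_sub, sub_eq_zero] at this
  exact this

theorem ne_zero_of_mem_vertices {v : Fin n → ℕ} (hv : v ∈ vertices c) : c v ≠ 0 := by
  obtain ⟨V, hV, h, -⟩ := exists_vertices_finset c
  exact h v (by rw [← hV] at hv; exact hv)

end Faces

/-! ### Rounding a functional to one with an exact face -/

/-- A vector almost orthogonal to given vectors is close to one that is orthogonal to them. -/
theorem exists_close_orthogonal {n : ℕ} {ι : Type*} [Finite ι] (d : ι → Fin n → ℝ) :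
    ∃ A : ℝ, 0 ≤ A ∧ ∀ (u : Fin n → ℝ) (g : ℝ), 0 ≤ g → (∀ k, |u ⬝ᵥ d k| ≤ g) →
      ∃ u' : Fin n → ℝ, (∀ k, u' ⬝ᵥ d k = 0) ∧ ∀ l, |u l - u' l| ≤ A * g := by
  have := Fintype.ofFinite ι
  let Φ : (Fin n → ℝ) →ₗ[ℝ] (ι → ℝ) :=
    { toFun := fun u k => u ⬝ᵥ d k
      map_add' := fun u v => funext fun k => add_dotProduct u v (d k)
      map_smul' := fun a u => funext fun k => smul_dotProduct a u (d k) }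
  obtain ⟨B, hB⟩ := Φ.rangeRestrict.exists_rightInverse_of_surjective Φ.range_rangeRestrict
  let B' := LinearMap.toContinuousLinearMap B
  have hB0 : 0 ≤ ‖B'‖ := ContinuousLinearMap.opNorm_nonneg B'
  refine ⟨‖B'‖, hB0, fun u g hg h => ⟨u - B (Φ.rangeRestrict u), fun k => ?_, fun l => ?_⟩⟩
  · have h1 : Φ.rangeRestrict (B (Φ.rangeRestrict u)) = Φ.rangeRestrict u :=
      LinearMap.congr_fun hB _
    have h2 : Φ (B (Φ.rangeRestrict u)) = Φ u := congrArg Subtype.val h1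
    have h3 : B (Φ.rangeRestrict u) ⬝ᵥ d k = u ⬝ᵥ d k := congrFun h2 k
    rw [sub_dotProduct, h3, sub_self]
  · have h1 : ‖Φ.rangeRestrict u‖ ≤ g := by
      change ‖Φ u‖ ≤ g
      exact (pi_norm_le_iff_of_nonneg hg).2 h
    have h2 : ‖B' (Φ.rangeRestrict u)‖ ≤ ‖B'‖ * g :=
      (B'.le_opNorm _).trans (mul_le_mul_of_nonneg_left h1 hB0)
    have h3 := (norm_le_pi_norm (B' (Φ.rangeRestrict u)) l).trans h2
    simpa [B'] using h3

/-- Finitely many numbers leave a multiplicative gap `(g', θ g']` at a bounded height. -/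
theorem exists_gap {ι : Type*} (V : Finset ι) (a : ι → ℝ) {θ : ℝ} (hθ : 1 ≤ θ) (N : ℕ) :
    ∀ g : ℝ, 0 ≤ g → (V.filter fun v => g < a v).card ≤ N →
      ∃ g', g ≤ g' ∧ g' ≤ θ ^ N * g ∧ ∀ v ∈ V, a v ≤ g' ∨ θ * g' < a v := by
  induction N with
  | zero =>
    intro g hg hN
    refine ⟨g, le_rfl, by simp, fun v hv => Or.inl (not_lt.1 fun h => ?_)⟩
    have : v ∈ V.filter fun v => g < a v := Finset.mem_filter.2 ⟨hv, h⟩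
    rw [Finset.card_eq_zero.1 (Nat.le_zero.1 hN)] at this
    exact Finset.notMem_empty v this
  | succ N ih =>
    intro g hg hN
    by_cases hgap : ∀ v ∈ V, a v ≤ g ∨ θ * g < a v
    · refine ⟨g, le_rfl, ?_, hgap⟩
      exact le_mul_of_one_le_left hg (one_le_pow₀ hθ)
    · push Not at hgap
      obtain ⟨v, hv, h1, h2⟩ := hgap
      have hlt : (V.filter fun v => θ * g < a v).card < (V.filter fun v => g < a v).card := by
        refine Finset.card_lt_card (Finset.ssubset_iff_of_subset ?_ |>.2 ⟨v, ?_, ?_⟩)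
        · intro w hw
          rw [Finset.mem_filter] at hw ⊢
          exact ⟨hw.1, (le_mul_of_one_le_left hg hθ).trans_lt hw.2⟩
        · exact Finset.mem_filter.2 ⟨hv, h1⟩
        · simp only [Finset.mem_filter, not_and, not_lt]
          exact fun _ => h2
      obtain ⟨g', h3, h4, h5⟩ := ih (θ * g) (by positivity) (by omega)
      exact ⟨g', (le_mul_of_one_le_left hg hθ).trans h3, h4.trans (by rw [pow_succ]; linarith), h5⟩

/-- A positive functional that is nearly minimal, within an error `G` small against its
coefficients, at some points of a finite set can be replaced by a positive functional that is
minimal exactly at the points where the original one is within `g` of its minimum, for some `g`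
comparable to `G`.

By `exists_gap`, `g` can be chosen such that the values of the functional that exceed the minimum
by more than `g` exceed it by a large multiple of `g`; then the correction that makes the small
differences vanish does not affect the sign of the large ones. -/
theorem exists_rounding {n : ℕ} (V : Finset (Fin n → ℕ)) : ∃ B : ℝ, 1 ≤ B ∧
    ∀ (u : Fin n → ℝ) (G : ℝ), 0 ≤ G → (∀ l, B * G < u l) → ∀ v₀ ∈ V,
      (∀ v ∈ V, u ⬝ᵥ toReal v₀ ≤ u ⬝ᵥ toReal v) →
      ∃ u' : Fin n → ℝ, (∀ l, 0 < u' l) ∧ ∃ g, G ≤ g ∧ g ≤ B * G ∧ ∀ v ∈ V,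
        (u ⬝ᵥ toReal v ≤ u ⬝ᵥ toReal v₀ + g → u' ⬝ᵥ toReal v = u' ⬝ᵥ toReal v₀) ∧
        (u ⬝ᵥ toReal v₀ + g < u ⬝ᵥ toReal v → u' ⬝ᵥ toReal v₀ < u' ⬝ᵥ toReal v) := by
  classical
  have hA : ∀ (I : V.powerset × V), ∃ A : ℝ, 0 ≤ A ∧ ∀ (u : Fin n → ℝ) (g : ℝ), 0 ≤ g →
      (∀ k : I.1.1, |u ⬝ᵥ (toReal k.1 - toReal I.2.1)| ≤ g) →
      ∃ u' : Fin n → ℝ, (∀ k : I.1.1, u' ⬝ᵥ (toReal k.1 - toReal I.2.1) = 0) ∧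
        ∀ l, |u l - u' l| ≤ A * g := fun I => exists_close_orthogonal _
  choose A hA0 hA using hA
  obtain ⟨A₁, hA₁0, hAle⟩ : ∃ A₁ : ℝ, 0 ≤ A₁ ∧ ∀ I, A I ≤ A₁ :=
    ⟨∑ I, A I, Finset.sum_nonneg fun I _ => hA0 I,
      fun I => Finset.single_le_sum (fun I _ => hA0 I) (Finset.mem_univ I)⟩
  obtain ⟨W, hW0, hWle⟩ : ∃ W : ℝ, 0 ≤ W ∧ ∀ v ∈ V, ∀ w ∈ V, ∑ l, |(v l : ℝ) - w l| ≤ W :=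
    ⟨∑ v ∈ V, ∑ w ∈ V, ∑ l, |(v l : ℝ) - w l|, Finset.sum_nonneg fun v _ => Finset.sum_nonneg
      fun w _ => Finset.sum_nonneg fun l _ => abs_nonneg _, fun v hv w hw =>
    (Finset.single_le_sum (f := fun w => ∑ l, |(v l : ℝ) - w l|)
      (fun w _ => Finset.sum_nonneg fun l _ => abs_nonneg _) hw).trans
    (Finset.single_le_sum (f := fun v => ∑ w ∈ V, ∑ l, |(v l : ℝ) - w l|)
      (fun v _ => Finset.sum_nonneg fun w _ => Finset.sum_nonneg fun l _ => abs_nonneg _) hv)⟩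
  set θ : ℝ := 1 + A₁ * W with hθ
  have hθ1 : 1 ≤ θ := by have := mul_nonneg hA₁0 hW0; linarith
  have hpow : 1 ≤ θ ^ V.card := one_le_pow₀ hθ1
  refine ⟨(1 + A₁) * θ ^ V.card, by nlinarith, fun u G hG hu v₀ hv₀ hmin => ?_⟩
  obtain ⟨g, hGg, hgG, hgap⟩ := exists_gap V (fun v => u ⬝ᵥ toReal v - u ⬝ᵥ toReal v₀) hθ1 V.card G
    hG (Finset.card_filter_le _ _)
  have hg : 0 ≤ g := hG.trans hGg
  set I := V.filter fun v => u ⬝ᵥ toReal v - u ⬝ᵥ toReal v₀ ≤ g with hI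
  let J : V.powerset × V := (⟨I, Finset.mem_powerset.2 (Finset.filter_subset _ _)⟩, ⟨v₀, hv₀⟩)
  obtain ⟨u', hu'0, hu'A⟩ := hA J u g hg (fun k => by
    have hk := (Finset.mem_filter.1 k.2)
    have h1 := hmin _ hk.1
    have h2 := hk.2
    rw [dotProduct_sub, abs_of_nonneg (sub_nonneg.2 h1)]
    exact h2)
  have hAJ : A J ≤ A₁ := hAle J
  have hclose : ∀ l, |u l - u' l| ≤ A₁ * g := fun l =>
    (hu'A l).trans (mul_le_mul_of_nonneg_right hAJ hg)
  have hAg : A₁ * g ≤ A₁ * (θ ^ V.card * G) := mul_le_mul_of_nonneg_left hgG hA₁0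
  refine ⟨u', fun l => ?_, g, hGg, ?_, fun v hv => ⟨fun h => ?_, fun h => ?_⟩⟩
  · have h1 := (abs_le.1 (hclose l)).2
    have h2 := hu l
    have h3 : 0 ≤ θ ^ V.card * G := by positivity
    nlinarith
  · have h3 : 0 ≤ A₁ * (θ ^ V.card * G) := by positivity
    nlinarith
  · have := hu'0 ⟨v, Finset.mem_filter.2 ⟨hv, by linarith⟩⟩
    rw [dotProduct_sub] at this
    linarith
  · have h1 : θ * g < u ⬝ᵥ toReal v - u ⬝ᵥ toReal v₀ :=
      (hgap v hv).resolve_left (by linarith)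
    have h2 : (u - u') ⬝ᵥ (toReal v - toReal v₀) ≤ A₁ * g * W := by
      calc (u - u') ⬝ᵥ (toReal v - toReal v₀) ≤ ∑ l, |u l - u' l| * |(v l : ℝ) - v₀ l| :=
            Finset.sum_le_sum fun l _ => by
              rw [← abs_mul]; exact le_abs_self _
        _ ≤ ∑ l, A₁ * g * |(v l : ℝ) - v₀ l| :=
            Finset.sum_le_sum fun l _ => mul_le_mul_of_nonneg_right (hclose l) (abs_nonneg _)
        _ = A₁ * g * ∑ l, |(v l : ℝ) - v₀ l| := by rw [Finset.mul_sum]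
        _ ≤ A₁ * g * W := mul_le_mul_of_nonneg_left (hWle v hv v₀ hv₀) (by positivity)
    rw [sub_dotProduct, dotProduct_sub, dotProduct_sub] at h2
    rw [hθ] at h1
    linarith

/-! ### Dominance of faces on the regions -/

section Region

variable {K : Type*} [NormedField K] {n : ℕ} {c : (Fin n → ℕ) → K}

/-- The logarithmic coordinates `-log |x_l|`, in which monomials become linear functionals. -/
noncomputable def negLog (x : Fin n → K) : Fin n → ℝ := fun l => -Real.log ‖x l‖

theorem mono_ne_zero {x : Fin n → K} (hx : x ∈ torus K n) (α : Fin n → ℕ) : mono x α ≠ 0 :=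
  Finset.prod_ne_zero_iff.2 fun l _ => pow_ne_zero _ (hx l)

theorem norm_mono (x : Fin n → K) (α : Fin n → ℕ) : ‖mono x α‖ = mono (fun l => ‖x l‖) α := by
  simp [mono, norm_prod, norm_pow]

theorem norm_mono_eq_exp {x : Fin n → K} (hx : x ∈ torus K n) (α : Fin n → ℕ) :
    ‖mono x α‖ = Real.exp (-(negLog x ⬝ᵥ toReal α)) := by
  rw [norm_mono, mono, dotProduct, ← Finset.sum_neg_distrib, Real.exp_sum]
  refine Finset.prod_congr rfl fun l _ => ?_
  rw [negLog, toReal, neg_mul, neg_neg, mul_comm, Real.exp_nat_mul,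
    Real.exp_log (norm_pos_iff.2 (hx l))]

theorem norm_mono_le_iff {x : Fin n → K} (hx : x ∈ torus K n) (α β : Fin n → ℕ) :
    ‖mono x α‖ ≤ ‖mono x β‖ ↔ negLog x ⬝ᵥ toReal β ≤ negLog x ⬝ᵥ toReal α := by
  rw [norm_mono_eq_exp hx, norm_mono_eq_exp hx, Real.exp_le_exp, neg_le_neg_iff]

theorem mul_norm_mono_le_iff {x : Fin n → K} (hx : x ∈ torus K n) {r : ℝ} (hr : 0 < r)
    (α β : Fin n → ℕ) : r⁻¹ * ‖mono x α‖ ≤ ‖mono x β‖ ↔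
      negLog x ⬝ᵥ toReal β ≤ negLog x ⬝ᵥ toReal α + Real.log r := by
  have : r⁻¹ = Real.exp (-Real.log r) := by rw [Real.exp_neg, Real.exp_log hr]
  rw [norm_mono_eq_exp hx, norm_mono_eq_exp hx, this, ← Real.exp_add, Real.exp_le_exp]
  constructor <;> intro h <;> linarith

theorem iSup_norm_mono_eq {S : Set (Fin n → ℕ)} {x : Fin n → K} {v₀ : Fin n → ℕ} (h₀ : v₀ ∈ S)
    (hmax : ∀ v ∈ S, ‖mono x v‖ ≤ ‖mono x v₀‖) : (⨆ v : S, ‖mono x v.1‖) = ‖mono x v₀‖ := by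
  have : Nonempty S := ⟨⟨v₀, h₀⟩⟩
  refine le_antisymm (ciSup_le fun v => hmax v.1 v.2) ?_
  refine le_ciSup (f := fun v : S => ‖mono x v.1‖) ⟨‖mono x v₀‖, ?_⟩ ⟨v₀, h₀⟩
  rintro _ ⟨v, rfl⟩
  exact hmax v.1 v.2

/-- Dominance of a face, in terms of a vertex at which the largest monomial is attained. -/
theorem dominates_iff {C : ℕ → ℝ} {i : ℕ} {F : Set (Fin n → ℝ)}
    (hF : F ∈ compactFaces c i) {x : Fin n → K} :
    Dominates c C i F x ↔ ∃ v₀ ∈ verticesOn c F, (∀ v ∈ vertices c, ‖mono x v‖ ≤ ‖mono x v₀‖) ∧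
      (0 < i → ∀ w ∈ verticesOn c F, (C i)⁻¹ * ‖mono x v₀‖ ≤ ‖mono x w‖) := by
  have hne := verticesOn_nonempty hF
  have hfin := verticesOn_finite c F
  have : Nonempty (verticesOn c F) := hne.to_subtype
  have hbdd : BddBelow (Set.range fun v : verticesOn c F => ‖mono x v.1‖) :=
    ⟨0, by rintro _ ⟨v, rfl⟩; exact norm_nonneg _⟩
  constructor
  · rintro ⟨h1, h2⟩
    obtain ⟨v₀, hv₀, hmax⟩ := hfin.exists_maximalFor (fun v => ‖mono x v‖) _ hne
    have hmax' : ∀ v ∈ verticesOn c F, ‖mono x v‖ ≤ ‖mono x v₀‖ := fun v hv =>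
      (le_total ‖mono x v‖ ‖mono x v₀‖).elim id (hmax hv)
    rw [iSup_norm_mono_eq hv₀ hmax'] at h1
    have hb : BddAbove (Set.range fun v : vertices c => ‖mono x v.1‖) := by
      have := (vertices_finite c).to_subtype
      exact Set.Finite.bddAbove (Set.finite_range _)
    have hle : ∀ v ∈ vertices c, ‖mono x v‖ ≤ ‖mono x v₀‖ := fun v hv => by
      rw [h1]; exact le_ciSup hb ⟨v, hv⟩
    refine ⟨v₀, hv₀, hle, fun hi w hw => ?_⟩
    rw [h1]
    exact (h2 hi).trans (ciInf_le hbdd ⟨w, hw⟩)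
  · rintro ⟨v₀, hv₀, hle, h⟩
    have e1 := iSup_norm_mono_eq (S := vertices c) hv₀.1 hle
    have e2 := iSup_norm_mono_eq hv₀ (fun v hv => hle v hv.1)
    refine ⟨e2.trans e1.symm, fun hi => ?_⟩
    rw [e1]
    exact le_ciInf fun w => h hi w.1 w.2

/-- On the region of a face, the monomials of the other vertices are negligible, provided that
the constants of higher index are large. Otherwise a strictly larger face would dominate, because
a functional with large coefficients that is almost minimal at certain vertices is close to one
that is exactly minimal there. -/
theorem exists_vertex_gap (c : (Fin n → ℕ) → K) {κ : ℕ → ℕ}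
    {F : (i : ℕ) → Fin (κ i) → Set (Fin n → ℝ)}
    (hF : ∀ i, Set.range (F i) = compactFaces c i) : ∃ B : ℝ, 1 ≤ B ∧
    ∀ (C : ℕ → ℝ) (G : ℝ) (i : ℕ) (j : Fin (κ i)), 0 ≤ G → i < n →
      (0 < i → 0 < C i ∧ Real.log (C i) ≤ G) →
      (∀ k, i < k → k ≤ n → Real.exp (B * G) ≤ C k) → ∀ x ∈ region c C F i j,
      ∃ v₀ ∈ verticesOn c (F i j), (∀ v ∈ vertices c, ‖mono x v‖ ≤ ‖mono x v₀‖) ∧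
        (∀ l, G < negLog x l) ∧ ∀ v ∈ vertices c, toReal v ∉ F i j →
          negLog x ⬝ᵥ toReal v₀ + G < negLog x ⬝ᵥ toReal v := by
  obtain ⟨V, hV, hcV, hN⟩ := exists_vertices_finset c
  have hmemV : ∀ v, v ∈ vertices c ↔ v ∈ V := fun v => by rw [← hV]; rfl
  obtain ⟨B, hB1, hB⟩ := exists_rounding V
  refine ⟨B, hB1, fun C G i j hG hin hCi hC x hx => ?_⟩
  obtain ⟨hcube, hdom, hnot⟩ := hx
  have hxt : x ∈ torus K n := hcube.1
  have hFij : ∀ i j, F i j ∈ compactFaces c i := fun i j => hF i ▸ Set.mem_range_self j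
  obtain ⟨v₀, hv₀, hmax, hinf⟩ := (dominates_iff (hFij i j)).1 hdom
  have hu : ∀ l, B * G < negLog x l := fun l => by
    have h1 := hcube.2 l
    have h2 := hC n hin le_rfl
    have h3 : ‖x l‖ < Real.exp (-(B * G)) := by
      rw [Real.exp_neg]
      exact h1.trans_le (inv_anti₀ (Real.exp_pos _) h2)
    have h4 := Real.log_lt_log (norm_pos_iff.2 (hxt l)) h3
    rw [Real.log_exp] at h4
    rw [negLog]; linarith
  have hGB : G ≤ B * G := le_mul_of_one_le_left hG hB1
  refine ⟨v₀, hv₀, hmax, fun l => hGB.trans_lt (hu l), fun v hv hvF => ?_⟩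
  by_contra! hle
  have hmin : ∀ v ∈ V, negLog x ⬝ᵥ toReal v₀ ≤ negLog x ⬝ᵥ toReal v := fun v hv =>
    (norm_mono_le_iff hxt _ _).1 (hmax v ((hmemV v).2 hv))
  have hv₀V : v₀ ∈ V := (hmemV _).1 hv₀.1
  obtain ⟨u', hu', g, hGg, hgG, hVg⟩ := hB (negLog x) G hG hu v₀ hv₀V hmin
  have hm' : ∀ v ∈ V, u' ⬝ᵥ toReal v₀ ≤ u' ⬝ᵥ toReal v := fun v hv => by
    rcases le_or_gt (negLog x ⬝ᵥ toReal v) (negLog x ⬝ᵥ toReal v₀ + g) with h | h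
    · exact ((hVg v hv).1 h).ge
    · exact ((hVg v hv).2 h).le
  have hF' := mem_compactFaces_of_pos hN hu' hm' ⟨v₀, hv₀V, rfl⟩
  set F' := {t | t ∈ newtonPolyhedron c ∧ u' ⬝ᵥ t = u' ⬝ᵥ toReal v₀} with hF'def
  set i' := Module.finrank ℝ (vectorSpan ℝ F')
  have hon : ∀ w, w ∈ verticesOn c F' ↔
      w ∈ V ∧ negLog x ⬝ᵥ toReal w ≤ negLog x ⬝ᵥ toReal v₀ + g := fun w => by
    rw [hF'def, mem_verticesOn_iff hV hN]
    refine and_congr_right fun hw => ⟨fun h => ?_, fun h => (hVg w hw).1 h⟩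
    by_contra! h'
    exact ((hVg w hw).2 h').ne' h
  have hsubV : verticesOn c (F i j) ⊆ verticesOn c F' := fun w hw => by
    refine (hon w).2 ⟨(hmemV w).1 hw.1, ?_⟩
    rcases Nat.eq_zero_or_pos i with hi | hi
    · subst hi
      obtain ⟨a, -, ha⟩ := eq_singleton_of_mem_compactFaces_zero (hFij 0 j)
      have h1 : toReal w ∈ F 0 j := hw.2
      have h2 : toReal v₀ ∈ F 0 j := hv₀.2
      rw [ha] at h1 h2
      rw [h1, h2]
      linarith
    · have h1 := (mul_norm_mono_le_iff hxt (hCi hi).1 _ _).1 (hinf hi w hw)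
      linarith [(hCi hi).2]
  have hsub : F i j ⊆ F' := by
    rw [compactFace_eq_convexHull (hFij i j), compactFace_eq_convexHull hF']
    exact convexHull_mono (Set.image_mono hsubV)
  have hvF' : toReal v ∈ F' := ((hon v).2 ⟨(hmemV v).1 hv, by linarith⟩).2
  have hlt : i < i' := dim_lt_dim_of_ssubset (hFij i j) hF' hsub hvF' hvF hvF'.1
  have hi'n : i' < n := dim_lt_of_mem_compactFaces hF' (by omega)
  obtain ⟨j', hj'⟩ : F' ∈ Set.range (F i') := by rw [hF]; exact hF'
  refine hnot i' j' (Or.inl hlt) ?_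
  rw [hj', dominates_iff hF']
  have hCi' := hC i' hlt hi'n.le
  have hCpos : 0 < C i' := (Real.exp_pos _).trans_le hCi'
  refine ⟨v₀, hsubV hv₀, hmax, fun _ w hw => (mul_norm_mono_le_iff hxt hCpos _ _).2 ?_⟩
  have h1 := ((hon w).1 hw).2
  have h2 := Real.log_le_log (Real.exp_pos _) hCi'
  rw [Real.log_exp] at h2
  linarith

end Region

/-! ### The terms off a face -/

theorem summable_pow_sum (n : ℕ) {q : ℝ} (h0 : 0 ≤ q) (h1 : q < 1) :
    Summable fun α : Fin n → ℕ => q ^ ∑ l, α l := by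
  classical
  refine summable_of_sum_le (c := (1 - q)⁻¹ ^ n) (fun α => pow_nonneg h0 _) fun S => ?_
  have hS : S ⊆ Fintype.piFinset fun l : Fin n => S.image fun α => α l := fun α hα =>
    Fintype.mem_piFinset.2 fun l => Finset.mem_image_of_mem _ hα
  calc ∑ α ∈ S, q ^ ∑ l, α l
      ≤ ∑ α ∈ Fintype.piFinset fun l : Fin n => S.image fun α => α l, q ^ ∑ l, α l :=
        Finset.sum_le_sum_of_subset_of_nonneg hS fun α _ _ => pow_nonneg h0 _
    _ = ∏ l : Fin n, ∑ a ∈ S.image fun α => α l, q ^ a := by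
        rw [Finset.prod_univ_sum]
        exact Finset.sum_congr rfl fun α _ => (Finset.prod_pow_eq_pow_sum _ _ _).symm
    _ ≤ ∏ l : Fin n, (1 - q)⁻¹ := by
        refine Finset.prod_le_prod (fun l _ => Finset.sum_nonneg fun a _ => pow_nonneg h0 _)
          fun l _ => ?_
        rw [← tsum_geometric_of_lt_one h0 h1]
        exact (summable_geometric_of_lt_one h0 h1).sum_le_tsum _ fun a _ => pow_nonneg h0 _
    _ = (1 - q)⁻¹ ^ n := by simp

/-- The amount by which an exponent off the face `F` exceeds the minimum of a functional that is
minimal on `F`. -/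
theorem exists_excess {K : Type*} [Zero K] {n : ℕ} (c : (Fin n → ℕ) → K) {i : ℕ}
    {F : Set (Fin n → ℝ)} (hF : F ∈ compactFaces c i) :
    ∃ (μ : (Fin n → ℕ) → ℝ) (D : ℝ), (∀ α, c α ≠ 0 → 0 ≤ μ α ∧ ∑ l, (α l : ℝ) - D ≤ μ α ∧
      (toReal α ∉ F → 0 < μ α)) ∧
      ∀ (u : Fin n → ℝ) (s : ℝ) (v₀ : Fin n → ℕ), 0 ≤ s → (∀ l, s ≤ u l) →
        (∀ v ∈ vertices c, u ⬝ᵥ toReal v₀ ≤ u ⬝ᵥ toReal v) →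
        (∀ v ∈ vertices c, toReal v ∉ F → u ⬝ᵥ toReal v₀ + s ≤ u ⬝ᵥ toReal v) →
        ∀ α, c α ≠ 0 → s * μ α ≤ u ⬝ᵥ toReal α - u ⬝ᵥ toReal v₀ := by
  classical
  obtain ⟨V, hV, hcV, hN⟩ := exists_vertices_finset c
  have hmemV : ∀ v, v ∈ vertices c ↔ v ∈ V := fun v => by rw [← hV]; rfl
  have hw : ∀ α : Fin n → ℕ, ∃ w : (Fin n → ℕ) → ℝ, c α ≠ 0 → (∀ v, 0 ≤ w v) ∧
      ∑ v ∈ V, w v = 1 ∧ ∀ l, ∑ v ∈ V, w v * (v l : ℝ) ≤ α l := fun α => by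
    by_cases h : c α = 0
    · exact ⟨0, fun h' => absurd h h'⟩
    · have := toReal_mem_newtonPolyhedron h
      rw [hN] at this
      obtain ⟨w, hw⟩ := this
      exact ⟨w, fun _ => hw⟩
  choose w hw using hw
  set off := V.filter fun v => toReal v ∉ F
  refine ⟨fun α => ∑ v ∈ off, w α v + ∑ l, ((α l : ℝ) - ∑ v ∈ V, w α v * (v l : ℝ)),
    ∑ l, ∑ v ∈ V, (v l : ℝ), fun α hα => ?_, fun u s v₀ hs hu h1 h2 α hα => ?_⟩
  · obtain ⟨w0, w1, w2⟩ := hw α hα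
    have p1 : 0 ≤ ∑ v ∈ off, w α v := Finset.sum_nonneg fun v _ => w0 v
    have p2 : ∀ l ∈ Finset.univ, 0 ≤ (α l : ℝ) - ∑ v ∈ V, w α v * (v l : ℝ) :=
      fun l _ => sub_nonneg.2 (w2 l)
    have p3 := Finset.sum_nonneg p2
    refine ⟨by positivity, ?_, fun hαF => ?_⟩
    · have : ∑ l, ∑ v ∈ V, w α v * (v l : ℝ) ≤ ∑ l, ∑ v ∈ V, (v l : ℝ) := by
        refine Finset.sum_le_sum fun l _ => Finset.sum_le_sum fun v hv => ?_
        refine mul_le_of_le_one_left (Nat.cast_nonneg _) ?_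
        exact w1 ▸ Finset.single_le_sum (fun v _ => w0 v) hv
      dsimp only
      rw [Finset.sum_sub_distrib]
      linarith
    · refine lt_of_le_of_ne (by positivity) fun h0 => hαF ?_
      have e1 : ∑ v ∈ off, w α v = 0 := by linarith
      have e2 : ∑ l, ((α l : ℝ) - ∑ v ∈ V, w α v * (v l : ℝ)) = 0 := by linarith
      have e1' := (Finset.sum_eq_zero_iff_of_nonneg fun v _ => w0 v).1 e1
      have e2' := (Finset.sum_eq_zero_iff_of_nonneg p2).1 e2
      have hα' : toReal α = ∑ v ∈ V.filter (fun v => toReal v ∈ F), w α v • toReal v := by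
        rw [Finset.sum_filter_of_ne]
        · funext l
          have := e2' l (Finset.mem_univ l)
          simp [toReal]; linarith
        · intro v hv hne
          by_contra hvF
          exact hne (by rw [e1' v (Finset.mem_filter.2 ⟨hv, hvF⟩), zero_smul])
      have hconv : Convex ℝ F := compactFace_eq_convexHull hF ▸ convex_convexHull ℝ _
      rw [hα']
      refine hconv.sum_mem (fun v _ => w0 v) ?_ fun v hv => (Finset.mem_filter.1 hv).2
      rw [← w1]
      refine Finset.sum_filter_of_ne fun v hv hne => ?_
      by_contra hvF
      exact hne (e1' v (Finset.mem_filter.2 ⟨hv, hvF⟩))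
  · obtain ⟨w0, w1, w2⟩ := hw α hα
    have e1 : u ⬝ᵥ toReal α = ∑ v ∈ V, w α v * (u ⬝ᵥ toReal v) +
        ∑ l, u l * ((α l : ℝ) - ∑ v ∈ V, w α v * (v l : ℝ)) := by
      rw [sum_mul_dotProduct_toReal, ← Finset.sum_add_distrib]
      exact Finset.sum_congr rfl fun l _ => by simp only [toReal]; ring
    have e2 : s * ∑ l, ((α l : ℝ) - ∑ v ∈ V, w α v * (v l : ℝ)) ≤
        ∑ l, u l * ((α l : ℝ) - ∑ v ∈ V, w α v * (v l : ℝ)) := by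
      rw [Finset.mul_sum]
      exact Finset.sum_le_sum fun l _ => mul_le_mul_of_nonneg_right (hu l) (sub_nonneg.2 (w2 l))
    have e3 : u ⬝ᵥ toReal v₀ + s * ∑ v ∈ off, w α v ≤ ∑ v ∈ V, w α v * (u ⬝ᵥ toReal v) := by
      calc u ⬝ᵥ toReal v₀ + s * ∑ v ∈ off, w α v
          = ∑ v ∈ V, w α v * (u ⬝ᵥ toReal v₀ + if toReal v ∉ F then s else 0) := by
            simp only [mul_add, Finset.sum_add_distrib, ← Finset.sum_mul, w1, one_mul, mul_ite,
              mul_zero]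
            rw [← Finset.sum_filter, ← Finset.sum_mul, mul_comm s]
        _ ≤ _ := by
            refine Finset.sum_le_sum fun v hv => mul_le_mul_of_nonneg_left ?_ (w0 v)
            split_ifs with h
            · rw [add_zero]; exact h1 v ((hmemV v).2 hv)
            · exact h2 v ((hmemV v).2 hv) h
    simp only [mul_add]
    linarith

open Filter Topology in
/-- If the variables and the monomials of the vertices off `F` are small enough, the terms
off the face `F` add up to little compared with the largest monomial. Each single term is small
because its exponent lies at a positive distance from `F`, and the terms of high degree are dominated by a
geometric series. -/
theorem exists_sum_off_face_le {K : Type*} [NormedField K] {n : ℕ} (c : (Fin n → ℕ) → K) {i : ℕ}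
    {F : Set (Fin n → ℝ)} (hF : F ∈ compactFaces c i) {q M : ℝ} (hq : 0 ≤ q) (hM : 0 ≤ M)
    {b : (Fin n → ℕ) → ℝ} (hb0 : ∀ α, 0 ≤ b α) (hbM : ∀ α, b α ≤ M * q ^ ∑ l, α l)
    (hbc : ∀ α, c α = 0 → b α = 0) {η : ℝ} (hη : 0 < η) :
    ∃ s : ℝ, 0 ≤ s ∧ ∀ x ∈ torus K n, ∀ v₀, (∀ l, s ≤ negLog x l) →
      (∀ v ∈ vertices c, negLog x ⬝ᵥ toReal v₀ ≤ negLog x ⬝ᵥ toReal v) →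
      (∀ v ∈ vertices c, toReal v ∉ F → negLog x ⬝ᵥ toReal v₀ + s ≤ negLog x ⬝ᵥ toReal v) →
      Summable (fun α => b α * ‖mono x α‖) ∧
        ∑' α, {α | toReal α ∉ F}.indicator (fun α => b α * ‖mono x α‖) α ≤ η * ‖mono x v₀‖ := by
  classical
  obtain ⟨μ, D, hμ, hexc⟩ := exists_excess c hF
  obtain ⟨s₀, hs₀0, hs₀⟩ : ∃ s₀ : ℝ, 0 ≤ s₀ ∧ q * Real.exp (-s₀) ≤ 1 / 2 := by
    have h : Tendsto (fun s : ℝ => q * Real.exp (-s)) atTop (𝓝 (q * 0)) :=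
      (Real.tendsto_exp_neg_atTop_nhds_zero).const_mul q
    rw [mul_zero] at h
    have h2 := h.eventually_le_const (show (0 : ℝ) < 1 / 2 by norm_num)
    obtain ⟨s, hs1, hs2⟩ := (h2.and (eventually_ge_atTop 0)).exists
    exact ⟨s, hs2, hs1⟩
  set P : (Fin n → ℕ) → Prop := fun α => c α ≠ 0 ∧ toReal α ∉ F
  set d : ℝ → (Fin n → ℕ) → ℝ := fun s α =>
    if P α then M * q ^ (∑ l, α l) * Real.exp (-(s * μ α)) else 0 with hd
  have hlim : Tendsto (fun s => ∑' α, d s α) atTop (𝓝 (∑' _ : Fin n → ℕ, (0 : ℝ))) := by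
    refine tendsto_tsum_of_dominated_convergence
      (bound := fun α => M * Real.exp (s₀ * D) * (1 / 2) ^ ∑ l, α l)
      ((summable_pow_sum n (by norm_num) (by norm_num)).mul_left _) (fun α => ?_) ?_
    · by_cases hα : P α
      · simp only [hd, hα, if_true]
        have hpos := (hμ α hα.1).2.2 hα.2
        have h1 : Tendsto (fun s : ℝ => s * μ α) atTop atTop := tendsto_id.atTop_mul_const hpos
        have h2 := (Real.tendsto_exp_neg_atTop_nhds_zero.comp h1).const_mul (M * q ^ ∑ l, α l)
        rw [mul_zero] at h2
        exact h2
      · simp only [hd, hα, if_false]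
        exact tendsto_const_nhds
    · filter_upwards [eventually_ge_atTop s₀] with s hs α
      by_cases hα : P α
      · simp only [hd, hα, if_true]
        rw [Real.norm_of_nonneg (by positivity)]
        obtain ⟨m0, m1, -⟩ := hμ α hα.1
        have h1 : Real.exp (-(s * μ α)) ≤ Real.exp (s₀ * D) * Real.exp (-s₀) ^ ∑ l, α l := by
          rw [← Real.exp_nat_mul, ← Real.exp_add, Real.exp_le_exp]
          push_cast
          nlinarith [mul_le_mul_of_nonneg_right hs m0, mul_le_mul_of_nonneg_left m1 hs₀0]
        calc M * q ^ (∑ l, α l) * Real.exp (-(s * μ α))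
            ≤ M * q ^ (∑ l, α l) * (Real.exp (s₀ * D) * Real.exp (-s₀) ^ ∑ l, α l) :=
              mul_le_mul_of_nonneg_left h1 (by positivity)
          _ = M * Real.exp (s₀ * D) * (q * Real.exp (-s₀)) ^ ∑ l, α l := by rw [mul_pow]; ring
          _ ≤ _ := by gcongr
      · simp only [hd, hα, if_false, norm_zero]
        positivity
  rw [tsum_zero] at hlim
  obtain ⟨s, hsη, hss₀⟩ := ((hlim.eventually_le_const hη).and (eventually_ge_atTop s₀)).exists
  have hs0 : 0 ≤ s := hs₀0.trans hss₀
  refine ⟨s, hs0, fun x hx v₀ hu h1 h2 => ?_⟩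
  have hsum : Summable fun α => b α * ‖mono x α‖ := by
    refine Summable.of_nonneg_of_le (fun α => mul_nonneg (hb0 α) (norm_nonneg _))
      (fun α => ?_) ((summable_pow_sum n (q := 1 / 2) (by norm_num) (by norm_num)).mul_left M)
    have h3 : ‖mono x α‖ ≤ Real.exp (-s₀) ^ ∑ l, α l := by
      rw [norm_mono, mono, ← Finset.prod_pow_eq_pow_sum]
      refine Finset.prod_le_prod (fun l _ => by positivity) fun l _ => ?_
      refine pow_le_pow_left₀ (norm_nonneg _) ?_ _
      rw [← Real.log_le_log_iff (norm_pos_iff.2 (hx l)) (Real.exp_pos _), Real.log_exp]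
      have := hu l
      rw [negLog] at this
      linarith
    calc b α * ‖mono x α‖ ≤ (M * q ^ ∑ l, α l) * Real.exp (-s₀) ^ ∑ l, α l :=
          mul_le_mul (hbM α) h3 (norm_nonneg _) (by positivity)
      _ = M * (q * Real.exp (-s₀)) ^ ∑ l, α l := by rw [mul_pow]; ring
      _ ≤ _ := by gcongr
  refine ⟨hsum, ?_⟩
  have hterm : ∀ α, {α | toReal α ∉ F}.indicator (fun α => b α * ‖mono x α‖) α ≤
      d s α * ‖mono x v₀‖ := fun α => by
    by_cases hα : P α
    · rw [Set.indicator_of_mem (show α ∈ {α | toReal α ∉ F} from hα.2)]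
      simp only [hd, hα, if_true]
      have h3 := hexc (negLog x) s v₀ hs0 hu h1 h2 α hα.1
      have h4 : ‖mono x α‖ ≤ Real.exp (-(s * μ α)) * ‖mono x v₀‖ := by
        rw [norm_mono_eq_exp hx, norm_mono_eq_exp hx, ← Real.exp_add, Real.exp_le_exp]
        linarith
      calc b α * ‖mono x α‖
          ≤ (M * q ^ ∑ l, α l) * (Real.exp (-(s * μ α)) * ‖mono x v₀‖) :=
            mul_le_mul (hbM α) h4 (norm_nonneg _) (by positivity)
        _ = _ := by ring
    · simp only [hd, hα, if_false, zero_mul]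
      by_cases h : toReal α ∉ F
      · have h0 : c α = 0 := by by_contra h'; exact hα ⟨h', h⟩
        rw [Set.indicator_of_mem (show α ∈ {α | toReal α ∉ F} from h), hbc α h0, zero_mul]
      · rw [Set.indicator_of_notMem (show α ∉ {α | toReal α ∉ F} from h)]
  have hds : Summable (d s) := by
    refine Summable.of_nonneg_of_le (fun α => ?_) (fun α => ?_)
      ((summable_pow_sum n (q := 1 / 2) (by norm_num) (by norm_num)).mul_left
        (M * Real.exp (s * D)))
    · by_cases hα : P α
      · simp only [hd, hα, if_true]; positivity
      · simp only [hd, hα, if_false]; exact le_rfl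
    · by_cases hα : P α
      · simp only [hd, hα, if_true]
        have h1 : Real.exp (-(s * μ α)) ≤ Real.exp (s * D) * Real.exp (-s) ^ ∑ l, α l := by
          rw [← Real.exp_nat_mul, ← Real.exp_add, Real.exp_le_exp]
          push_cast
          nlinarith [mul_le_mul_of_nonneg_left (hμ α hα.1).2.1 hs0]
        calc M * q ^ (∑ l, α l) * Real.exp (-(s * μ α))
            ≤ M * q ^ (∑ l, α l) * (Real.exp (s * D) * Real.exp (-s) ^ ∑ l, α l) :=
              mul_le_mul_of_nonneg_left h1 (by positivity)
          _ = M * Real.exp (s * D) * (q * Real.exp (-s)) ^ ∑ l, α l := by rw [mul_pow]; ring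
          _ ≤ _ := by
            have : q * Real.exp (-s) ≤ 1 / 2 := le_trans
              (mul_le_mul_of_nonneg_left (Real.exp_le_exp.2 (neg_le_neg hss₀)) hq) hs₀
            gcongr
      · simp only [hd, hα, if_false]; positivity
  calc ∑' α, {α | toReal α ∉ F}.indicator (fun α => b α * ‖mono x α‖) α
      ≤ ∑' α, d s α * ‖mono x v₀‖ :=
        (hsum.indicator _).tsum_le_tsum hterm (hds.mul_right _)
    _ = (∑' α, d s α) * ‖mono x v₀‖ := tsum_mul_right
    _ ≤ η * ‖mono x v₀‖ := mul_le_mul_of_nonneg_right hsη (norm_nonneg _)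

/-! ### Termwise differentiation of power series -/

theorem norm_pow_sub_pow_le {K : Type*} [NormedField K] {x t : K} {ε : ℝ} (hε : 0 < ε)
    (ht : ‖t‖ ≤ ε) (k : ℕ) : ‖(x + t) ^ k - x ^ k‖ ≤ ‖t‖ / ε * (‖x‖ + ε) ^ k := by
  have hτ : ‖t‖ = ‖t‖ / ε * ε := by field_simp
  induction k with
  | zero => simp; positivity
  | succ k ih =>
    have h1 : ‖(x + t) ^ k‖ ≤ (‖x‖ + ε) ^ k := by
      rw [norm_pow]
      exact pow_le_pow_left₀ (norm_nonneg _) ((norm_add_le _ _).trans (by linarith)) _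
    calc ‖(x + t) ^ (k + 1) - x ^ (k + 1)‖ = ‖x * ((x + t) ^ k - x ^ k) + t * (x + t) ^ k‖ := by
          congr 1; ring
      _ ≤ ‖x‖ * (‖t‖ / ε * (‖x‖ + ε) ^ k) + ‖t‖ * (‖x‖ + ε) ^ k := by
          refine (norm_add_le _ _).trans ?_
          rw [norm_mul, norm_mul]
          gcongr
      _ = ‖x‖ * (‖t‖ / ε * (‖x‖ + ε) ^ k) + (‖t‖ / ε * ε) * (‖x‖ + ε) ^ k := by rw [← hτ]
      _ = _ := by ring

/-- A second order Taylor estimate for powers, by a multiple of a slightly larger power. -/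
theorem norm_pow_sub_pow_sub_le {K : Type*} [NormedField K] {x t : K} {ε : ℝ} (hε : 0 < ε)
    (ht : ‖t‖ ≤ ε) (k : ℕ) :
    ‖(x + t) ^ k - x ^ k - t * (k * x ^ (k - 1))‖ ≤ (‖t‖ / ε) ^ 2 * (‖x‖ + ε) ^ k := by
  have hτ : ‖t‖ = ‖t‖ / ε * ε := by field_simp
  induction k with
  | zero => simp; positivity
  | succ k ih =>
    have hk : (k : K) * x ^ k = x * (k * x ^ (k - 1)) := by
      cases k with
      | zero => simp
      | succ k => rw [Nat.add_sub_cancel, pow_succ]; ring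
    calc ‖(x + t) ^ (k + 1) - x ^ (k + 1) - t * ((k + 1 : ℕ) * x ^ (k + 1 - 1))‖
        = ‖x * ((x + t) ^ k - x ^ k - t * (k * x ^ (k - 1))) + t * ((x + t) ^ k - x ^ k)‖ := by
          congr 1
          rw [Nat.add_sub_cancel]
          push_cast
          linear_combination -t * hk
      _ ≤ ‖x‖ * ((‖t‖ / ε) ^ 2 * (‖x‖ + ε) ^ k) + ‖t‖ * (‖t‖ / ε * (‖x‖ + ε) ^ k) := by
          refine (norm_add_le _ _).trans ?_
          rw [norm_mul, norm_mul]
          have := norm_pow_sub_pow_le (x := x) hε ht k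
          gcongr
      _ = ‖x‖ * ((‖t‖ / ε) ^ 2 * (‖x‖ + ε) ^ k) +
          (‖t‖ / ε * ε) * (‖t‖ / ε * (‖x‖ + ε) ^ k) := by rw [← hτ]
      _ = _ := by ring

theorem succ_mul_pow_mul_le {x ε : ℝ} (hx : 0 ≤ x) (hε : 0 ≤ ε) (k : ℕ) :
    (k + 1) * x ^ k * ε ≤ (x + ε) ^ (k + 1) := by
  induction k with
  | zero => simp [hx]
  | succ k ih =>
    have h1 : x ^ (k + 1) ≤ (x + ε) ^ (k + 1) := pow_le_pow_left₀ hx (by linarith) _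
    have h2 := mul_le_mul_of_nonneg_left ih hx
    have h3 := mul_le_mul_of_nonneg_left h1 hε
    rw [pow_succ (x + ε)]
    push_cast
    calc ((k : ℝ) + 1 + 1) * x ^ (k + 1) * ε
        = x * ((k + 1) * x ^ k * ε) + ε * x ^ (k + 1) := by ring
      _ ≤ x * (x + ε) ^ (k + 1) + ε * (x + ε) ^ (k + 1) := add_le_add h2 h3
      _ = _ := by ring

section Mono

variable {R : Type*} [CommMonoid R] {n : ℕ}

theorem mono_eq_mul_erase (x : Fin n → R) (a : Fin n → ℕ) (m : Fin n) :
    mono x a = x m ^ a m * ∏ l ∈ Finset.univ.erase m, x l ^ a l :=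
  (Finset.mul_prod_erase _ _ (Finset.mem_univ m)).symm

theorem mono_add (x : Fin n → R) (a b : Fin n → ℕ) : mono x (a + b) = mono x a * mono x b := by
  simp [mono, pow_add, Finset.prod_mul_distrib]

theorem mono_mul (x y : Fin n → R) (a : Fin n → ℕ) : mono (x * y) a = mono x a * mono y a := by
  simp [mono, mul_pow, Finset.prod_mul_distrib]

theorem mono_single (x : Fin n → R) (m : Fin n) : mono x (Pi.single m 1) = x m := by
  rw [mono_eq_mul_erase x _ m, Finset.prod_eq_one, Pi.single_eq_same, pow_one, mul_one]
  intro l hl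
  rw [Pi.single_eq_of_ne (Finset.ne_of_mem_erase hl), pow_zero]

theorem mono_nonneg {x : Fin n → ℝ} (hx : ∀ l, 0 ≤ x l) (a : Fin n → ℕ) : 0 ≤ mono x a :=
  Finset.prod_nonneg fun l _ => pow_nonneg (hx l) _

theorem mono_le_mono {x y : Fin n → ℝ} (hx : ∀ l, 0 ≤ x l) (hxy : ∀ l, x l ≤ y l)
    (a : Fin n → ℕ) : mono x a ≤ mono y a :=
  Finset.prod_le_prod (fun l _ => pow_nonneg (hx l) _)
    fun l _ => pow_le_pow_left₀ (hx l) (hxy l) _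

end Mono

section Series

variable {K : Type*} [NontriviallyNormedField K] {n : ℕ}

theorem norm_mono_le {x : Fin n → K} {R : Fin n → ℝ} (hx : ∀ l, ‖x l‖ ≤ R l) (a : Fin n → ℕ) :
    ‖mono x a‖ ≤ mono R a := by
  rw [norm_mono]
  exact mono_le_mono (fun l => norm_nonneg _) hx a

theorem natCast_norm_le (k : ℕ) : ‖(k : K)‖ ≤ k := by
  simpa using Nat.norm_cast_le (α := K) k

/-- A power series that converges absolutely on a polydisc may be differentiated term by term in
the directions in which there is room. -/
theorem hasSum_lineDeriv_of_hasSum [CompleteSpace K] {e : (Fin n → ℕ) → K} {g : (Fin n → K) → K}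
    {R : Fin n → ℝ} (hR : Summable fun a => ‖e a‖ * mono R a)
    (hg : ∀ x : Fin n → K, (∀ l, ‖x l‖ ≤ R l) → HasSum (fun a => e a * mono x a) (g x))
    {w : Fin n → K} (hw : ∀ l, ‖w l‖ ≤ R l) {m : Fin n} {ε : ℝ} (hε : 0 < ε)
    (hwm : ‖w m‖ + ε ≤ R m) :
    HasSum (fun a => ((a m + 1 : ℕ) : K) * e (a + Pi.single m 1) * mono w a)
      (lineDeriv K g w (Pi.single m 1)) := by
  set d : (Fin n → ℕ) → K := fun a =>
    e a * ((a m : K) * w m ^ (a m - 1) * ∏ l ∈ Finset.univ.erase m, w l ^ a l) with hd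
  have hR0 : ∀ l, 0 ≤ R l := fun l => (norm_nonneg _).trans (hw l)
  have hrest : ∀ a : Fin n → ℕ, ‖∏ l ∈ Finset.univ.erase m, w l ^ a l‖ ≤
      ∏ l ∈ Finset.univ.erase m, R l ^ a l := fun a => by
    rw [norm_prod]
    refine Finset.prod_le_prod (fun l _ => norm_nonneg _) fun l _ => ?_
    rw [norm_pow]
    exact pow_le_pow_left₀ (norm_nonneg _) (hw l) _
  have hrest0 : ∀ a : Fin n → ℕ, 0 ≤ ∏ l ∈ Finset.univ.erase m, R l ^ a l := fun a =>
    Finset.prod_nonneg fun l _ => pow_nonneg (hR0 l) _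
  have hpow : ∀ k : ℕ, (‖w m‖ + ε) ^ k ≤ R m ^ k := fun k =>
    pow_le_pow_left₀ (by positivity) hwm _
  have hdle : ∀ a, ‖d a‖ ≤ ε⁻¹ * (‖e a‖ * mono R a) := fun a => by
    have h1 : ‖(a m : K) * w m ^ (a m - 1)‖ ≤ ε⁻¹ * R m ^ a m := by
      rw [norm_mul, norm_pow]
      rcases Nat.eq_zero_or_pos (a m) with h | h
      · rw [h]; simp; exact hε.le
      · obtain ⟨k, hk⟩ := Nat.exists_eq_succ_of_ne_zero h.ne'
        rw [hk, Nat.succ_eq_add_one, Nat.add_sub_cancel]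
        have h2 := (succ_mul_pow_mul_le (norm_nonneg (w m)) hε.le k).trans (hpow (k + 1))
        have h3 := natCast_norm_le (K := K) (k + 1)
        rw [inv_mul_eq_div, le_div_iff₀ hε]
        refine le_trans ?_ h2
        gcongr
        push_cast at h3 ⊢
        exact h3
    rw [hd, mono_eq_mul_erase R a m]
    dsimp only
    rw [norm_mul, norm_mul]
    calc ‖e a‖ * (‖(a m : K) * w m ^ (a m - 1)‖ * ‖∏ l ∈ Finset.univ.erase m, w l ^ a l‖)
        ≤ ‖e a‖ * ((ε⁻¹ * R m ^ a m) * ∏ l ∈ Finset.univ.erase m, R l ^ a l) := by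
          have := hrest a
          have := hrest0 a
          have := hR0 m
          gcongr
      _ = _ := by ring
  have hdsum : Summable d := Summable.of_norm_bounded (hR.mul_left ε⁻¹) hdle
  have hline : ∀ t : K, ‖t‖ ≤ ε → ∀ l, ‖(w + t • (Pi.single m 1 : Fin n → K)) l‖ ≤ R l := by
    intro t ht l
    by_cases h : l = m
    · subst h
      simp only [Pi.add_apply, Pi.smul_apply, Pi.single_eq_same, smul_eq_mul, mul_one]
      exact (norm_add_le _ _).trans (by linarith)
    · simp only [Pi.add_apply, Pi.smul_apply, Pi.single_eq_of_ne h, smul_zero, add_zero]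
      exact hw l
  have hmono : ∀ (t : K) (a : Fin n → ℕ), mono (w + t • (Pi.single m 1 : Fin n → K)) a =
      (w m + t) ^ a m * ∏ l ∈ Finset.univ.erase m, w l ^ a l := fun t a => by
    rw [mono_eq_mul_erase _ _ m]
    congr 1
    · simp
    · refine Finset.prod_congr rfl fun l hl => ?_
      simp [Pi.single_eq_of_ne (Finset.ne_of_mem_erase hl)]
  have hderiv : HasLineDerivAt K g (∑' a, d a) w (Pi.single m 1) := by
    rw [HasLineDerivAt, hasDerivAt_iff_isLittleO]
    have hO : (fun t : K => g (w + t • (Pi.single m 1 : Fin n → K)) -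
        g (w + (0 : K) • (Pi.single m 1 : Fin n → K)) - (t - 0) • ∑' a, d a) =O[nhds 0]
        fun t : K => t ^ 2 := by
      refine Asymptotics.IsBigO.of_bound (ε⁻¹ ^ 2 * ∑' a, ‖e a‖ * mono R a) ?_
      filter_upwards [Metric.closedBall_mem_nhds (0 : K) hε] with t ht
      rw [mem_closedBall_zero_iff] at ht
      have h1 := hg _ (hline t ht)
      have h2 := hg _ (hline 0 (by simpa using hε.le))
      have h3 := (h1.sub h2).sub (hdsum.hasSum.mul_left t)
      rw [sub_zero, smul_eq_mul, ← h3.tsum_eq, norm_pow]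
      have h4 : ∀ a, ‖e a * mono (w + t • (Pi.single m 1 : Fin n → K)) a -
          e a * mono (w + (0 : K) • (Pi.single m 1 : Fin n → K)) a - t * d a‖ ≤
          (‖t‖ / ε) ^ 2 * (‖e a‖ * mono R a) := fun a => by
        have h5 := (norm_pow_sub_pow_sub_le (x := w m) hε ht (a m)).trans
          (mul_le_mul_of_nonneg_left (hpow (a m)) (by positivity))
        have h6 : e a * mono (w + t • (Pi.single m 1 : Fin n → K)) a -
            e a * mono (w + (0 : K) • (Pi.single m 1 : Fin n → K)) a - t * d a =
            e a * (((w m + t) ^ a m - w m ^ a m - t * (a m * w m ^ (a m - 1))) *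
              ∏ l ∈ Finset.univ.erase m, w l ^ a l) := by
          rw [hmono, hmono, add_zero]
          ring
        rw [h6, norm_mul, norm_mul, mono_eq_mul_erase R a m]
        calc _ ≤ ‖e a‖ * (((‖t‖ / ε) ^ 2 * R m ^ a m) * ∏ l ∈ Finset.univ.erase m, R l ^ a l) := by
              have := hrest a
              have := hrest0 a
              gcongr
              exact (norm_nonneg _).trans h5
          _ = _ := by ring
      refine (tsum_of_norm_bounded (hR.hasSum.mul_left _) h4).trans (le_of_eq ?_)
      rw [div_eq_mul_inv, mul_pow]
      ring
    refine hO.trans_isLittleO ?_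
    simp only [sub_zero]
    exact Asymptotics.isLittleO_pow_id one_lt_two
  rw [hderiv.lineDeriv]
  have hinj : Function.Injective fun a : Fin n → ℕ => a + Pi.single m 1 :=
    add_left_injective _
  have := (hinj.hasSum_iff (f := d) (a := ∑' a, d a) (fun a ha => ?_)).2 hdsum.hasSum
  · refine this.congr_fun ?_
    intro a
    simp only [hd, Function.comp, Pi.add_apply, Pi.single_eq_same, Nat.add_sub_cancel]
    rw [mono_eq_mul_erase w a m]
    have : ∏ l ∈ Finset.univ.erase m, w l ^ (a l + (Pi.single m 1 : Fin n → ℕ) l) =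
        ∏ l ∈ Finset.univ.erase m, w l ^ a l := Finset.prod_congr rfl fun l hl => by
      rw [Pi.single_eq_of_ne (Finset.ne_of_mem_erase hl), add_zero]
    rw [this]
    ring
  · have : a m = 0 := by
      by_contra h
      refine ha ⟨a - Pi.single m 1, funext fun l => ?_⟩
      by_cases hl : l = m
      · subst hl; simp; omega
      · simp [hl]
    simp [hd, this]

/-- The operator `∑ m, β m ∂/∂z m` on the coefficients of a power series. -/
def dirDerivCoeff (Z : Finset (Fin n)) (β : Z → ℚ) (e : (Fin n → ℕ) → K) : (Fin n → ℕ) → K :=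
  fun a => ∑ m : Z, (β m : K) * (((a m + 1 : ℕ) : K) * e (a + Pi.single m.1 1))

theorem dirDerivCoeff_add (Z : Finset (Fin n)) (β : Z → ℚ) (e e' : (Fin n → ℕ) → K) :
    dirDerivCoeff Z β (e + e') = dirDerivCoeff Z β e + dirDerivCoeff Z β e' := by
  funext a
  simp only [dirDerivCoeff, Pi.add_apply, ← Finset.sum_add_distrib]
  exact Finset.sum_congr rfl fun m _ => by ring

theorem iterate_dirDerivCoeff_add (Z : Finset (Fin n)) (β : Z → ℚ) (p : ℕ)
    (e e' : (Fin n → ℕ) → K) : (dirDerivCoeff Z β)^[p] (e + e') =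
      (dirDerivCoeff Z β)^[p] e + (dirDerivCoeff Z β)^[p] e' := by
  induction p generalizing e e' with
  | zero => rfl
  | succ p ih => rw [Function.iterate_succ_apply, dirDerivCoeff_add, ih]; rfl

/-- A Cauchy estimate: the weighted `ℓ¹` norm of a derivative on a smaller polydisc. -/
theorem dirDerivCoeff_bound {Z : Finset (Fin n)} (β : Z → ℚ) {e : (Fin n → ℕ) → K}
    {R R' : Fin n → ℝ} (hR : Summable fun a => ‖e a‖ * mono R a) (hR' : ∀ l, 0 ≤ R' l)
    (hle : ∀ l, R' l ≤ R l) {ε : ℝ} (hε : 0 < ε) (hZ : ∀ m ∈ Z, R' m + ε ≤ R m) :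
    (Summable fun a => ‖dirDerivCoeff Z β e a‖ * mono R' a) ∧
      ∑' a, ‖dirDerivCoeff Z β e a‖ * mono R' a ≤
        (∑ m, ‖(β m : K)‖) / ε * ∑' a, ‖e a‖ * mono R a := by
  have hR0 : ∀ l, 0 ≤ R l := fun l => (hR' l).trans (hle l)
  have hinj : ∀ m : Fin n, Function.Injective fun a : Fin n → ℕ => a + Pi.single m 1 :=
    fun m => add_left_injective _
  have hs : ∀ m : Z, Summable fun a : Fin n → ℕ =>
      ‖e (a + Pi.single m.1 1)‖ * mono R (a + Pi.single m.1 1) := fun m =>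
    hR.comp_injective (hinj m)
  have ht : ∀ m : Z, ∑' a : Fin n → ℕ, ‖e (a + Pi.single m.1 1)‖ * mono R (a + Pi.single m.1 1) ≤
      ∑' a, ‖e a‖ * mono R a := fun m =>
    Summable.tsum_le_tsum_of_inj _ (hinj m)
      (fun a _ => mul_nonneg (norm_nonneg _) (mono_nonneg hR0 a)) (fun a => le_rfl) (hs m) hR
  have hb : ∀ a, ‖dirDerivCoeff Z β e a‖ * mono R' a ≤ ∑ m : Z, ‖(β m : K)‖ / ε *
      (‖e (a + Pi.single m.1 1)‖ * mono R (a + Pi.single m.1 1)) := fun a => by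
    have h1 : ‖dirDerivCoeff Z β e a‖ ≤
        ∑ m : Z, ‖(β m : K)‖ * (((a m + 1 : ℕ) : ℝ) * ‖e (a + Pi.single m.1 1)‖) := by
      refine (norm_sum_le _ _).trans (Finset.sum_le_sum fun m _ => ?_)
      rw [norm_mul, norm_mul]
      have := natCast_norm_le (K := K) (a m + 1)
      gcongr
    refine (mul_le_mul_of_nonneg_right h1 (mono_nonneg hR' a)).trans ?_
    rw [Finset.sum_mul]
    refine Finset.sum_le_sum fun m _ => ?_
    have h2 : ((a m + 1 : ℕ) : ℝ) * mono R' a * ε ≤ mono R (a + Pi.single m.1 1) := by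
      rw [mono_eq_mul_erase _ _ m.1, mono_eq_mul_erase _ _ m.1]
      have h3 : ∏ l ∈ Finset.univ.erase m.1, R' l ^ a l ≤
          ∏ l ∈ Finset.univ.erase m.1, R l ^ (a + Pi.single m.1 1 : Fin n → ℕ) l := by
        refine Finset.prod_le_prod (fun l _ => pow_nonneg (hR' l) _) fun l hl => ?_
        rw [Pi.add_apply, Pi.single_eq_of_ne (Finset.ne_of_mem_erase hl), add_zero]
        exact pow_le_pow_left₀ (hR' l) (hle l) _
      have h4 := (succ_mul_pow_mul_le (hR' m.1) hε.le (a m)).trans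
        (pow_le_pow_left₀ (add_nonneg (hR' _) hε.le) (hZ m.1 m.2) (a m + 1))
      have h5 : 0 ≤ ∏ l ∈ Finset.univ.erase m.1, R' l ^ a l :=
        Finset.prod_nonneg fun l _ => pow_nonneg (hR' l) _
      rw [Pi.add_apply, Pi.single_eq_same]
      push_cast
      calc ((a m : ℝ) + 1) * (R' m ^ a m * ∏ l ∈ Finset.univ.erase m.1, R' l ^ a l) * ε
          = (((a m : ℝ) + 1) * R' m ^ a m * ε) * ∏ l ∈ Finset.univ.erase m.1, R' l ^ a l := by ring
        _ ≤ _ := mul_le_mul h4 h3 h5 (pow_nonneg (hR0 _) _)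
    calc ‖(β m : K)‖ * (((a m + 1 : ℕ) : ℝ) * ‖e (a + Pi.single m.1 1)‖) * mono R' a
        = ‖(β m : K)‖ / ε *
            (‖e (a + Pi.single m.1 1)‖ * (((a m + 1 : ℕ) : ℝ) * mono R' a * ε)) := by
          field_simp
      _ ≤ _ := by gcongr
  have hsum := summable_sum fun m (_ : m ∈ (Finset.univ : Finset Z)) =>
    (hs m).mul_left (‖(β m : K)‖ / ε)
  have hsum1 : Summable fun a => ‖dirDerivCoeff Z β e a‖ * mono R' a :=
    Summable.of_nonneg_of_le (fun a => mul_nonneg (norm_nonneg _) (mono_nonneg hR' a)) hb hsum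
  refine ⟨hsum1, (hsum1.tsum_le_tsum hb hsum).trans ?_⟩
  rw [Summable.tsum_finsetSum fun m _ => (hs m).mul_left _, Finset.sum_div, Finset.sum_mul]
  refine Finset.sum_le_sum fun m _ => ?_
  rw [tsum_mul_left]
  exact mul_le_mul_of_nonneg_left (ht m) (by positivity)

/-- Iterated derivatives of a power series: their coefficients, and the corresponding Cauchy
estimate. -/
theorem iterate_dirDeriv_hasSum [CompleteSpace K] {Z : Finset (Fin n)} (β : Z → ℚ) {ε : ℝ}
    (hε : 0 < ε) (p : ℕ) {e : (Fin n → ℕ) → K} {g : (Fin n → K) → K}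
    {R R' : Fin n → ℝ} (hR : Summable fun a => ‖e a‖ * mono R a)
    (hR' : ∀ l, 0 ≤ R' l) (hle : ∀ l, R' l ≤ R l) (hZ : ∀ m ∈ Z, R' m + p * ε ≤ R m) :
    ((Summable fun a => ‖(dirDerivCoeff Z β)^[p] e a‖ * mono R' a) ∧
      ∑' a, ‖(dirDerivCoeff Z β)^[p] e a‖ * mono R' a ≤
        ((∑ m, ‖(β m : K)‖) / ε) ^ p * ∑' a, ‖e a‖ * mono R a) ∧
    ((∀ x : Fin n → K, (∀ l, ‖x l‖ ≤ R l) → HasSum (fun a => e a * mono x a) (g x)) →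
      ∀ x : Fin n → K, (∀ l, ‖x l‖ ≤ R' l) →
        HasSum (fun a => (dirDerivCoeff Z β)^[p] e a * mono x a) ((dirDeriv Z β)^[p] g x)) := by
  induction p generalizing e g R with
  | zero =>
    have hb : ∀ a, ‖e a‖ * mono R' a ≤ ‖e a‖ * mono R a := fun a =>
      mul_le_mul_of_nonneg_left (mono_le_mono hR' hle a) (norm_nonneg _)
    have hs : Summable fun a => ‖e a‖ * mono R' a := Summable.of_nonneg_of_le
      (fun a => mul_nonneg (norm_nonneg _) (mono_nonneg hR' a)) hb hR
    refine ⟨⟨hs, ?_⟩, fun hg x hx => hg x fun l => (hx l).trans (hle l)⟩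
    simpa using hs.tsum_le_tsum hb hR
  | succ p ih =>
    classical
    set R₁ : Fin n → ℝ := fun l => if l ∈ Z then R l - ε else R l with hR₁
    have hR₁in : ∀ m ∈ Z, R₁ m = R m - ε := fun m hm => by simp [hR₁, hm]
    have hZ' : ∀ m ∈ Z, R' m + p * ε ≤ R₁ m := fun m hm => by
      have := hZ m hm
      push_cast at this
      rw [hR₁in m hm]
      linarith
    have hR'₁ : ∀ l, R' l ≤ R₁ l := fun l => by
      by_cases h : l ∈ Z
      · have := hZ' l h
        have : 0 ≤ p * ε := by positivity
        linarith
      · simp [hR₁, h, hle l]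
    have hR₁0 : ∀ l, 0 ≤ R₁ l := fun l => (hR' l).trans (hR'₁ l)
    have hR₁R : ∀ l, R₁ l ≤ R l := fun l => by
      simp only [hR₁]; split_ifs <;> linarith
    have hstep : ∀ m ∈ Z, R₁ m + ε ≤ R m := fun m hm => by rw [hR₁in m hm]; linarith
    obtain ⟨h1, h2⟩ := dirDerivCoeff_bound β hR hR₁0 hR₁R hε hstep
    obtain ⟨⟨h3, h4⟩, h5⟩ := ih (g := dirDeriv Z β g) h1 hR'₁ hZ'
    refine ⟨⟨h3, h4.trans ?_⟩, fun hg => h5 fun x hx => ?_⟩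
    · rw [pow_succ, mul_assoc]
      exact mul_le_mul_of_nonneg_left h2 (by positivity)
    · have h6 := fun m : Z => (hasSum_lineDeriv_of_hasSum hR hg
        (fun l => (hx l).trans (hR₁R l)) hε
        ((add_le_add_left (hx m.1) ε).trans (hstep m.1 m.2))).mul_left (β m : K)
      have h7 := hasSum_sum fun m (_ : m ∈ (Finset.univ : Finset Z)) => h6 m
      refine h7.congr_fun ?_
      intro a
      rw [dirDerivCoeff, Finset.sum_mul]
      exact Finset.sum_congr rfl fun m _ => by ring

end Series

/-! ### Orders of vanishing of polynomials and directional derivatives -/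

open Filter Topology Asymptotics

section Order

variable {K : Type*} [NontriviallyNormedField K]

theorem coeff_eq_zero_of_isBigO {p : Polynomial K} {d : ℕ}
    (h : (fun t => p.eval t) =O[𝓝 0] fun t : K => t ^ (d + 1)) {q : ℕ} (hq : q ≤ d) :
    p.coeff q = 0 := by
  induction q using Nat.strong_induction_on with
  | _ q ih =>
    obtain ⟨r, rfl⟩ := Polynomial.X_pow_dvd_iff.2 fun k hk => ih k hk (by omega)
    have hc : (Polynomial.X ^ q * r).coeff q = r.eval 0 := by
      rw [← Polynomial.coeff_zero_eq_eval_zero]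
      simpa using Polynomial.coeff_X_pow_mul r q 0
    rw [hc]
    have h1 : Tendsto (fun t => r.eval t) (𝓝[≠] 0) (𝓝 (r.eval 0)) :=
      (r.continuous.tendsto 0).mono_left nhdsWithin_le_nhds
    have h2 : (fun t => r.eval t) =O[𝓝[≠] 0] fun t : K => t ^ (d + 1 - q) := by
      have h3 : (fun t : K => (t ^ q)⁻¹ * (Polynomial.X ^ q * r).eval t) =O[𝓝[≠] 0]
          fun t : K => (t ^ q)⁻¹ * t ^ (d + 1) :=
        (isBigO_refl _ _).mul (h.mono nhdsWithin_le_nhds)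
      refine h3.congr' ?_ ?_
      · filter_upwards [self_mem_nhdsWithin] with t ht
        have : t ^ q ≠ 0 := pow_ne_zero _ ht
        simp [this]
      · filter_upwards [self_mem_nhdsWithin] with t ht
        rw [← pow_sub_mul_pow t (show q ≤ d + 1 by omega), mul_comm (t ^ (d + 1 - q)),
          inv_mul_cancel_left₀ (pow_ne_zero _ ht)]
    have h4 : Tendsto (fun t : K => t ^ (d + 1 - q)) (𝓝[≠] 0) (𝓝 0) := by
      have := (continuous_pow (M := K) (d + 1 - q)).tendsto 0
      rw [zero_pow (by omega)] at this
      exact this.mono_left nhdsWithin_le_nhds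
    exact tendsto_nhds_unique h1 (h2.trans_tendsto h4)

/-- The restriction of a polynomial to a line through the origin has the values of the homogeneous
components as coefficients. -/
theorem coeff_aeval_C_mul_X {R σ : Type*} [CommRing R] (Q : MvPolynomial σ R) (s : σ → R) (q : ℕ) :
    (MvPolynomial.aeval (fun l => Polynomial.C (s l) * Polynomial.X) Q).coeff q =
      MvPolynomial.eval s (MvPolynomial.homogeneousComponent q Q) := by
  induction Q using MvPolynomial.induction_on' with
  | monomial d r =>
    rw [MvPolynomial.homogeneousComponent_of_mem (MvPolynomial.isHomogeneous_monomial r rfl),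
      MvPolynomial.aeval_monomial]
    have : (d.prod fun l k => (Polynomial.C (s l) * Polynomial.X) ^ k) =
        Polynomial.C (d.prod fun l k => s l ^ k) * Polynomial.X ^ d.degree := by
      rw [Finsupp.prod, Finsupp.prod, map_prod, Finsupp.degree_apply,
        ← Finset.prod_pow_eq_pow_sum, ← Finset.prod_mul_distrib]
      exact Finset.prod_congr rfl fun l _ => by rw [mul_pow, map_pow]
    rw [this, ← mul_assoc, Polynomial.algebraMap_eq, ← map_mul, Polynomial.coeff_C_mul_X_pow]
    split_ifs
    · rw [MvPolynomial.eval_monomial]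
    · rw [map_zero]
  | add p q hp hq => simp [hp, hq]

theorem eval_homogeneousComponent_mul {R σ : Type*} [CommRing R] (Q : MvPolynomial σ R)
    (s : σ → R) (r : R) (q : ℕ) :
    MvPolynomial.eval (fun l => r * s l) (MvPolynomial.homogeneousComponent q Q) =
      r ^ q * MvPolynomial.eval s (MvPolynomial.homogeneousComponent q Q) := by
  rw [← coeff_aeval_C_mul_X, ← coeff_aeval_C_mul_X]
  have : MvPolynomial.aeval (fun l => Polynomial.C (r * s l) * Polynomial.X) Q =
      (MvPolynomial.aeval (fun l => Polynomial.C (s l) * Polynomial.X) Q).comp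
        (Polynomial.C r * Polynomial.X) := by
    induction Q using MvPolynomial.induction_on with
    | C a => simp
    | add p q hp hq => rw [map_add, map_add, hp, hq, Polynomial.add_comp]
    | mul_X p l hp =>
      rw [map_mul, map_mul, hp, Polynomial.mul_comp, MvPolynomial.aeval_X, MvPolynomial.aeval_X]
      simp only [Polynomial.mul_comp, Polynomial.C_comp, Polynomial.X_comp, map_mul]
      ring
  rw [this, Polynomial.comp_C_mul_X_coeff, mul_comm]

/-- A polynomial that vanishes to order `d + 1` at the origin has no terms of degree at most `d`. -/
theorem homogeneousComponent_eq_zero_of_isBigO {σ : Type*} [Fintype σ] {Q : MvPolynomial σ K}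
    {d : ℕ} (h : (fun s => MvPolynomial.eval s Q) =O[𝓝 0] fun s : σ → K => ‖s‖ ^ (d + 1))
    {q : ℕ} (hq : q ≤ d) : MvPolynomial.homogeneousComponent q Q = 0 := by
  refine MvPolynomial.funext fun s => ?_
  rw [map_zero, ← coeff_aeval_C_mul_X]
  refine coeff_eq_zero_of_isBigO (d := d) ?_ hq
  have ht : Tendsto (fun t : K => t • s) (𝓝 0) (𝓝 0) := by
    have : Continuous fun t : K => t • s := by fun_prop
    simpa using this.tendsto 0
  have h1 := h.comp_tendsto ht
  have h2 : (fun t : K => ‖t • s‖ ^ (d + 1)) =O[𝓝 0] fun t : K => t ^ (d + 1) := by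
    refine IsBigO.of_bound (‖s‖ ^ (d + 1)) (Eventually.of_forall fun t => ?_)
    rw [norm_smul, mul_pow, Real.norm_of_nonneg (by positivity), norm_pow, mul_comm]
  have key : ∀ (t : K) (Q : MvPolynomial σ K), MvPolynomial.eval (t • s) Q =
      (MvPolynomial.aeval (fun l => Polynomial.C (s l) * Polynomial.X) Q).eval t := fun t Q => by
    induction Q using MvPolynomial.induction_on with
    | C a => simp
    | add p q hp hq => rw [map_add, map_add, Polynomial.eval_add, hp, hq]
    | mul_X p l hp =>
      rw [map_mul, map_mul, Polynomial.eval_mul, hp, MvPolynomial.eval_X, MvPolynomial.aeval_X,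
        Polynomial.eval_C_mul, Polynomial.eval_X, Pi.smul_apply, smul_eq_mul, mul_comm t]
  exact (h1.trans h2).congr_left fun t => key t Q

theorem isBigO_of_homogeneousComponent_eq_zero {σ : Type*} [Fintype σ] {Q : MvPolynomial σ K}
    {d : ℕ} (h : ∀ q ≤ d, MvPolynomial.homogeneousComponent q Q = 0) :
    (fun s => MvPolynomial.eval s Q) =O[𝓝 0] fun s : σ → K => ‖s‖ ^ (d + 1) := by
  simp only [MvPolynomial.eval_eq']
  refine IsBigO.fun_sum fun a ha => ?_
  have hdeg : d + 1 ≤ ∑ l, a l := by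
    by_contra! hlt
    have h1 := congrArg (MvPolynomial.coeff a) (h a.degree (by
      rw [Finsupp.degree_eq_sum]; omega))
    rw [MvPolynomial.coeff_homogeneousComponent, if_pos rfl, MvPolynomial.coeff_zero] at h1
    exact (MvPolynomial.mem_support_iff.1 ha) h1
  refine IsBigO.of_bound ‖MvPolynomial.coeff a Q‖ ?_
  filter_upwards [Metric.closedBall_mem_nhds (0 : σ → K) one_pos] with s hs
  rw [mem_closedBall_zero_iff] at hs
  rw [norm_mul, norm_prod, Real.norm_of_nonneg (by positivity)]
  refine mul_le_mul_of_nonneg_left ?_ (norm_nonneg _)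
  calc ∏ l, ‖s l ^ a l‖ ≤ ∏ l, ‖s‖ ^ a l := by
        refine Finset.prod_le_prod (fun l _ => norm_nonneg _) fun l _ => ?_
        rw [norm_pow]
        exact pow_le_pow_left₀ (norm_nonneg _) (norm_le_pi_norm s l) _
    _ = ‖s‖ ^ ∑ l, a l := Finset.prod_pow_eq_pow_sum _ _ _
    _ ≤ ‖s‖ ^ (d + 1) := pow_le_pow_of_le_one (norm_nonneg _) hs hdeg

variable {n : ℕ}

theorem lineDeriv_eval (P : MvPolynomial (Fin n) K) (x : Fin n → K) (m : Fin n) :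
    lineDeriv K (fun w => MvPolynomial.eval w P) x (Pi.single m 1) =
      MvPolynomial.eval x (MvPolynomial.pderiv m P) := by
  refine HasLineDerivAt.lineDeriv ?_
  induction P using MvPolynomial.induction_on with
  | C a =>
    simp only [MvPolynomial.eval_C, MvPolynomial.pderiv_C, map_zero]
    exact hasDerivAt_const _ _
  | add p q hp hq =>
    simp only [map_add]
    exact HasDerivAt.add hp hq
  | mul_X p l hp =>
    have h1 : HasDerivAt (fun t : K => (x + t • (Pi.single m 1 : Fin n → K)) l)
        ((Pi.single m 1 : Fin n → K) l) 0 := by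
      simpa using
        ((hasDerivAt_id (0 : K)).mul_const ((Pi.single m 1 : Fin n → K) l)).const_add (x l)
    have h2 := HasDerivAt.mul hp h1
    have h3 : MvPolynomial.eval x (MvPolynomial.pderiv m (p * MvPolynomial.X l)) =
        MvPolynomial.eval x (MvPolynomial.pderiv m p) *
            (x + (0 : K) • (Pi.single m 1 : Fin n → K)) l +
          MvPolynomial.eval (x + (0 : K) • (Pi.single m 1 : Fin n → K)) p *
            (Pi.single m 1 : Fin n → K) l := by
      rw [Derivation.leibniz, MvPolynomial.pderiv_X]
      by_cases h : l = m
      · subst h; simp; ring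
      · simp [Pi.single_eq_of_ne h]; ring
    rw [HasLineDerivAt, h3]
    simp only [map_mul, MvPolynomial.eval_X]
    exact h2

/-- The derivation `∑ m, β m ∂/∂z m` of the polynomial ring. -/
noncomputable def polyDirDeriv (Z : Finset (Fin n)) (β : Z → ℚ) (P : MvPolynomial (Fin n) K) :
    MvPolynomial (Fin n) K :=
  ∑ m : Z, MvPolynomial.C (β m : K) * MvPolynomial.pderiv m.1 P

theorem iterate_dirDeriv_eval (Z : Finset (Fin n)) (β : Z → ℚ) (P : MvPolynomial (Fin n) K)
    (p : ℕ) : (dirDeriv Z β)^[p] (fun w => MvPolynomial.eval w P) =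
      fun w => MvPolynomial.eval w ((polyDirDeriv Z β)^[p] P) := by
  induction p generalizing P with
  | zero => rfl
  | succ p ih =>
    rw [Function.iterate_succ_apply, Function.iterate_succ_apply, ← ih]
    congr 1
    funext w
    simp only [dirDeriv, polyDirDeriv, map_sum, map_mul, MvPolynomial.eval_C, lineDeriv_eval]

/-- The Taylor polynomial of `P` at `a` in the variables with index in `Z`. -/
noncomputable def taylorPoly (Z : Finset (Fin n)) (a : Fin n → K) (P : MvPolynomial (Fin n) K) :
    MvPolynomial Z K :=
  open scoped Classical in
  MvPolynomial.aeval (fun l => (if h : l ∈ Z then MvPolynomial.X ⟨l, h⟩ else 0) +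
    MvPolynomial.C (a l)) P

open scoped Classical in
theorem eval_taylorPoly (Z : Finset (Fin n)) (a : Fin n → K) (P : MvPolynomial (Fin n) K)
    (s : Z → K) : MvPolynomial.eval s (taylorPoly Z a P) =
      MvPolynomial.eval (fun l => (if h : l ∈ Z then s ⟨l, h⟩ else 0) + a l) P := by
  induction P using MvPolynomial.induction_on with
  | C r => simp [taylorPoly]
  | add p q hp hq => simp only [taylorPoly, map_add] at hp hq ⊢; rw [hp, hq]
  | mul_X p l hp =>
    simp only [taylorPoly, map_mul, MvPolynomial.aeval_X, MvPolynomial.eval_X, map_add,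
      MvPolynomial.eval_C] at hp ⊢
    rw [hp]
    by_cases h : l ∈ Z <;> simp [h]

/-- Iterated directional derivatives are given by the homogeneous components of the Taylor
polynomial. -/
theorem iterate_dirDeriv_eval_eq (Z : Finset (Fin n)) (β : Z → ℚ) (P : MvPolynomial (Fin n) K)
    (p : ℕ) (a : Fin n → K) : (dirDeriv Z β)^[p] (fun w => MvPolynomial.eval w P) a =
      (p.factorial : K) * MvPolynomial.eval (fun m => (β m : K))
        (MvPolynomial.homogeneousComponent p (taylorPoly Z a P)) := by
  classical
  -- restriction of a polynomial to the line through `a` in the direction `β`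
  set ψ : MvPolynomial (Fin n) K →ₐ[K] Polynomial K := MvPolynomial.aeval fun l =>
    Polynomial.C (if h : l ∈ Z then (β ⟨l, h⟩ : K) else 0) * Polynomial.X +
      Polynomial.C (a l) with hψ
  have hψ0 : ∀ P, (ψ P).coeff 0 = MvPolynomial.eval a P := fun P => by
    rw [Polynomial.coeff_zero_eq_eval_zero]
    induction P using MvPolynomial.induction_on with
    | C r => simp [hψ]
    | add p q hp hq => simp [hp, hq]
    | mul_X p l hp => rw [map_mul, Polynomial.eval_mul, hp]; simp [hψ]
  have hder : ∀ P, Polynomial.derivative (ψ P) = ψ (polyDirDeriv Z β P) := fun P => by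
    induction P using MvPolynomial.induction_on with
    | C r => simp [hψ, polyDirDeriv]
    | add p q hp hq =>
      have : polyDirDeriv Z β (p + q) = polyDirDeriv Z β p + polyDirDeriv Z β q := by
        simp [polyDirDeriv, mul_add, Finset.sum_add_distrib]
      rw [this, map_add, map_add, map_add, hp, hq]
    | mul_X p l hp =>
      have : polyDirDeriv Z β (p * MvPolynomial.X l) = polyDirDeriv Z β p * MvPolynomial.X l +
          p * MvPolynomial.C (if h : l ∈ Z then (β ⟨l, h⟩ : K) else 0) := by
        simp only [polyDirDeriv, Derivation.leibniz, MvPolynomial.pderiv_X, smul_eq_mul, mul_add,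
          Finset.sum_add_distrib, Finset.sum_mul]
        rw [add_comm]
        congr 1
        · exact Finset.sum_congr rfl fun m _ => by ring
        · by_cases h : l ∈ Z
          · rw [Finset.sum_eq_single ⟨l, h⟩]
            · simp [h]; ring
            · intro m _ hm
              have : l ≠ m.1 := fun h' => hm (Subtype.ext h'.symm)
              simp [this]
            · simp
          · simp only [h, dite_false, map_zero, mul_zero]
            refine Finset.sum_eq_zero fun m _ => ?_
            have : l ≠ m.1 := fun h' => h (h' ▸ m.2)
            simp [this]
      rw [this, map_mul, Polynomial.derivative_mul, hp, map_add, map_mul, map_mul]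
      congr 1
      congr 1
      simp [hψ]
  have hiter : ∀ (p : ℕ) P, Polynomial.derivative^[p] (ψ P) = ψ ((polyDirDeriv Z β)^[p] P) := by
    intro p
    induction p with
    | zero => intro P; rfl
    | succ p ih => intro P; rw [Function.iterate_succ_apply, hder, ih, Function.iterate_succ_apply]
  have hcomp : ψ P = MvPolynomial.aeval (fun m : Z => Polynomial.C (β m : K) * Polynomial.X)
      (taylorPoly Z a P) := by
    induction P using MvPolynomial.induction_on with
    | C r => simp [hψ, taylorPoly]
    | add p q hp hq => simp only [taylorPoly, map_add] at hp hq ⊢; rw [hp, hq]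
    | mul_X p l hp =>
      simp only [taylorPoly, map_mul, MvPolynomial.aeval_X, map_add] at hp ⊢
      rw [hp]
      congr 1
      by_cases h : l ∈ Z <;> simp [hψ, h]
  rw [iterate_dirDeriv_eval, ← coeff_aeval_C_mul_X, ← hcomp]
  dsimp only
  rw [← hψ0, ← hiter, Polynomial.coeff_iterate_derivative, zero_add, Nat.descFactorial_self,
    nsmul_eq_mul]

end Order

/-! ### The charts of a sequence of blowups -/

section Charts

variable {K : Type*} [NontriviallyNormedField K] {n : ℕ}

/-- The properties of a chart of a sequence of blowups that matter here: `L` is linear and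
injective, the domain lies in the punctured unit polydisc, and `γ` is a bijection of the torus
onto itself with differentiable inverse. -/
structure Chart.IsRegular (ch : Chart K n) : Prop where
  linear : ∃ M : Fin n → Fin n → ℕ, ∀ α l, ch.L α l = ∑ k, M l k * α k
  injective : Function.Injective ch.L
  dom_le : ∀ w ∈ ch.dom, w ∈ torus K n ∧ ∀ l, ‖w l‖ ≤ 1
  inverse : ∃ σ : (Fin n → K) → (Fin n → K),
    (∀ x ∈ torus K n, σ x ∈ torus K n ∧ ch.γ (σ x) = x ∧ DifferentiableAt K σ x) ∧
    ∀ w ∈ torus K n, ch.γ w ∈ torus K n ∧ σ (ch.γ w) = w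

theorem Chart.isRegular_start : (Chart.start K n).IsRegular where
  linear := by
    classical
    exact ⟨fun l k => if l = k then 1 else 0, fun α l => by simp [Chart.start]⟩
  injective := Function.injective_id
  dom_le w hw := hw
  inverse := ⟨id, fun x hx => ⟨hx, rfl, differentiableAt_id⟩, fun w hw => ⟨hw, rfl⟩⟩

theorem Chart.IsRegular.blowup {ch ch' : Chart K n} (h : ch.IsRegular) {j k : Fin n} (hjk : j ≠ k)
    (hγ : ch'.γ = ch.γ ∘ blowup j k) (hL : ch'.L = blowupExp j k ∘ ch.L)
    (hdom : ∀ w ∈ ch'.dom, w ∈ torus K n ∧ NewtonBlowup.blowup j k w ∈ ch.dom ∧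
      ‖NewtonBlowup.blowup j k w j‖ ≤ ‖NewtonBlowup.blowup j k w k‖) : ch'.IsRegular where
  linear := by
    obtain ⟨M, hM⟩ := h.linear
    refine ⟨fun l r => if l = k then M k r + M j r else M l r, fun α l => ?_⟩
    rw [hL, Function.comp, blowupExp]
    by_cases hl : l = k
    · subst hl
      simp [hM, add_mul, Finset.sum_add_distrib]
    · simp [hl, hM]
  injective := by
    rw [hL]
    refine Function.Injective.comp (fun α β hαβ => ?_) h.injective
    have hne : ∀ l, l ≠ k → α l = β l := fun l hl => by
      have := congrFun hαβ l
      simpa [blowupExp, hl] using this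
    funext l
    by_cases hl : l = k
    · subst hl
      have h1 := congrFun hαβ l
      have h2 := hne j hjk
      simp only [blowupExp, Function.update_self] at h1
      omega
    · exact hne l hl
  dom_le w hw := by
    obtain ⟨hwt, h1, h2⟩ := hdom w hw
    refine ⟨hwt, fun l => ?_⟩
    by_cases hl : l = j
    · subst hl
      simp only [NewtonBlowup.blowup, Function.update_self, Function.update_of_ne hjk.symm,
        norm_mul] at h2
      exact le_of_mul_le_mul_right (by rwa [one_mul]) (norm_pos_iff.2 (hwt k))
    · have := (h.dom_le _ h1).2 l
      rwa [NewtonBlowup.blowup, Function.update_of_ne hl] at this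
  inverse := by
    obtain ⟨σ, h1, h2⟩ := h.inverse
    have hb : ∀ w ∈ torus K n, NewtonBlowup.blowup j k w ∈ torus K n := fun w hw l => by
      by_cases hl : l = j
      · subst hl
        simpa [NewtonBlowup.blowup] using ⟨hw l, hw k⟩
      · simpa [NewtonBlowup.blowup, hl] using hw l
    refine ⟨fun x => Function.update (σ x) j (σ x j / σ x k), fun x hx => ⟨?_, ?_, ?_⟩,
      fun w hw => ⟨?_, ?_⟩⟩
    · intro l
      by_cases hl : l = j
      · subst hl
        simpa using ⟨(h1 x hx).1 l, (h1 x hx).1 k⟩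
      · simpa [hl] using (h1 x hx).1 l
    · have hk : σ x k ≠ 0 := (h1 x hx).1 k
      have : NewtonBlowup.blowup j k (Function.update (σ x) j (σ x j / σ x k)) = σ x := by
        simp [NewtonBlowup.blowup, hjk.symm, hk]
      rw [hγ, Function.comp, this]
      exact (h1 x hx).2.1
    · have hd := (h1 x hx).2.2
      have hdl : ∀ l, DifferentiableAt K (fun x => σ x l) x := differentiableAt_pi.1 hd
      refine differentiableAt_pi.2 fun l => ?_
      by_cases hl : l = j
      · subst hl
        simp only [Function.update_self, div_eq_mul_inv]
        exact (hdl l).fun_mul ((hdl k).fun_inv ((h1 x hx).1 k))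
      · simp only [Function.update_of_ne hl]
        exact hdl l
    · rw [hγ]
      exact (h2 _ (hb w hw)).1
    · have hk : w k ≠ 0 := hw k
      rw [hγ]
      simp only [Function.comp, (h2 _ (hb w hw)).2]
      simp [NewtonBlowup.blowup, hjk.symm, hk]

theorem isRegular_of_mem_charts (t : BlowupTree n) {ch : Chart K n} (hch : ch ∈ t.charts K) :
    ch.IsRegular := by
  have key : ∀ (t : BlowupTree n) (ch₀ : Chart K n), ch₀.IsRegular →
      ∀ ch ∈ t.chartsFrom ch₀, ch.IsRegular := by
    intro t
    induction t with
    | leaf =>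
      intro ch₀ h ch hch
      simp only [BlowupTree.chartsFrom, List.mem_singleton] at hch
      exact hch ▸ h
    | node j k hjk t₁ t₂ ih₁ ih₂ =>
      intro ch₀ h ch hch
      simp only [BlowupTree.chartsFrom, List.mem_append] at hch
      rcases hch with hch | hch
      · exact ih₁ _ (h.blowup (ch' := ch₀.fst j k) hjk rfl rfl
          fun w hw => ⟨hw.1, hw.2.1, hw.2.2⟩) ch hch
      · exact ih₂ _ (h.blowup (ch' := ch₀.snd j k) hjk.symm rfl rfl
          fun w hw => ⟨hw.1, hw.2.1, hw.2.2.le⟩) ch hch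
  exact key t _ Chart.isRegular_start ch hch

end Charts

/-! ### Orders of vanishing under blowups -/

section OrderBlowup

open Filter Topology Asymptotics

variable {K : Type*} [NontriviallyNormedField K] [CharZero K] {n : ℕ}

/-- If all derivatives of order at most `d` in rational directions vanish, so do all homogeneous
components of degree at most `d` of the Taylor polynomial. -/
theorem homogeneousComponent_taylorPoly_eq_zero {Z : Finset (Fin n)} (hZ : Z.Nonempty)
    {P : MvPolynomial (Fin n) K} {a : Fin n → K} {p : ℕ}
    (h : ∀ β : Z → ℚ, ∑ m, |β m| = 1 →
      (dirDeriv Z β)^[p] (fun w => MvPolynomial.eval w P) a = 0) :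
    MvPolynomial.homogeneousComponent p (taylorPoly Z a P) = 0 := by
  refine MvPolynomial.funext_set (fun _ => (fun r : ℚ => (r : K)) '' {0}ᶜ) (fun _ => ?_)
    fun x hx => ?_
  · exact (Set.finite_singleton (0 : ℚ)).infinite_compl.image (Rat.cast_injective.injOn)
  choose β hβ0 hβ using fun m => hx m (Set.mem_univ m)
  have hS : 0 < ∑ m, |β m| := by
    obtain ⟨m, hm⟩ := hZ
    exact Finset.sum_pos (fun m _ => abs_pos.2 (hβ0 m)) ⟨⟨m, hm⟩, Finset.mem_univ _⟩
  set S := ∑ m, |β m| with hSdef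
  have hS' : (S : K) ≠ 0 := Rat.cast_ne_zero.2 hS.ne'
  have h1 := h (fun m => β m / S) (by
    simp only [abs_div, abs_of_pos hS, ← Finset.sum_div]
    exact div_self hS.ne')
  rw [iterate_dirDeriv_eval_eq] at h1
  have h2 := (mul_eq_zero.1 h1).resolve_left (Nat.cast_ne_zero.2 p.factorial_ne_zero)
  have h3 : x = fun m => (S : K) * ((β m / S : ℚ) : K) := funext fun m => by
    rw [← hβ m]
    push_cast
    field_simp
  rw [map_zero, h3, eval_homogeneousComponent_mul, h2, mul_zero]

open scoped Classical in
/-- The point with the coordinates of `w` in the directions of `Z`, and `1` in the others. -/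
noncomputable def onesOff (Z : Finset (Fin n)) (w : Fin n → K) : Fin n → K :=
  fun l => if l ∈ Z then w l else 1

/-- Let `P = Φ ∘ γ` be, up to a factor not involving the variables in `Z`, a polynomial in the
variables in `Z`. Then at each point of the torus some derivative of `P` in a rational direction
in these variables, of order at most the maximum order of a zero of `Φ`, is different from `0`. -/
theorem exists_dirDeriv_ne_zero {ch : Chart K n} (hch : ch.IsRegular) {Z : Finset (Fin n)}
    (hZ : Z.Nonempty) {P Φ : MvPolynomial (Fin n) K} (hΦ : Φ ≠ 0)
    (hP : ∀ w, MvPolynomial.eval w P = MvPolynomial.eval (ch.γ w) Φ) {y : Fin n → ℕ}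
    (hy : ∀ w, MvPolynomial.eval w P = mono w y * MvPolynomial.eval (onesOff Z w) P)
    {a : Fin n → K} (ha : a ∈ torus K n) (haZ : ∀ l, l ∉ Z → a l = 1) :
    ∃ β : Z → ℚ, ∑ m, |β m| = 1 ∧ ∃ p : ℕ, (p : ℕ∞) ≤ maxZeroOrder Φ ∧
      (dirDeriv Z β)^[p] (fun w => MvPolynomial.eval w P) a ≠ 0 := by
  classical
  obtain ⟨σ, hσ1, hσ2⟩ := hch.inverse
  set b := ch.γ a with hb
  have hbt : b ∈ torus K n := (hσ2 a ha).1
  have hσb : σ b = a := (hσ2 a ha).2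
  by_cases hzero : MvPolynomial.eval b Φ = 0
  · set Q : MvPolynomial (Fin n) K :=
      MvPolynomial.bind₁ (fun l => MvPolynomial.X l + MvPolynomial.C (b l)) Φ with hQ
    have hQe : ∀ s, MvPolynomial.eval s Q = MvPolynomial.eval (s + b) Φ := fun s => by
      have : MvPolynomial.eval s Q = MvPolynomial.eval
          (fun l => MvPolynomial.eval s (MvPolynomial.X l + MvPolynomial.C (b l))) Φ := by
        rw [hQ, MvPolynomial.eval, MvPolynomial.eval₂Hom_bind₁]; rfl
      rw [this]
      congr 2
      funext l
      simp
    have hQ0 : Q ≠ 0 := fun h0 => hΦ (MvPolynomial.funext fun x => by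
      have := hQe (x - b)
      rw [h0, map_zero, sub_add_cancel] at this
      rw [map_zero, ← this])
    have hQ0' : (Q : MvPowerSeries (Fin n) K) ≠ 0 := fun h => hQ0 (MvPolynomial.coe_eq_zero_iff.1 h)
    have hord := MvPowerSeries.ne_zero_iff_order_finite.1 hQ0'
    obtain ⟨D, hD, hdeg⟩ := MvPowerSeries.exists_coeff_ne_zero_and_order hord
    rw [MvPolynomial.coeff_coe] at hD
    have hmax : ((D.degree : ℕ) : ℕ∞) ≤ maxZeroOrder Φ := by
      rw [hdeg]
      exact le_iSup₂ (f := fun a (_ : a ∈ {a : Fin n → K | a ∈ torus K n ∧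
        MvPolynomial.eval a Φ = 0}) => zeroOrder Φ a) b ⟨hbt, hzero⟩
    by_contra! hcon
    -- all derivatives of order at most `d` vanish, hence so does the Taylor polynomial up to `d`
    have hcomp : ∀ q ≤ D.degree, MvPolynomial.homogeneousComponent q (taylorPoly Z a P) = 0 :=
      fun q hq => homogeneousComponent_taylorPoly_eq_zero hZ fun β hβ =>
        hcon β hβ q (le_trans (by exact_mod_cast hq) hmax)
    have hO := isBigO_of_homogeneousComponent_eq_zero hcomp
    -- pass to all variables, then through the inverse of the blowups
    have hO2 : (fun w => MvPolynomial.eval w P) =O[𝓝 a] fun w => ‖w - a‖ ^ (D.degree + 1) := by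
      set ρ : (Fin n → K) → Z → K := fun w m => w m - a m with hρ
      have hρt : Tendsto ρ (𝓝 a) (𝓝 0) := by
        have : Continuous ρ := by fun_prop
        have h0 : ρ a = 0 := by funext m; simp [hρ]
        exact h0 ▸ this.tendsto a
      have h1 := hO.comp_tendsto hρt
      have h2 : ∀ w, MvPolynomial.eval w P =
          mono w y * MvPolynomial.eval (ρ w) (taylorPoly Z a P) := fun w => by
        rw [hy w, eval_taylorPoly]
        congr 3
        funext l
        by_cases hl : l ∈ Z
        · simp [onesOff, hl, hρ]
        · simp [onesOff, hl, haZ l hl]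
      have h3 : (fun w : Fin n → K => mono w y) =O[𝓝 a] fun _ => (1 : ℝ) := by
        have : Continuous fun w : Fin n → K => mono w y := by unfold mono; fun_prop
        exact this.continuousAt.isBigO_one ℝ
      have h4 : (fun w => ‖ρ w‖ ^ (D.degree + 1)) =O[𝓝 a] fun w => ‖w - a‖ ^ (D.degree + 1) := by
        refine IsBigO.pow (IsBigO.norm_norm
          (IsBigO.of_bound 1 (Eventually.of_forall fun w => ?_))) _
        rw [one_mul]
        exact (pi_norm_le_iff_of_nonneg (norm_nonneg _)).2 fun m => norm_le_pi_norm (w - a) m.1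
      refine ((h3.mul (h1.trans h4)).congr_left fun w => (h2 w).symm).congr_right fun w => ?_
      rw [one_mul]
    have hO3 : (fun x => MvPolynomial.eval x Φ) =O[𝓝 b] fun x => ‖x - b‖ ^ (D.degree + 1) := by
      have hd := (hσ1 b hbt).2.2
      have hσt : Tendsto σ (𝓝 b) (𝓝 a) := hσb ▸ hd.continuousAt.tendsto
      have h1 := hO2.comp_tendsto hσt
      have h2 : (fun x => ‖σ x - a‖ ^ (D.degree + 1)) =O[𝓝 b]
          fun x => ‖x - b‖ ^ (D.degree + 1) := by
        have := hd.isBigO_sub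
        rw [hσb] at this
        exact this.norm_norm.pow _
      refine (h1.trans h2).congr' ?_ EventuallyEq.rfl
      have hopen : ∀ᶠ x in 𝓝 b, x ∈ torus K n := by
        refine (eventually_all.2 fun l => ?_ : ∀ᶠ x in 𝓝 b, ∀ l, x l ≠ 0)
        exact (continuous_apply l).continuousAt.eventually_ne (hbt l)
      filter_upwards [hopen] with x hx
      rw [Function.comp, hP, (hσ1 x hx).2.1]
    have hO4 : (fun s => MvPolynomial.eval s Q) =O[𝓝 0] fun s => ‖s‖ ^ (D.degree + 1) := by
      have ht : Tendsto (fun s => s + b) (𝓝 0) (𝓝 b) := by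
        have : Continuous fun s : Fin n → K => s + b := by fun_prop
        simpa using this.tendsto 0
      refine ((hO3.comp_tendsto ht).congr_left fun s => (hQe s).symm).congr_right fun s => ?_
      simp
    have := congrArg (MvPolynomial.coeff D) (homogeneousComponent_eq_zero_of_isBigO hO4 le_rfl)
    rw [MvPolynomial.coeff_homogeneousComponent, if_pos rfl, MvPolynomial.coeff_zero] at this
    exact hD this
  · obtain ⟨m, hm⟩ := hZ
    refine ⟨fun k => if k = ⟨m, hm⟩ then 1 else 0, ?_, 0, by simp, ?_⟩
    · rw [Finset.sum_eq_single ⟨m, hm⟩] <;> simp +contextual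
    · rw [Function.iterate_zero, id, hP]
      exact hzero

end OrderBlowup

/-! ### The polynomial of a face in the coordinates of a chart -/

section FacePoly

variable {K : Type*} [NontriviallyNormedField K] {n : ℕ} {c : (Fin n → ℕ) → K} {i : ℕ}
  {F : Set (Fin n → ℝ)}

theorem finite_lattice_face (hF : F ∈ compactFaces c i) :
    {α : Fin n → ℕ | toReal α ∈ F}.Finite := by
  obtain ⟨R, hR⟩ := hF.2.1.isBounded.exists_norm_le
  refine (Set.finite_Iic (fun _ : Fin n => ⌈R⌉₊)).subset fun α hα l => ?_
  have h1 := (norm_le_pi_norm _ l).trans (hR _ hα)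
  have h2 : (α l : ℝ) ≤ R := (le_abs_self _).trans h1
  exact Nat.cast_le.1 (h2.trans (Nat.le_ceil R))

theorem eval_monomial_equivFun (x : Fin n → K) (α : Fin n → ℕ) (r : K) :
    MvPolynomial.eval x (MvPolynomial.monomial (Finsupp.equivFunOnFinite.symm α) r) =
      r * mono x α := by
  rw [MvPolynomial.eval_monomial, Finsupp.prod_fintype _ _ fun l => pow_zero _]
  rfl

theorem facePoly_eq_sum (hF : F ∈ compactFaces c i) : facePoly c F =
    ∑ α ∈ (finite_lattice_face hF).toFinset,
      MvPolynomial.monomial (Finsupp.equivFunOnFinite.symm α) (c α) :=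
  finsum_mem_eq_finite_toFinset_sum _ _

theorem facePoly_ne_zero (hF : F ∈ compactFaces c i) : facePoly c F ≠ 0 := by
  classical
  obtain ⟨v, hv⟩ := verticesOn_nonempty hF
  intro h
  have h1 := congrArg (MvPolynomial.coeff (Finsupp.equivFunOnFinite.symm v)) h
  rw [facePoly_eq_sum hF, MvPolynomial.coeff_sum, MvPolynomial.coeff_zero,
    Finset.sum_eq_single v] at h1
  · rw [MvPolynomial.coeff_monomial, if_pos rfl] at h1
    exact ne_zero_of_mem_vertices hv.1 h1
  · intro α _ hα
    rw [MvPolynomial.coeff_monomial,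
      if_neg fun h' => hα (Finsupp.equivFunOnFinite.symm.injective h')]
  · intro h'
    exact absurd ((finite_lattice_face hF).mem_toFinset.2
      (show v ∈ {α | toReal α ∈ F} from hv.2)) h'

/-- The polynomial `f_F ∘ γ` of a face in the coordinates of a chart. -/
noncomputable def chartPoly (ch : Chart K n) (hF : F ∈ compactFaces c i) :
    MvPolynomial (Fin n) K :=
  ∑ α ∈ (finite_lattice_face hF).toFinset,
    MvPolynomial.monomial (Finsupp.equivFunOnFinite.symm (ch.L α)) (c α)

theorem eval_chartPoly (ch : Chart K n) (hF : F ∈ compactFaces c i) (w : Fin n → K) :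
    MvPolynomial.eval w (chartPoly ch hF) =
      ∑ α ∈ (finite_lattice_face hF).toFinset, c α * mono w (ch.L α) := by
  simp only [chartPoly, map_sum, eval_monomial_equivFun]

theorem eval_chartPoly_eq_facePoly {ch : Chart K n}
    (hmono : ∀ x α, mono (ch.γ x) α = mono x (ch.L α)) (hF : F ∈ compactFaces c i)
    (w : Fin n → K) :
    MvPolynomial.eval w (chartPoly ch hF) = MvPolynomial.eval (ch.γ w) (facePoly c F) := by
  rw [eval_chartPoly, facePoly_eq_sum hF]
  simp only [map_sum, eval_monomial_equivFun, hmono]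

/-- The `z` variables in terms of a least exponent `L v'` among all vertices and a greatest one
`L v''` among the vertices on the face. -/
theorem exists_zVars_spec {ch : Chart K n}
    (ht : ∀ v ∈ vertices c, ∀ w ∈ vertices c, ch.L v ≤ ch.L w ∨ ch.L w ≤ ch.L v)
    (hF : F ∈ compactFaces c i) : ∃ v' ∈ vertices c, ∃ v'' ∈ verticesOn c F,
      (∀ w ∈ vertices c, ch.L v' ≤ ch.L w) ∧ (∀ w ∈ verticesOn c F, ch.L w ≤ ch.L v'') ∧
      ∀ r, r ∈ zVars c F ch ↔ ch.L v' r < ch.L v'' r := by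
  have hne := verticesOn_nonempty hF
  obtain ⟨v', hv', hmin⟩ := (vertices_finite c).exists_minimalFor ch.L _ (hne.mono fun _ h => h.1)
  obtain ⟨v'', hv'', hmax⟩ := (verticesOn_finite c F).exists_maximalFor ch.L _ hne
  have h1 : ∀ w ∈ vertices c, ch.L v' ≤ ch.L w := fun w hw =>
    (ht v' hv' w hw).elim id fun h => hmin hw h
  have h2 : ∀ w ∈ verticesOn c F, ch.L w ≤ ch.L v'' := fun w hw =>
    (ht w hw.1 v'' hv''.1).elim id fun h => hmax hw h
  refine ⟨v', hv', v'', hv'', h1, h2, fun r => ?_⟩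
  simp only [zVars, Finset.mem_filter, Finset.mem_univ, true_and]
  constructor
  · rintro ⟨u', u'', ⟨hu', hu'2⟩, ⟨hu'', hu''2⟩, hlt⟩
    exact ((h1 u' hu') r).trans_lt (hlt.trans_le (h2 u'' hu'' r))
  · exact fun h => ⟨v', v'', ⟨hv', h1⟩, ⟨hv'', h2⟩, h⟩

theorem zVars_nonempty {ch : Chart K n} (hch : ch.IsRegular)
    (ht : ∀ v ∈ vertices c, ∀ w ∈ vertices c, ch.L v ≤ ch.L w ∨ ch.L w ≤ ch.L v)
    (hF : F ∈ compactFaces c i) (hi : 0 < i) : (zVars c F ch).Nonempty := by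
  obtain ⟨v', hv', v'', hv'', h1, h2, hZ⟩ := exists_zVars_spec ht hF
  obtain ⟨a, ha, b, hb, hab⟩ := exists_ne_mem_verticesOn hF hi
  by_contra hne
  rw [Finset.not_nonempty_iff_eq_empty] at hne
  have hle : ch.L v'' ≤ ch.L v' := fun r => by
    by_contra! h
    have := (hZ r).2 h
    rw [hne] at this
    exact Finset.notMem_empty r this
  exact hab (hch.injective (((h2 a ha).trans (hle.trans (h1 b hb.1))).antisymm
    ((h2 b hb).trans (hle.trans (h1 a ha.1)))))

theorem yExp_of_mem {ch : Chart K n} {r : Fin n} (hr : r ∈ zVars c F ch) : yExp c F ch r = 0 := by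
  simp [yExp, hr]

/-- On a face, all exponents have the same `y`-part. -/
theorem L_eq_yExp {ch : Chart K n} (hch : ch.IsRegular)
    (ht : ∀ v ∈ vertices c, ∀ w ∈ vertices c, ch.L v ≤ ch.L w ∨ ch.L w ≤ ch.L v)
    (hF : F ∈ compactFaces c i) {α : Fin n → ℕ} (hα : toReal α ∈ F) {r : Fin n}
    (hr : r ∉ zVars c F ch) : ch.L α r = yExp c F ch r := by
  obtain ⟨v', hv', v'', hv'', h1, h2, hZ⟩ := exists_zVars_spec ht hF
  have hconst : ∀ v ∈ verticesOn c F, ch.L v r = ch.L v'' r := fun v hv => by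
    have h3 : ch.L v' r ≤ ch.L v r := h1 v hv.1 r
    have h4 : ch.L v r ≤ ch.L v'' r := h2 v hv r
    have h5 : ¬ ch.L v' r < ch.L v'' r := mt (hZ r).2 hr
    omega
  have hy : yExp c F ch r = ch.L v'' r := by
    have : (fun v => ch.L v r) '' verticesOn c F = {ch.L v'' r} := by
      ext k
      constructor
      · rintro ⟨v, hv, rfl⟩
        exact hconst v hv
      · rintro rfl
        exact ⟨v'', hv'', rfl⟩
    simp [yExp, hr, this]
  rw [hy]
  obtain ⟨M, hM⟩ := hch.linear
  have hsub : convexHull ℝ (toReal '' verticesOn c F) ⊆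
      {t | (fun k => (M r k : ℝ)) ⬝ᵥ t = ch.L v'' r} := by
    refine convexHull_min ?_ ?_
    · rintro _ ⟨v, hv, rfl⟩
      rw [Set.mem_ofPred_eq, ← hconst v hv, hM]
      simp [dotProduct, toReal]
    · intro x hx y hy a b ha hb hab
      simp only [Set.mem_ofPred_eq] at hx hy ⊢
      rw [dotProduct_add, dotProduct_smul, dotProduct_smul, hx, hy, ← add_smul, hab, one_smul]
  have h6 := hsub (compactFace_eq_convexHull hF ▸ hα)
  rw [Set.mem_ofPred_eq] at h6
  have h7 : (ch.L α r : ℝ) = ch.L v'' r := by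
    rw [← h6, hM α]
    simp [dotProduct, toReal]
  exact_mod_cast h7

theorem yExp_le {ch : Chart K n} (hch : ch.IsRegular)
    (ht : ∀ v ∈ vertices c, ∀ w ∈ vertices c, ch.L v ≤ ch.L w ∨ ch.L w ≤ ch.L v)
    (hF : F ∈ compactFaces c i) {α : Fin n → ℕ} (hα : toReal α ∈ F) :
    yExp c F ch ≤ ch.L α := fun r => by
  by_cases hr : r ∈ zVars c F ch
  · rw [yExp_of_mem hr]; exact Nat.zero_le _
  · exact (L_eq_yExp hch ht hF hα hr).ge

/-- `f_F ∘ γ` is `y ^ α` times a polynomial in the `z` variables. -/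
theorem eval_chartPoly_factor {ch : Chart K n} (hch : ch.IsRegular)
    (ht : ∀ v ∈ vertices c, ∀ w ∈ vertices c, ch.L v ≤ ch.L w ∨ ch.L w ≤ ch.L v)
    (hF : F ∈ compactFaces c i) (w : Fin n → K) :
    MvPolynomial.eval w (chartPoly ch hF) = mono w (yExp c F ch) *
      MvPolynomial.eval (onesOff (zVars c F ch) w) (chartPoly ch hF) := by
  rw [eval_chartPoly, eval_chartPoly, Finset.mul_sum]
  refine Finset.sum_congr rfl fun α hα => ?_
  have hα' : α ∈ {α | toReal α ∈ F} := (Set.Finite.mem_toFinset _).1 hα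
  rw [mul_left_comm]
  congr 1
  simp only [mono, ← Finset.prod_mul_distrib]
  refine Finset.prod_congr rfl fun l _ => ?_
  by_cases hl : l ∈ zVars c F ch
  · simp [onesOff, hl, yExp_of_mem hl]
  · simp [onesOff, hl, L_eq_yExp hch ht hF hα' hl]

theorem norm_mono_le_of_le {w : Fin n → K} (hw : ∀ l, ‖w l‖ ≤ 1) {a b : Fin n → ℕ} (hab : a ≤ b) :
    ‖mono w b‖ ≤ ‖mono w a‖ := by
  rw [norm_mono, norm_mono]
  exact Finset.prod_le_prod (fun l _ => pow_nonneg (norm_nonneg _) _) fun l _ =>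
    pow_le_pow_of_le_one (norm_nonneg _) (hw l) (hab l)

/-- On the blown-up region of a face, the `z` variables are bounded away from `0`. -/
theorem inv_le_norm_of_mem_zVars {ch : Chart K n} (hch : ch.IsRegular)
    (hmono : ∀ x α, mono (ch.γ x) α = mono x (ch.L α))
    (ht : ∀ v ∈ vertices c, ∀ w ∈ vertices c, ch.L v ≤ ch.L w ∨ ch.L w ≤ ch.L v)
    (hF : F ∈ compactFaces c i) (hi : 0 < i) {C : ℕ → ℝ} (hC : 0 < C i) {w : Fin n → K}
    (hw : w ∈ ch.dom) (hdom : Dominates c C i F (ch.γ w)) {r : Fin n} (hr : r ∈ zVars c F ch) :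
    (C i)⁻¹ ≤ ‖w r‖ := by
  obtain ⟨v', hv', v'', hv'', h1, h2, hZ⟩ := exists_zVars_spec ht hF
  obtain ⟨v₀, hv₀, hmax, hinf⟩ := (dominates_iff hF).1 hdom
  obtain ⟨hwt, hw1⟩ := hch.dom_le w hw
  have h3 := (mul_le_mul_of_nonneg_left (hmax v' hv') (inv_nonneg.2 hC.le)).trans (hinf hi v'' hv'')
  rw [hmono, hmono] at h3
  have h4 : ch.L v' + Pi.single r 1 ≤ ch.L v'' := fun l => by
    by_cases hl : l = r
    · subst hl
      simpa using (hZ l).1 hr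
    · simpa [hl] using h1 v'' hv''.1 l
  have h5 := norm_mono_le_of_le hw1 h4
  rw [mono_add, mono_single, norm_mul] at h5
  have h6 : 0 < ‖mono w (ch.L v')‖ := norm_pos_iff.2 (mono_ne_zero hwt _)
  refine le_of_mul_le_mul_right ?_ h6
  linarith

end FacePoly

/-! ### Derivatives in the `z` variables and factors in the `y` variables -/

section Factor

variable {K : Type*} [NontriviallyNormedField K] {n : ℕ} {Z : Finset (Fin n)}

theorem mono_add_smul_single {y : Fin n → ℕ} {m : Fin n} (hm : y m = 0) (w : Fin n → K) (t : K) :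
    mono (w + t • (Pi.single m 1 : Fin n → K)) y = mono w y := by
  refine Finset.prod_congr rfl fun l _ => ?_
  by_cases hl : l = m
  · subst hl; simp [hm]
  · simp [hl]

theorem iterate_dirDeriv_div_mono {y : Fin n → ℕ} (hy : ∀ m ∈ Z, y m = 0) (β : Z → ℚ) (p : ℕ)
    (g : (Fin n → K) → K) : (dirDeriv Z β)^[p] (fun w => g w / mono w y) =
      fun w => (dirDeriv Z β)^[p] g w / mono w y := by
  induction p generalizing g with
  | zero => rfl
  | succ p ih =>
    rw [Function.iterate_succ_apply, Function.iterate_succ_apply, ← ih]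
    congr 1
    funext w
    rw [dirDeriv, dirDeriv, Finset.sum_div]
    refine Finset.sum_congr rfl fun m _ => ?_
    rw [mul_div_assoc]
    congr 1
    rw [lineDeriv, lineDeriv]
    simp only [mono_add_smul_single (hy m.1 m.2)]
    rw [deriv_div_const]

theorem onesOff_add_smul_single {m : Fin n} (hm : m ∈ Z) (w : Fin n → K) (t : K) :
    onesOff Z (w + t • (Pi.single m 1 : Fin n → K)) =
      onesOff Z w + t • (Pi.single m 1 : Fin n → K) := by
  funext l
  by_cases hl : l ∈ Z
  · simp [onesOff, hl]
  · have : l ≠ m := fun h => hl (h ▸ hm)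
    simp [onesOff, hl, this]

theorem iterate_dirDeriv_factor {y : Fin n → ℕ} (hy : ∀ m ∈ Z, y m = 0) (β : Z → ℚ) (p : ℕ)
    {g : (Fin n → K) → K} (hg : ∀ w, g w = mono w y * g (onesOff Z w)) (w : Fin n → K) :
    (dirDeriv Z β)^[p] g w = mono w y * (dirDeriv Z β)^[p] g (onesOff Z w) := by
  induction p generalizing g w with
  | zero => exact hg w
  | succ p ih =>
    rw [Function.iterate_succ_apply]
    refine ih (fun w => ?_) w
    rw [dirDeriv, dirDeriv, Finset.mul_sum]
    refine Finset.sum_congr rfl fun m _ => ?_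
    rw [mul_left_comm]
    congr 1
    rw [lineDeriv, lineDeriv, ← deriv_const_mul_field]
    congr 1
    funext t
    rw [hg, mono_add_smul_single (hy m.1 m.2), onesOff_add_smul_single m.2]

end Factor

/-! ### The contribution of the terms off a face -/

section ErrorTerm

variable {K : Type*} [NontriviallyNormedField K] {n : ℕ}

theorem extend_mul_hasSum {R : Type*} [NonUnitalNonAssocSemiring R] [TopologicalSpace R]
    {ι ι' : Type*} {L : ι → ι'} (hL : Function.Injective L) (c : ι → R) (G : ι' → R) {s : R} :
    HasSum (fun a => Function.extend L c 0 a * G a) s ↔ HasSum (fun α => c α * G (L α)) s := by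
  rw [← hL.hasSum_iff]
  · simp only [Function.comp_def, hL.extend_apply]
  · intro a ha
    rw [Function.extend_apply' _ _ _ ha, Pi.zero_apply, zero_mul]

theorem norm_extend {ι ι' : Type*} (L : ι → ι') (c : ι → K) (a : ι') :
    ‖Function.extend L c 0 a‖ = Function.extend L (fun α => ‖c α‖) 0 a := by
  classical
  rw [Function.extend_def, Function.extend_def]
  split_ifs <;> simp

/-- The coefficients of a power series that converges near `0` grow at most geometrically. -/
theorem exists_coeff_bound {U : Set (Fin n → K)} (hU : IsOpen U) (h0U : (0 : Fin n → K) ∈ U)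
    {f : (Fin n → K) → K} {c : (Fin n → ℕ) → K}
    (hf : ∀ x ∈ U, HasSum (fun α : Fin n → ℕ => c α * mono x α) (f x)) :
    ∃ M q : ℝ, 0 ≤ M ∧ 0 ≤ q ∧ ∀ α, ‖c α‖ ≤ M * q ^ ∑ l, α l := by
  obtain ⟨ρ, hρ, hball⟩ := Metric.isOpen_iff.1 hU 0 h0U
  obtain ⟨t, ht0, htρ⟩ := NormedField.exists_norm_lt K hρ
  have hmem : (fun _ => t : Fin n → K) ∈ U := hball (by
    rw [mem_ball_zero_iff, pi_norm_lt_iff hρ]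
    exact fun _ => htρ)
  have hs := (hf _ hmem).summable.tendsto_cofinite_zero.norm
  obtain ⟨M, hM⟩ := hs.bddAbove_range_of_cofinite
  refine ⟨max M 0, ‖t‖⁻¹, le_max_right _ _, by positivity, fun α => ?_⟩
  have h1 : ‖c α * mono (fun _ => t) α‖ ≤ M := hM ⟨α, rfl⟩
  have h2 : mono (fun _ => t) α = t ^ ∑ l, α l := Finset.prod_pow_eq_pow_sum _ _ _
  rw [h2, norm_mul, norm_pow] at h1
  rw [inv_pow, ← div_eq_mul_inv, le_div_iff₀ (by positivity)]
  exact h1.trans (le_max_left _ _)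

/-- In a chart, the derivatives of `f ∘ γ` differ from those of `f_F ∘ γ` by little compared with
the largest monomial, where the variables and the monomials of the vertices off `F` are small.

The Cauchy estimates are applied on a polydisc with twice the radii `‖w l‖`. On it, the exponent
`α` contributes at most `A ^ |α|` times what it contributes at `w`. -/
theorem exists_dirDeriv_sub_le [CompleteSpace K]
    {U : Set (Fin n → K)} (hU : IsOpen U) (h0U : (0 : Fin n → K) ∈ U)
    {f : (Fin n → K) → K} {c : (Fin n → ℕ) → K}
    (hf : ∀ x ∈ U, HasSum (fun α : Fin n → ℕ => c α * mono x α) (f x))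
    {ch : Chart K n} (hch : ch.IsRegular) (hmono : ∀ x α, mono (ch.γ x) α = mono x (ch.L α))
    {i : ℕ} {F : Set (Fin n → ℝ)} (hF : F ∈ compactFaces c i) {η : ℝ} (hη : 0 < η) :
    ∃ s : ℝ, 0 ≤ s ∧ ∀ w ∈ ch.dom, ∀ v₀, (∀ l, s ≤ negLog (ch.γ w) l) →
      (∀ v ∈ vertices c, negLog (ch.γ w) ⬝ᵥ toReal v₀ ≤ negLog (ch.γ w) ⬝ᵥ toReal v) →
      (∀ v ∈ vertices c, toReal v ∉ F →
        negLog (ch.γ w) ⬝ᵥ toReal v₀ + s ≤ negLog (ch.γ w) ⬝ᵥ toReal v) →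
      ∀ (Z : Finset (Fin n)) (β : Z → ℚ) (p : ℕ) (ε : ℝ), 0 < ε → (∀ m ∈ Z, p * ε ≤ ‖w m‖) →
        ‖(dirDeriv Z β)^[p] (f ∘ ch.γ) w -
          (dirDeriv Z β)^[p] (fun w => MvPolynomial.eval w (chartPoly ch hF)) w‖ ≤
          ((∑ m, ‖(β m : K)‖) / ε) ^ p * (η * ‖mono (ch.γ w) v₀‖) := by
  classical
  obtain ⟨M, q, hM, hq, hc⟩ := exists_coeff_bound hU h0U hf
  obtain ⟨ρ, hρ, hball⟩ := Metric.isOpen_iff.1 hU 0 h0U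
  obtain ⟨N, hN⟩ := hch.linear
  set Λ : ℕ := ∑ l, ∑ k, N l k with hΛ
  set A : ℝ := 2 ^ Λ with hA
  have hA1 : 1 ≤ A := one_le_pow₀ one_le_two
  -- doubling the variables of the chart
  have hdouble : ∀ (w : Fin n → K) (α : Fin n → ℕ),
      mono (fun l => 2 * ‖w l‖) (ch.L α) ≤ A ^ (∑ l, α l) * ‖mono (ch.γ w) α‖ := fun w α => by
    have h1 : mono (fun l => 2 * ‖w l‖) (ch.L α) = 2 ^ (∑ l, ch.L α l) * ‖mono (ch.γ w) α‖ := by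
      rw [hmono, norm_mono, ← Finset.prod_pow_eq_pow_sum]
      exact mono_mul (fun _ => (2 : ℝ)) (fun l => ‖w l‖) _
    rw [h1, hA, ← pow_mul]
    refine mul_le_mul_of_nonneg_right (pow_le_pow_right₀ one_le_two ?_) (norm_nonneg _)
    simp only [hN, hΛ, Finset.sum_mul]
    refine Finset.sum_le_sum fun l _ => Finset.sum_le_sum fun k _ => ?_
    exact Nat.mul_le_mul_left _
      (Finset.single_le_sum (fun _ _ => Nat.zero_le _) (Finset.mem_univ k))
  obtain ⟨s₁, hs₁0, hs₁⟩ := exists_sum_off_face_le c hF (mul_nonneg hq (zero_le_one.trans hA1)) hM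
    (b := fun α => ‖c α‖ * A ^ ∑ l, α l) (fun α => by positivity)
    (fun α => by
      rw [mul_pow, ← mul_assoc]
      exact mul_le_mul_of_nonneg_right (hc α) (by positivity))
    (fun α h => by simp [h]) hη
  obtain ⟨s₂, hs₂⟩ : ∃ s₂ : ℝ, ∀ t : ℝ, 0 < t → s₂ ≤ -Real.log t → A * t < ρ := by
    refine ⟨-Real.log (ρ / (2 * A)), fun t ht h => ?_⟩
    have h1 : t ≤ ρ / (2 * A) := by
      rw [← Real.log_le_log_iff ht (by positivity)]
      linarith
    calc A * t ≤ A * (ρ / (2 * A)) := by gcongr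
      _ = ρ / 2 := by field_simp
      _ < ρ := by linarith
  refine ⟨max s₁ s₂, hs₁0.trans (le_max_left _ _), fun w hw v₀ hu hmin hgap Z β p ε hε hZ => ?_⟩
  obtain ⟨hwt, hw1⟩ := hch.dom_le w hw
  obtain ⟨σ, -, hσ⟩ := hch.inverse
  have hxt : ch.γ w ∈ torus K n := (hσ w hwt).1
  obtain ⟨hsum, hoff⟩ := hs₁ (ch.γ w) hxt v₀ (fun l => (le_max_left _ _).trans (hu l)) hmin
    fun v hv hvF => (add_le_add_right (le_max_left _ _) _).trans (hgap v hv hvF)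
  set R : Fin n → ℝ := fun l => 2 * ‖w l‖ with hR
  have hR0 : ∀ l, 0 ≤ R l := fun l => by positivity
  have hγU : ∀ w' : Fin n → K, (∀ l, ‖w' l‖ ≤ R l) → ch.γ w' ∈ U := fun w' hw' => by
    refine hball ?_
    rw [mem_ball_zero_iff, pi_norm_lt_iff hρ]
    intro l
    have h1 := (norm_mono_le hw' (ch.L (Pi.single l 1))).trans (hdouble w (Pi.single l 1))
    rw [← hmono, mono_single, mono_single, Finset.sum_pi_single', if_pos (Finset.mem_univ l),
      pow_one] at h1
    exact h1.trans_lt (hs₂ _ (norm_pos_iff.2 (hxt l)) ((le_max_right _ _).trans (hu l)))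
  -- the coefficients of `f ∘ γ`, split into the terms on the face and the others
  set e : ((Fin n → ℕ) → K) → (Fin n → ℕ) → K := fun c => Function.extend ch.L c 0 with he
  have hnorm : ∀ c' : (Fin n → ℕ) → K, (∀ α, ‖c' α‖ ≤ ‖c α‖) →
      Summable (fun α => ‖c' α‖ * mono R (ch.L α)) ∧
      HasSum (fun a => ‖e c' a‖ * mono R a) (∑' α, ‖c' α‖ * mono R (ch.L α)) := fun c' hc' => by
    have h1 : Summable fun α => ‖c' α‖ * mono R (ch.L α) := by
      refine Summable.of_nonneg_of_le
        (fun α => mul_nonneg (norm_nonneg _) (mono_nonneg hR0 _)) (fun α => ?_) hsum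
      rw [mul_assoc]
      exact mul_le_mul (hc' α) (hdouble w α) (mono_nonneg hR0 _) (norm_nonneg _)
    refine ⟨h1, ?_⟩
    have h2 := (extend_mul_hasSum hch.injective (fun α => ‖c' α‖) (mono R)).2 h1.hasSum
    simpa only [he, norm_extend] using h2
  set cF : (Fin n → ℕ) → K := {α | toReal α ∈ F}.indicator c with hcF
  set cO : (Fin n → ℕ) → K := {α | toReal α ∉ F}.indicator c with hcO
  have hadd : e c = e cF + e cO := by
    have h1 : c = cF + cO := by
      have : {α : Fin n → ℕ | toReal α ∉ F} = {α | toReal α ∈ F}ᶜ := rfl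
      rw [hcF, hcO, this, Set.indicator_self_add_compl]
    funext a
    simp only [he, Pi.add_apply]
    by_cases ha : ∃ α, ch.L α = a
    · obtain ⟨α, rfl⟩ := ha
      simp only [hch.injective.extend_apply]
      exact congrFun h1 α
    · simp [Function.extend_apply' _ _ _ ha]
  have hle : ∀ l, ‖w l‖ ≤ R l := fun l => by
    have := norm_nonneg (w l)
    simp only [hR]; linarith
  have hroom : ∀ m ∈ Z, ‖w m‖ + p * ε ≤ R m := fun m hm => by
    have := hZ m hm
    simp only [hR]; linarith
  have hsc := (hnorm c fun _ => le_rfl).2.summable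
  have hscF := (hnorm cF fun α => norm_indicator_le_norm_self _ _).2.summable
  have hsO := hnorm cO fun α => norm_indicator_le_norm_self _ _
  have hD := (iterate_dirDeriv_hasSum β hε p (g := f ∘ ch.γ) hsc (fun l => norm_nonneg (w l)) hle
    hroom).2 (fun x hx => (extend_mul_hasSum hch.injective c (mono x)).2 (by
      have := hf _ (hγU x hx)
      simp only [hmono] at this
      exact this)) w fun l => le_rfl
  have hDF := (iterate_dirDeriv_hasSum β hε p
    (g := fun w => MvPolynomial.eval w (chartPoly ch hF)) hscF (fun l => norm_nonneg (w l)) hle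
    hroom).2 (fun x hx => (extend_mul_hasSum hch.injective cF (mono x)).2 (by
      rw [eval_chartPoly]
      have h1 : ∑ α ∈ (finite_lattice_face hF).toFinset, c α * mono x (ch.L α) =
          ∑ α ∈ (finite_lattice_face hF).toFinset, cF α * mono x (ch.L α) := by
        refine Finset.sum_congr rfl fun α hα => ?_
        rw [hcF, Set.indicator_of_mem ((Set.Finite.mem_toFinset _).1 hα)]
      rw [h1]
      refine hasSum_sum_of_ne_finset_zero fun α hα => ?_
      rw [hcF, Set.indicator_of_notMem fun h => hα ((Set.Finite.mem_toFinset _).2 h), zero_mul]))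
    w fun l => le_rfl
  obtain ⟨hDO1, hDO2⟩ := (iterate_dirDeriv_hasSum (g := f) β hε p hsO.2.summable
    (fun l => norm_nonneg (w l)) hle hroom).1
  have hdiff := hD.sub hDF
  rw [hadd, iterate_dirDerivCoeff_add] at hdiff
  simp only [Pi.add_apply, add_mul, add_sub_cancel_left] at hdiff
  rw [← hdiff.tsum_eq]
  refine (tsum_of_norm_bounded hDO1.hasSum fun a => ?_).trans (hDO2.trans ?_)
  · rw [norm_mul, norm_mono]
  · refine mul_le_mul_of_nonneg_left ?_ (by positivity)
    rw [hsO.2.tsum_eq]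
    refine le_trans ?_ hoff
    refine hsO.1.tsum_le_tsum (fun α => ?_) (hsum.indicator _)
    by_cases hα : α ∈ {α : Fin n → ℕ | toReal α ∉ F}
    · rw [hcO, Set.indicator_of_mem hα, Set.indicator_of_mem hα, mul_assoc]
      exact mul_le_mul_of_nonneg_left (hdouble w α) (norm_nonneg _)
    · rw [hcO, Set.indicator_of_notMem hα, Set.indicator_of_notMem hα, norm_zero, zero_mul]

end ErrorTerm

/-! ### Lower bounds on the blown-up regions -/

section LowerBounds

open Filter Topology

variable {K : Type*} [NontriviallyNormedField K] {n : ℕ}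

theorem continuous_eval_iterate_dirDeriv (Z : Finset (Fin n)) (β : Z → ℚ) (p : ℕ)
    (P : MvPolynomial (Fin n) K) :
    Continuous ((dirDeriv Z β)^[p] fun w => MvPolynomial.eval w P) := by
  rw [iterate_dirDeriv_eval]
  exact MvPolynomial.continuous_eval _

/-- The points with coordinates of absolute value between `r⁻¹` and `1` in the directions of `Z`,
and coordinates equal to `1` in the others. -/
def annulus (Z : Finset (Fin n)) (r : ℝ) : Set (Fin n → K) :=
  {a | ∀ l, (l ∈ Z → r⁻¹ ≤ ‖a l‖ ∧ ‖a l‖ ≤ 1) ∧ (l ∉ Z → a l = 1)}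

theorem isCompact_annulus [ProperSpace K] (Z : Finset (Fin n)) (r : ℝ) :
    IsCompact (annulus Z r : Set (Fin n → K)) := by
  classical
  have : (annulus Z r : Set (Fin n → K)) = Set.pi Set.univ fun l =>
      if l ∈ Z then {z : K | r⁻¹ ≤ ‖z‖} ∩ Metric.closedBall 0 1 else {1} := by
    ext a
    simp only [annulus, Set.mem_ofPred_eq, Set.mem_pi, Set.mem_univ, true_imp_iff]
    refine forall_congr' fun l => ?_
    by_cases h : l ∈ Z <;> simp [h]
  rw [this]
  refine isCompact_univ_pi fun l => ?_
  split_ifs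
  · exact (isCompact_closedBall 0 1).inter_left (isClosed_le continuous_const continuous_norm)
  · exact isCompact_singleton

/-- Finitely many derivatives in rational directions in the `z` variables, of orders bounded by the
maximum order of a zero of the face polynomial, suffice to bound `f_F ∘ γ` from below. -/
theorem exists_finite_dirDeriv_cover [ProperSpace K] [CharZero K] {c : (Fin n → ℕ) → K} {i : ℕ}
    {F : Set (Fin n → ℝ)} {ch : Chart K n} (hch : ch.IsRegular)
    (hmono : ∀ x α, mono (ch.γ x) α = mono x (ch.L α))
    (ht : ∀ v ∈ vertices c, ∀ w ∈ vertices c, ch.L v ≤ ch.L w ∨ ch.L w ≤ ch.L v)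
    (hF : F ∈ compactFaces c i) (hi : 0 < i) {r : ℝ} (hr : 0 < r) :
    ∃ (q : ℕ) (D : Fin q → Set (Fin n → K)) (β : Fin q → zVars c F ch → ℚ) (p : Fin q → ℕ)
      (δ : Fin q → ℝ), annulus (zVars c F ch) r ⊆ ⋃ l, D l ∧
      ∀ l, ∑ m, |β l m| = 1 ∧ (p l : ℕ∞) ≤ maxZeroOrder (facePoly c F) ∧ 0 < δ l ∧
        ∀ a ∈ D l, δ l ≤ ‖(dirDeriv (zVars c F ch) (β l))^[p l]
          (fun w => MvPolynomial.eval w (chartPoly ch hF)) a‖ := by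
  have hpt : ∀ a : Fin n → K, ∃ (β : zVars c F ch → ℚ) (p : ℕ), a ∈ annulus (zVars c F ch) r →
      ∑ m, |β m| = 1 ∧ (p : ℕ∞) ≤ maxZeroOrder (facePoly c F) ∧
        (dirDeriv (zVars c F ch) β)^[p]
          (fun w => MvPolynomial.eval w (chartPoly ch hF)) a ≠ 0 := fun a => by
    by_cases ha : a ∈ annulus (zVars c F ch) r
    · have hat : a ∈ torus K n := fun l => by
        by_cases hl : l ∈ zVars c F ch
        · exact norm_pos_iff.1 ((inv_pos.2 hr).trans_le ((ha l).1 hl).1)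
        · rw [(ha l).2 hl]; exact one_ne_zero
      obtain ⟨β, h1, p, h2, h3⟩ := exists_dirDeriv_ne_zero hch (zVars_nonempty hch ht hF hi)
        (facePoly_ne_zero hF) (eval_chartPoly_eq_facePoly hmono hF)
        (eval_chartPoly_factor hch ht hF) hat fun l hl => (ha l).2 hl
      exact ⟨β, p, fun _ => ⟨h1, h2, h3⟩⟩
    · exact ⟨0, 0, fun h => absurd h ha⟩
  choose β p hβ using hpt
  set g : (Fin n → K) → (Fin n → K) → K := fun a => (dirDeriv (zVars c F ch) (β a))^[p a]
    fun w => MvPolynomial.eval w (chartPoly ch hF) with hg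
  obtain ⟨S, hS, hcov⟩ := (isCompact_annulus (zVars c F ch) r).elim_nhds_subcover
    (fun a => {w | ‖g a a‖ / 2 < ‖g a w‖}) fun a ha => by
      have h1 : 0 < ‖g a a‖ := norm_pos_iff.2 (hβ a ha).2.2
      exact (continuous_eval_iterate_dirDeriv _ _ _ _).norm.continuousAt.eventually
        (lt_mem_nhds (half_lt_self h1))
  refine ⟨S.card, fun l => {w | ‖g (S.equivFin.symm l) (S.equivFin.symm l)‖ / 2 <
    ‖g (S.equivFin.symm l) w‖}, fun l => β (S.equivFin.symm l), fun l => p (S.equivFin.symm l),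
    fun l => ‖g (S.equivFin.symm l) (S.equivFin.symm l)‖ / 2, fun w hw => ?_, fun l => ?_⟩
  · obtain ⟨a, ha, hwa⟩ := Set.mem_iUnion₂.1 (hcov hw)
    exact Set.mem_iUnion.2 ⟨S.equivFin ⟨a, ha⟩, by simpa using hwa⟩
  · have := hβ _ (hS _ (S.equivFin.symm l).2)
    exact ⟨this.1, this.2.1, half_pos (norm_pos_iff.2 this.2.2), fun a ha => le_of_lt ha⟩

variable [LocallyCompactSpace K]
  {U : Set (Fin n → K)} {f : (Fin n → K) → K} {c : (Fin n → ℕ) → K}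
  {κ : ℕ → ℕ} {F : (i : ℕ) → Fin (κ i) → Set (Fin n → ℝ)}

/-- On the region of `F i j`, if the constants of higher index are large, the derivatives of
`f ∘ γ` are arbitrarily close to those of `f_F ∘ γ`. -/
theorem eventually_dirDeriv_sub_le (hU : IsOpen U) (h0U : (0 : Fin n → K) ∈ U)
    (hf : ∀ x ∈ U, HasSum (fun α : Fin n → ℕ => c α * mono x α) (f x))
    (hF : ∀ i, Set.range (F i) = compactFaces c i) {ch : Chart K n} (hch : ch.IsRegular)
    (hmono : ∀ x α, mono (ch.γ x) α = mono x (ch.L α)) {i : ℕ} (hin : i < n) (j : Fin (κ i))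
    (hFij : F i j ∈ compactFaces c i) {η : ℝ} (hη : 0 < η) (r : ℝ) :
    ∀ᶠ τ : ℝ in atTop, ∀ C : ℕ → ℝ, (0 < i → 0 < C i ∧ C i ≤ r) →
      (∀ k, i < k → k ≤ n → τ ≤ C k) → ∀ w ∈ blownRegion c C F i j ch,
      ∃ v₀ ∈ verticesOn c (F i j),
        ∀ (Z : Finset (Fin n)) (β : Z → ℚ) (p : ℕ) (ε : ℝ), 0 < ε → (∀ m ∈ Z, p * ε ≤ ‖w m‖) →
        ‖(dirDeriv Z β)^[p] (f ∘ ch.γ) w -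
          (dirDeriv Z β)^[p] (fun w => MvPolynomial.eval w (chartPoly ch hFij)) w‖ ≤
          ((∑ m, ‖(β m : K)‖) / ε) ^ p * (η * ‖mono (ch.γ w) v₀‖) := by
  have : ProperSpace K := ProperSpace.of_locallyCompactSpace K
  obtain ⟨B, hB1, hB⟩ := exists_vertex_gap c hF
  obtain ⟨s, hs0, hs⟩ := exists_dirDeriv_sub_le hU h0U hf hch hmono hFij hη
  set G := max s (Real.log r) with hG
  have hG0 : 0 ≤ G := hs0.trans (le_max_left _ _)
  filter_upwards [eventually_ge_atTop (Real.exp (B * G))] with τ hτ C hCi hC w hw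
  obtain ⟨v₀, hv₀, hmax, hu, hgap⟩ := hB C G i j hG0 hin
    (fun hi => ⟨(hCi hi).1, (Real.log_le_log (hCi hi).1 (hCi hi).2).trans (le_max_right _ _)⟩)
    (fun k hk hkn => hτ.trans (hC k hk hkn)) (ch.γ w) hw.1
  have hxt : ch.γ w ∈ torus K n := hw.1.1.1
  exact ⟨v₀, hv₀, hs w hw.2 v₀ (fun l => (le_max_left _ _).trans (hu l).le)
    (fun v hv => (norm_mono_le_iff hxt _ _).1 (hmax v hv))
    fun v hv hvF => (add_le_add_right (le_max_left _ _) _).trans (hgap v hv hvF).le⟩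

/-- The lower bounds on the region of a face of positive dimension. -/
theorem eventually_lower_bound_of_pos [CharZero K] (hU : IsOpen U) (h0U : (0 : Fin n → K) ∈ U)
    (hf : ∀ x ∈ U, HasSum (fun α : Fin n → ℕ => c α * mono x α) (f x))
    (hF : ∀ i, Set.range (F i) = compactFaces c i) {ch : Chart K n} (hch : ch.IsRegular)
    (hmono : ∀ x α, mono (ch.γ x) α = mono x (ch.L α))
    (ht : ∀ v ∈ vertices c, ∀ w ∈ vertices c, ch.L v ≤ ch.L w ∨ ch.L w ≤ ch.L v)
    {i : ℕ} (hi : 0 < i) (hin : i < n) (j : Fin (κ i)) {r : ℝ} (hr : 0 < r) :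
    ∀ᶠ τ : ℝ in atTop, ∀ C : ℕ → ℝ, C i = r → (∀ k, i < k → k ≤ n → τ ≤ C k) →
      ∃ (q : ℕ) (B : Fin q → Set (zVars c (F i j) ch → K)),
        (zVars c (F i j) ch).restrict '' blownRegion c C F i j ch = ⋃ l, B l ∧
        ∀ l, ∃ β : zVars c (F i j) ch → ℚ, ∑ m, |β m| = 1 ∧
          ∃ p : ℕ, (p : ℕ∞) ≤ maxZeroOrder (facePoly c (F i j)) ∧
          ∃ δ : ℝ, 0 < δ ∧ ∀ x ∈ blownRegion c C F i j ch,
            (zVars c (F i j) ch).restrict x ∈ B l →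
              δ ≤ ‖(dirDeriv (zVars c (F i j) ch) β)^[p]
                (quotientBy f ch (yExp c (F i j) ch)) x‖ ∧
              δ * ‖mono x (yExp c (F i j) ch)‖ ≤
                ‖(dirDeriv (zVars c (F i j) ch) β)^[p] (f ∘ ch.γ) x‖ := by
  classical
  have : ProperSpace K := ProperSpace.of_locallyCompactSpace K
  have hFij : F i j ∈ compactFaces c i := hF i ▸ Set.mem_range_self j
  set Z := zVars c (F i j) ch with hZ
  set y := yExp c (F i j) ch with hy
  have hyZ : ∀ m ∈ Z, y m = 0 := fun m hm => yExp_of_mem hm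
  obtain ⟨q, D, β, p, δ, hcov, hD⟩ := exists_finite_dirDeriv_cover hch hmono ht hFij hi hr
  -- steps `ε l` such that the `z` variables leave room for `p l` of them
  set ε : Fin q → ℝ := fun l => r⁻¹ / (p l + 1) with hε
  have hε0 : ∀ l, 0 < ε l := fun l => by positivity
  have hpε : ∀ l, p l * ε l ≤ r⁻¹ := fun l => by
    rw [hε]
    dsimp only
    rw [mul_div_assoc', div_le_iff₀ (by positivity)]
    have : 0 < r⁻¹ := inv_pos.2 hr
    linarith
  obtain ⟨η, hη, hηδ⟩ : ∃ η : ℝ, 0 < η ∧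
      ∀ l, ((∑ m, ‖(β l m : K)‖) / ε l) ^ p l * η ≤ δ l / 2 := by
    have h1 : ∀ l, ∀ᶠ η in 𝓝[>] (0 : ℝ), ((∑ m, ‖(β l m : K)‖) / ε l) ^ p l * η ≤ δ l / 2 :=
      fun l => by
        have h2 : Tendsto (fun η : ℝ => ((∑ m, ‖(β l m : K)‖) / ε l) ^ p l * η) (𝓝[>] 0)
            (𝓝 (((∑ m, ‖(β l m : K)‖) / ε l) ^ p l * 0)) :=
          (tendsto_id.const_mul _).mono_left nhdsWithin_le_nhds
        rw [mul_zero] at h2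
        exact h2.eventually_le_const (half_pos (hD l).2.2.1)
    obtain ⟨η, h3, h4⟩ := ((eventually_all.2 h1).and self_mem_nhdsWithin).exists
    exact ⟨η, h4, h3⟩
  filter_upwards [eventually_dirDeriv_sub_le hU h0U hf hF hch hmono hin j hFij hη r] with
    τ hτ C hCi hC
  have herr := hτ C (fun _ => ⟨hCi ▸ hr, hCi.le⟩) hC
  have hann : ∀ w ∈ blownRegion c C F i j ch, onesOff Z w ∈ annulus Z r := fun w hw l => by
    obtain ⟨-, hw1⟩ := hch.dom_le w hw.2
    refine ⟨fun hl => ?_, fun hl => by simp [onesOff, hl]⟩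
    have := inv_le_norm_of_mem_zVars hch hmono ht hFij hi (hCi ▸ hr) hw.2 hw.1.2.1 hl
    rw [hCi] at this
    simpa [onesOff, hl] using ⟨this, hw1 l⟩
  -- `onesOff Z w` depends only on the `z` variables
  let ext : (Z → K) → Fin n → K := fun z l => if h : l ∈ Z then z ⟨l, h⟩ else 1
  have hext : ∀ w, ext (Z.restrict w) = onesOff Z w := fun w => by
    funext l
    by_cases hl : l ∈ Z <;> simp [ext, onesOff, hl]
  refine ⟨q, fun l => Z.restrict '' blownRegion c C F i j ch ∩ ext ⁻¹' D l, ?_, fun l => ?_⟩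
  · rw [← Set.inter_iUnion, ← Set.preimage_iUnion, eq_comm, Set.inter_eq_left]
    rintro _ ⟨w, hw, rfl⟩
    rw [Set.mem_preimage, hext]
    exact hcov (hann w hw)
  · obtain ⟨hβ1, hpl, hδ, hlow⟩ := hD l
    refine ⟨β l, hβ1, p l, hpl, δ l / 2, half_pos hδ, fun w hw hwl => ?_⟩
    obtain ⟨hwt, hw1⟩ := hch.dom_le w hw.2
    have hy0 : 0 < ‖mono w y‖ := norm_pos_iff.2 (mono_ne_zero hwt _)
    have hwD : onesOff Z w ∈ D l := hext w ▸ hwl.2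
    have hroom : ∀ m ∈ Z, p l * ε l ≤ ‖w m‖ := fun m hm => by
      have h1 := ((hann w hw m).1 hm).1
      have h2 : onesOff Z w m = w m := by simp [onesOff, hm]
      rw [h2] at h1
      exact (hpε l).trans h1
    obtain ⟨v₀, hv₀, hsub⟩ := herr w hw
    have h1 := hsub Z (β l) (p l) (ε l) (hε0 l) hroom
    have h2 : ‖mono (ch.γ w) v₀‖ ≤ ‖mono w y‖ := by
      rw [hmono]
      exact norm_mono_le_of_le hw1 (yExp_le hch ht hFij hv₀.2)
    have h3 : ((∑ m, ‖(β l m : K)‖) / ε l) ^ p l * (η * ‖mono (ch.γ w) v₀‖) ≤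
        δ l / 2 * ‖mono w y‖ := by
      rw [← mul_assoc]
      exact mul_le_mul (hηδ l) h2 (norm_nonneg _) (half_pos hδ).le
    have h4 := iterate_dirDeriv_factor hyZ (β l) (p l) (eval_chartPoly_factor hch ht hFij) w
    have h5 : δ l * ‖mono w y‖ ≤ ‖(dirDeriv Z (β l))^[p l]
        (fun w => MvPolynomial.eval w (chartPoly ch hFij)) w‖ := by
      rw [h4, norm_mul, mul_comm]
      exact mul_le_mul_of_nonneg_left (hlow _ hwD) (norm_nonneg _)
    have h6 : δ l / 2 * ‖mono w y‖ ≤ ‖(dirDeriv Z (β l))^[p l] (f ∘ ch.γ) w‖ := by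
      have h7 := norm_sub_norm_le ((dirDeriv Z (β l))^[p l]
        (fun w => MvPolynomial.eval w (chartPoly ch hFij)) w)
        ((dirDeriv Z (β l))^[p l] (f ∘ ch.γ) w)
      rw [norm_sub_rev] at h7
      linarith
    refine ⟨?_, h6⟩
    have h8 : (dirDeriv Z (β l))^[p l] (quotientBy f ch y) w =
        (dirDeriv Z (β l))^[p l] (f ∘ ch.γ) w / mono w y :=
      congrFun (iterate_dirDeriv_div_mono hyZ (β l) (p l) (f ∘ ch.γ)) w
    rw [h8, norm_div, le_div_iff₀ hy0]
    exact h6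

/-- The lower bound on the region of a vertex. -/
theorem eventually_lower_bound_of_zero (hU : IsOpen U) (h0U : (0 : Fin n → K) ∈ U)
    (hf : ∀ x ∈ U, HasSum (fun α : Fin n → ℕ => c α * mono x α) (f x))
    (hF : ∀ i, Set.range (F i) = compactFaces c i) {ch : Chart K n} (hch : ch.IsRegular)
    (hmono : ∀ x α, mono (ch.γ x) α = mono x (ch.L α)) (hn : 0 < n) (j : Fin (κ 0)) :
    ∀ᶠ τ : ℝ in atTop, ∀ C : ℕ → ℝ, (∀ k, 0 < k → k ≤ n → τ ≤ C k) →
      ∀ v ∈ vertices c, F 0 j = {toReal v} → ∃ δ : ℝ, 0 < δ ∧ ∀ x ∈ blownRegion c C F 0 j ch,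
        δ ≤ ‖quotientBy f ch (ch.L v) x‖ ∧ δ * ‖mono x (ch.L v)‖ ≤ ‖f (ch.γ x)‖ := by
  have hFij : F 0 j ∈ compactFaces c 0 := hF 0 ▸ Set.mem_range_self j
  obtain ⟨v, hv, hFv⟩ := eq_singleton_of_mem_compactFaces_zero hFij
  have hcv : 0 < ‖c v‖ := norm_pos_iff.2 (ne_zero_of_mem_vertices hv)
  filter_upwards [eventually_dirDeriv_sub_le hU h0U hf hF hch hmono hn j hFij (half_pos hcv) 1]
    with τ hτ C hC v' hv' hFv'
  obtain rfl : v = v' := toReal_injective (Set.singleton_injective (hFv.symm.trans hFv'))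
  refine ⟨‖c v‖ / 2, half_pos hcv, fun w hw => ?_⟩
  obtain ⟨hwt, -⟩ := hch.dom_le w hw.2
  obtain ⟨v₀, hv₀, hsub⟩ := hτ C (fun h => absurd h (lt_irrefl 0)) hC w hw
  obtain rfl : v₀ = v := toReal_injective (by have := hv₀.2; rwa [hFv] at this)
  have h1 := hsub ∅ 0 0 1 one_pos (by simp)
  have hP : MvPolynomial.eval w (chartPoly ch hFij) = c v₀ * mono w (ch.L v₀) := by
    rw [eval_chartPoly]
    have : (finite_lattice_face hFij).toFinset = {v₀} := by
      ext α
      rw [Set.Finite.mem_toFinset, Finset.mem_singleton, Set.mem_ofPred_eq, hFv,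
        Set.mem_singleton_iff]
      exact toReal_injective.eq_iff
    rw [this, Finset.sum_singleton]
  simp only [Function.iterate_zero, id, pow_zero, one_mul, Function.comp, hP] at h1
  have h2 : ‖c v₀‖ / 2 * ‖mono w (ch.L v₀)‖ ≤ ‖f (ch.γ w)‖ := by
    have h3 := norm_sub_norm_le (c v₀ * mono w (ch.L v₀)) (f (ch.γ w))
    rw [norm_sub_rev, norm_mul] at h3
    rw [hmono] at h1
    linarith
  refine ⟨?_, h2⟩
  rw [quotientBy, norm_div, le_div_iff₀ (norm_pos_iff.2 (mono_ne_zero hwt _))]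
  exact h2

end LowerBounds

end NewtonBlowup

theorem lemma3p4 {K : Type*} [NontriviallyNormedField K] [LocallyCompactSpace K] [CharZero K]
    (n : ℕ) (U : Set (Fin n → K)) (hU : IsOpen U) (h0U : (0 : Fin n → K) ∈ U)
    (f : (Fin n → K) → K) (c : (Fin n → ℕ) → K)
    (hf : ∀ x ∈ U, HasSum (fun α : Fin n → ℕ => c α * mono x α) (f x))
    (hf0 : f 0 = 0) (hc : ∃ α, c α ≠ 0)
    -- an enumeration of the compact faces of each dimension
    (κ : ℕ → ℕ) (F : (i : ℕ) → Fin (κ i) → Set (Fin n → ℝ))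
    (hF : ∀ i, Function.Injective (F i) ∧ Set.range (F i) = compactFaces c i)
    -- blowups that make the exponents of the vertices linearly ordered
    (t : BlowupTree n) (ht : t.Resolves c) :
    -- the constants increase sufficiently quickly
    ∃ T : ℝ → ℝ, ∀ C : ℕ → ℝ, T 1 < C 1 → (∀ i, 1 ≤ i → i < n → T (C i) < C (i + 1)) →
      (∀ (i : ℕ) (j : Fin (κ i)), 0 < i → ∀ ch ∈ t.charts K,
        ∃ (q : ℕ) (B : Fin q → Set (zVars c (F i j) ch → K)),
          (zVars c (F i j) ch).restrict '' blownRegion c C F i j ch = ⋃ l, B l ∧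
          ∀ l, ∃ β : zVars c (F i j) ch → ℚ, ∑ m, |β m| = 1 ∧
            ∃ p : ℕ, (p : ℕ∞) ≤ maxZeroOrder (facePoly c (F i j)) ∧
            ∃ δ : ℝ, 0 < δ ∧ ∀ x ∈ blownRegion c C F i j ch,
              (zVars c (F i j) ch).restrict x ∈ B l →
                δ ≤ ‖(dirDeriv (zVars c (F i j) ch) β)^[p]
                  (quotientBy f ch (yExp c (F i j) ch)) x‖ ∧
                δ * ‖mono x (yExp c (F i j) ch)‖ ≤
                  ‖(dirDeriv (zVars c (F i j) ch) β)^[p] (f ∘ ch.γ) x‖) ∧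
      (∀ j : Fin (κ 0), ∃ v ∈ vertices c, F 0 j = {toReal v} ∧ ∀ ch ∈ t.charts K,
        ∃ δ : ℝ, 0 < δ ∧ ∀ x ∈ blownRegion c C F 0 j ch,
          δ ≤ ‖quotientBy f ch (ch.L v) x‖ ∧ δ * ‖mono x (ch.L v)‖ ≤ ‖f (ch.γ x)‖) := by
  -- for `n = 0` the condition `f 0 = 0` makes the only coefficient vanish
  have hn : 0 < n := by
    rcases Nat.eq_zero_or_pos n with rfl | hn
    · obtain ⟨α, hα⟩ := hc
      have h1 := (hf 0 h0U).unique
        (hasSum_single α fun β hβ => absurd (Subsingleton.elim β α) hβ)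
      rw [hf0] at h1
      simp only [mono, Finset.univ_eq_empty, Finset.prod_empty, mul_one] at h1
      exact absurd h1.symm hα
    · exact hn
  have hFr := fun i => (hF i).2
  have hmem : ∀ i j, F i j ∈ compactFaces c i := fun i j => hFr i ▸ Set.mem_range_self j
  have hlt : ∀ i, Fin (κ i) → i < n := fun i j => dim_lt_of_mem_compactFaces (hmem i j) hn
  -- `T r` is large enough for all faces and charts at once, when the constant of the dimension of
  -- the face is `r`; for the vertices, which have no constant, it is `T 1` that counts
  have hT : ∀ r : ℝ, ∃ τ : ℝ, r ≤ τ ∧ 1 ≤ τ ∧ _ ∧ _ := fun r =>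
    ((Filter.eventually_ge_atTop r).and ((Filter.eventually_ge_atTop 1).and
      (((Filter.eventually_all_finset (Finset.range n)).2 fun i hi =>
        Filter.eventually_all.2 fun j : Fin (κ i) =>
        (Filter.eventually_all_finite (List.finite_toSet (t.charts K))).2 fun ch hch =>
          Filter.eventually_imp_distrib_left.2 fun hi0 : 0 < i =>
          Filter.eventually_imp_distrib_left.2 fun hr : 0 < r =>
          eventually_lower_bound_of_pos hU h0U hf hFr (isRegular_of_mem_charts t hch)
            (mono_chart t ch hch) (ht ch hch) hi0 (Finset.mem_range.1 hi) j hr).and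
      (Filter.eventually_all.2 fun j : Fin (κ 0) =>
        (Filter.eventually_all_finite (List.finite_toSet (t.charts K))).2 fun ch hch =>
          eventually_lower_bound_of_zero hU h0U hf hFr (isRegular_of_mem_charts t hch)
            (mono_chart t ch hch) hn j)))).exists
  choose T hTr hT1 hTpos hTzero using hT
  refine ⟨T, fun C hC1 hC => ?_⟩
  have hone : ∀ i, 1 ≤ i → i ≤ n → 1 < C i := fun i hi => by
    induction i, hi using Nat.le_induction with
    | base => exact fun _ => (hT1 1).trans_lt hC1
    | succ i hi ih => exact fun hin => (hT1 _).trans_lt (hC i hi (by omega))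
  have hle : ∀ i, 1 ≤ i → ∀ k, i ≤ k → k ≤ n → C i ≤ C k := fun i hi k hik => by
    induction k, hik using Nat.le_induction with
    | base => exact fun _ => le_rfl
    | succ k hik ih =>
      exact fun hkn => (ih (by omega)).trans ((hTr _).trans (hC k (by omega) (by omega)).le)
  refine ⟨fun i j hi ch hch => ?_, fun j => ?_⟩
  · have hin := hlt i j
    exact hTpos (C i) i (Finset.mem_range.2 hin) j ch hch hi
      (zero_lt_one.trans (hone i hi hin.le)) C rfl
      fun k hk hkn => (hC i hi hin).le.trans (hle (i + 1) (by omega) k hk hkn)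
  · obtain ⟨v, hv, hFv⟩ := eq_singleton_of_mem_compactFaces_zero (hmem 0 j)
    refine ⟨v, hv, hFv, fun ch hch => hTzero 1 j ch hch C (fun k hk hkn => ?_) v hv hFv⟩
    exact hC1.le.trans (hle 1 le_rfl k hk hkn)
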